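/- **Setting.** Fix non-empty finite alphabets $\Sigma_I$ (inputs) and $\Sigma_O$ (outputs). A *controller strategy* is a map $\sigma_\exists\colon(\Sigma_I\Sigma_O)^*\Sigma_I\to\Sigma_O$ and an *environment strategy* is a map $\sigma_\forall\colon(\Sigma_I\Sigma_O)^*\to\Sigma_I$; $\mathrm{Out}(\cdot)$ denotes the set of words of $(\Sigma_I\Sigma_O)^\omega$ all of whose output (respectively input) letters are the ones the strategy prescribes. A *parity automaton* over $\Sigma_I\cup\Sigma_O$ is $\langle S,s_0,\Delta,\chi\rangle$ with $S$ finite, $s_0\in S$, $\Delta\subseteq S\times(\Sigma_I\cup\Sigma_O)\times S$ and $\chi\colon S\to\mathbb N$; it accepts an infinite word if that word labels a path from $s_0$ on which the smallest colour seen infinitely often is even. It is *deterministic* if each state has at most one successor for each letter. Specifications and assumptions are $\omega$-regular sets $L,A\subseteq(\Sigma_I\Sigma_O)^\omega$, i.e. languages of parity automata. An assumption $A$ is *sufficient* for $L$ if $\mathrm{Out}(\sigma_\exists)\cap A\subseteq L$ for some controller strategy $\sigma_\exists$. It is *ensurable* if for every $w\in(\Sigma_I\Sigma_O)^*$ with $w(\Sigma_I\Sigma_O)^\omega\cap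 A\neq\varnothing$ there is an environment strategy $\sigma_\forall$ with $w(\Sigma_I\Sigma_O)^\omega\cap\mathrm{Out}(\sigma_\forall)\neq\varnothing$ and $\mathrm{Out}(\sigma_\forall)\subseteq A$. It is *ensurable-optimal* for $L$ if it is ensurable and sufficient for $L$, and no ensurable assumption $B\supsetneq A$ is sufficient for $L$. Algorithms are programs of a unit-cost random access machine on natural numbers with addition and truncated subtraction. Automata (parity games) are given by the list of their number of states (vertices), initial state (owners of the vertices), colours, and the $0/1$ table of the transition (edge) relation; the size of such a list is the total length of the binary representations of its entries plus its number of entries. An *oracle for memoryless winning strategies in parity games* is a function that maps each finite parity game without dead ends (min-even condition) to some memoryless strategy of the controller that is winning from every vertex from which the controller has a winning strategy; a call costs one step plus the lengths of the query and of the answer. **Theorem.** 1. There are an algorithm and polynomials $p,q$ such that, given any deterministic parity automaton $\mathcal A$ of size $n$ that recognises a specification $L\subseteq(\Sigma_I\Sigma_O)^\omega$, the algorithm outputs, in time at most $2^{p(n)}$, a deterministic parity automaton of size at most $q(n)$ that recognises an ensurable-optimal assumption for $L$. 2. There are an oracle algorithm and polynomials $p,q$ such that, for every oracle for memoryless winning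 strategies in parity games and every $\mathcal A$, $n$, $L$ as in 1, the algorithm with this oracle outputs, in time at most $p(n)$, a deterministic parity automaton of size at most $q(n)$ that recognises an ensurable-optimal assumption for $L$. -/

import Mathlib

open Filter

namespace Ensurable

/-! ### Words, strategies and outcomes

An element of `(Σ_I · Σ_O)^ω` is a sequence of pairs (input signal, output signal), and an element
of `(Σ_I · Σ_O)^*` is a list of such pairs. -/

section Strategies

variable {I O : Type}

/-- The finite word made of the first `k` letters of `w`. -/
def pre {α : Type} (w : ℕ → α) (k : ℕ) : List α := (List.range k).map w

/-- The infinite word `i₀ o₀ i₁ o₁ …` over `Σ_I ∪ Σ_O` spelled by a sequence of pairs. -/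
def flat (w : ℕ → I × O) (j : ℕ) : I ⊕ O :=
  if Even j then Sum.inl (w (j / 2)).1 else Sum.inr (w (j / 2)).2

/-- A strategy of the controller, `(Σ_I · Σ_O)^* · Σ_I → Σ_O`. -/
abbrev Strategy (I O : Type) : Type := List (I × O) → I → O

/-- A strategy of the environment, `(Σ_I · Σ_O)^* → Σ_I`. -/
abbrev EnvStrategy (I O : Type) : Type := List (I × O) → I

/-- The outcomes of a strategy of the controller. -/
def Out (σ : Strategy I O) : Set (ℕ → I × O) :=
  {w | ∀ i, (w i).2 = σ (pre w i) (w i).1}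

/-- The outcomes of a strategy of the environment. -/
def EnvOut (τ : EnvStrategy I O) : Set (ℕ → I × O) :=
  {w | ∀ i, (w i).1 = τ (pre w i)}

/-- The cone `h · (Σ_I · Σ_O)^ω`. -/
def Cone (h : List (I × O)) : Set (ℕ → I × O) := {w | pre w h.length = h}

/-- `A` is sufficient for `L`: some strategy of the controller has all its outcomes that lie in `A`
inside `L`. -/
def Sufficient (A L : Set (ℕ → I × O)) : Prop :=
  ∃ σ : Strategy I O, Out σ ∩ A ⊆ L

/-- `A` is ensurable: whenever `h` can be extended to a word of `A`, the environment has a strategy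
that is compatible with `h` and all of whose outcomes are in `A`. -/
def IsEnsurable (A : Set (ℕ → I × O)) : Prop :=
  ∀ h : List (I × O), (Cone h ∩ A).Nonempty →
    ∃ τ : EnvStrategy I O, (Cone h ∩ EnvOut τ).Nonempty ∧ EnvOut τ ⊆ A

end Strategies

/-! ### Parity automata -/

/-- The (min-even) parity condition: the smallest colour seen infinitely often is even. -/
def ParityAccepts (c : ℕ → ℕ) : Prop :=
  ∃ k, Even k ∧ IsLeast {k | ∃ᶠ i in atTop, c i = k} k

/-- A (possibly nondeterministic, possibly incomplete) parity automaton over the alphabet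
`Σ_I ∪ Σ_O`, where `Σ_I` has `kI` symbols and `Σ_O` has `kO` symbols. -/
structure ParityAutomaton (kI kO : ℕ) where
  n : ℕ
  start : Fin n
  trans : Fin n → Fin kI ⊕ Fin kO → Fin n → Bool
  color : Fin n → ℕ

namespace ParityAutomaton

variable {kI kO : ℕ}

/-- The set of infinite words over `Σ_I ∪ Σ_O` that label an accepting path. -/
def language (A : ParityAutomaton kI kO) : Set (ℕ → Fin kI ⊕ Fin kO) :=
  {v | ∃ ρ : ℕ → Fin A.n, ρ 0 = A.start ∧
    (∀ i, A.trans (ρ i) (v i) (ρ (i + 1)) = true) ∧ ParityAccepts fun i => A.color (ρ i)}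

/-- `A` recognises `X ⊆ (Σ_I · Σ_O)^ω`: the words that it accepts are exactly those of `X`; in
particular it accepts only words in which inputs and outputs alternate. -/
def Recognises (A : ParityAutomaton kI kO) (X : Set (ℕ → Fin kI × Fin kO)) : Prop :=
  A.language = flat '' X

/-- At most one transition for each state and letter. -/
def Deterministic (A : ParityAutomaton kI kO) : Prop :=
  ∀ s a t t', A.trans s a t = true → A.trans s a t' = true → t = t'

/-- All letters, inputs first. -/
def letters (kI kO : ℕ) : List (Fin kI ⊕ Fin kO) :=
  (List.finRange kI).map Sum.inl ++ (List.finRange kO).map Sum.inr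

/-- The representation of an automaton as a list of numbers: number of states, initial state,
colours, and the 0/1 table of the transition relation. -/
def encode (A : ParityAutomaton kI kO) : List ℕ :=
  A.n :: (A.start : ℕ) :: (List.ofFn A.color ++
    (List.finRange A.n).flatMap fun s => (letters kI kO).flatMap fun a =>
      (List.finRange A.n).map fun t => (A.trans s a t).toNat)

end ParityAutomaton

/-- An assumption (or specification) is an `ω`-regular subset of `(Σ_I · Σ_O)^ω`. -/
def IsOmegaRegular {kI kO : ℕ} (X : Set (ℕ → Fin kI × Fin kO)) : Prop :=
  ∃ A : ParityAutomaton kI kO, A.Recognises X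

/-- `H` is an ensurable-optimal assumption for `L`: it is an ensurable assumption, sufficient
for `L`, and no ensurable assumption that strictly contains `H` is sufficient for `L`. -/
def IsEnsurableOptimal {kI kO : ℕ} (L H : Set (ℕ → Fin kI × Fin kO)) : Prop :=
  IsOmegaRegular H ∧ IsEnsurable H ∧ Sufficient H L ∧
    ¬ ∃ B : Set (ℕ → Fin kI × Fin kO),
      IsOmegaRegular B ∧ IsEnsurable B ∧ Sufficient B L ∧ H ⊂ B

/-! ### Parity games -/

/-- A parity game on a finite graph without dead ends; `owner v = true` means that the controller
moves at `v`. -/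
structure ParityGame where
  n : ℕ
  owner : Fin n → Bool
  edge : Fin n → Fin n → Bool
  color : Fin n → ℕ
  total : ∀ v, ∃ u, edge v u = true

namespace ParityGame

variable (G : ParityGame)

/-- A (history dependent) strategy of the controller, given the vertices visited before and the
current vertex, is legal if it always picks an edge. -/
def Legal (τ : List (Fin G.n) → Fin G.n → Fin G.n) : Prop :=
  ∀ h v, G.owner v = true → G.edge v (τ h v) = true

/-- Every play from `v` that is consistent with `τ` satisfies the parity condition. -/
def WinsFrom (τ : List (Fin G.n) → Fin G.n → Fin G.n) (v : Fin G.n) : Prop :=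
  ∀ ρ : ℕ → Fin G.n, ρ 0 = v → (∀ i, G.edge (ρ i) (ρ (i + 1)) = true) →
    (∀ i, G.owner (ρ i) = true → ρ (i + 1) = τ (pre ρ i) (ρ i)) →
    ParityAccepts fun i => G.color (ρ i)

/-- The vertices from which the controller has a winning strategy. -/
def WinRegion : Set (Fin G.n) := {v | ∃ τ, G.Legal τ ∧ G.WinsFrom τ v}

/-- `s` is a memoryless strategy that is winning from every vertex of the winning region. -/
def IsMemorylessWinning (s : Fin G.n → Fin G.n) : Prop :=
  G.Legal (fun _ => s) ∧ ∀ v ∈ G.WinRegion, G.WinsFrom (fun _ => s) v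

/-- The representation of a game as a list of numbers: number of vertices, owners, colours, and
the adjacency matrix. -/
def encode : List ℕ :=
  G.n :: (List.ofFn (fun v => (G.owner v).toNat) ++ List.ofFn G.color ++
    (List.finRange G.n).flatMap fun v => (List.finRange G.n).map fun u => (G.edge v u).toNat)

end ParityGame

/-- `f` is an oracle for computing memoryless winning strategies in parity games: on every game it
answers with the table of such a strategy. -/
def IsParityOracle (f : List ℕ → List ℕ) : Prop :=
  ∀ G : ParityGame, ∃ s : Fin G.n → Fin G.n,
    G.IsMemorylessWinning s ∧ f G.encode = List.ofFn fun v => (s v : ℕ)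

/-! ### Machine model

A random access machine at unit cost whose only arithmetic is addition and (truncated) subtraction,
programmed with structured control flow. A program uses finitely many registers and finitely many
arrays, which hold natural numbers. -/

/-- The memory: registers and arrays. -/
structure Mem where
  reg : ℕ → ℕ
  arr : ℕ → ℕ → ℕ

namespace Mem

/-- Assign `v` to register `x`. -/
def setReg (m : Mem) (x v : ℕ) : Mem := { m with reg := Function.update m.reg x v }

/-- Replace the whole array `a`. -/
def setArr (m : Mem) (a : ℕ) (g : ℕ → ℕ) : Mem := { m with arr := Function.update m.arr a g }

/-- The initial segment of length `k` of array `a`. -/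
def read (m : Mem) (a k : ℕ) : List ℕ := (List.range k).map (m.arr a)

/-- The initial memory on input `l`: array `0` holds `l`, register `0` holds its length, and
everything else is zero. -/
def input (l : List ℕ) : Mem where
  reg x := if x = 0 then l.length else 0
  arr a i := if a = 0 then l.getD i 0 else 0

/-- The result left in memory: array `0`, up to the length in register `0`. -/
def output (m : Mem) : List ℕ := m.read 0 (m.reg 0)

end Mem

/-- Programs. -/
inductive Prog
  /-- `x := k` -/
  | const (x k : ℕ)
  /-- `x := y` -/
  | copy (x y : ℕ)
  /-- `x := y + z` -/
  | add (x y z : ℕ)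
  /-- `x := y - z`, truncated at zero -/
  | sub (x y z : ℕ)
  /-- `x := a[y]` -/
  | load (x a y : ℕ)
  /-- `a[x] := y` -/
  | store (a x y : ℕ)
  /-- `p; q` -/
  | seq (p q : Prog)
  /-- `if x ≠ 0 then p else q` -/
  | cond (x : ℕ) (p q : Prog)
  /-- `while x ≠ 0 do p` -/
  | loop (x : ℕ) (p : Prog)
  /-- put the oracle's answer to the query `a[0], …, a[x-1]` into array `b`, and the length of
  this answer into register `y` -/
  | query (a x b y : ℕ)

/-- The program never calls the oracle. -/
def Prog.OracleFree : Prog → Prop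
  | .seq p q => p.OracleFree ∧ q.OracleFree
  | .cond _ p q => p.OracleFree ∧ q.OracleFree
  | .loop _ p => p.OracleFree
  | .query _ _ _ _ => False
  | _ => True

/-- `Exec f p m m' t`: with oracle `f`, the program `p` started in memory `m` halts in memory `m'`
after `t` steps. Each instruction and each test is one step; an oracle call costs one step and
the lengths of the query and of the answer. -/
inductive Exec (f : List ℕ → List ℕ) : Prog → Mem → Mem → ℕ → Prop
  | const (x k : ℕ) (m : Mem) : Exec f (.const x k) m (m.setReg x k) 1
  | copy (x y : ℕ) (m : Mem) : Exec f (.copy x y) m (m.setReg x (m.reg y)) 1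
  | add (x y z : ℕ) (m : Mem) : Exec f (.add x y z) m (m.setReg x (m.reg y + m.reg z)) 1
  | sub (x y z : ℕ) (m : Mem) : Exec f (.sub x y z) m (m.setReg x (m.reg y - m.reg z)) 1
  | load (x a y : ℕ) (m : Mem) : Exec f (.load x a y) m (m.setReg x (m.arr a (m.reg y))) 1
  | store (a x y : ℕ) (m : Mem) :
      Exec f (.store a x y) m
        (m.setArr a (Function.update (m.arr a) (m.reg x) (m.reg y))) 1
  | seq {p q : Prog} {m₁ m₂ m₃ : Mem} {t₁ t₂ : ℕ} (h₁ : Exec f p m₁ m₂ t₁)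
      (h₂ : Exec f q m₂ m₃ t₂) : Exec f (.seq p q) m₁ m₃ (t₁ + t₂)
  | condTrue {x : ℕ} {p q : Prog} {m m' : Mem} {t : ℕ} (hx : m.reg x ≠ 0)
      (h : Exec f p m m' t) : Exec f (.cond x p q) m m' (t + 1)
  | condFalse {x : ℕ} {p q : Prog} {m m' : Mem} {t : ℕ} (hx : m.reg x = 0)
      (h : Exec f q m m' t) : Exec f (.cond x p q) m m' (t + 1)
  | loopDone {x : ℕ} {p : Prog} {m : Mem} (hx : m.reg x = 0) : Exec f (.loop x p) m m 1
  | loopStep {x : ℕ} {p : Prog} {m₁ m₂ m₃ : Mem} {t₁ t₂ : ℕ} (hx : m₁.reg x ≠ 0)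
      (h₁ : Exec f p m₁ m₂ t₁) (h₂ : Exec f (.loop x p) m₂ m₃ t₂) :
      Exec f (.loop x p) m₁ m₃ (t₁ + t₂ + 1)
  | query (a x b y : ℕ) (m : Mem) :
      Exec f (.query a x b y) m
        ((m.setArr b fun i => (f (m.read a (m.reg x))).getD i 0).setReg y
          (f (m.read a (m.reg x))).length)
        (1 + m.reg x + (f (m.read a (m.reg x))).length)

/-- On input `l` and with oracle `f`, the program `p` halts within `T` steps with output `l'`. -/
def OutputsWithin (f : List ℕ → List ℕ) (p : Prog) (l l' : List ℕ) (T : ℕ) : Prop :=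
  ∃ m' t, Exec f p (Mem.input l) m' t ∧ t ≤ T ∧ m'.output = l'

/-- The size of a list of numbers: the total length of their binary representations, plus one
separator for each. -/
def size (l : List ℕ) : ℕ := (l.map fun k => Nat.size k + 1).sum

end Ensurable

/-!
An ensurable-optimal assumption is obtained from a single strategy `σ` of the controller in the
parity game of the given automaton, in which the environment chooses inputs and the controller
chooses outputs. Where the controller can win, `σ` follows a positional winning strategy; elsewhere
it cooperates, that is, it moves along a path that satisfies the parity condition whenever there is
one. The assumption `assumptionOf σ L` consists of the words such that, as long as they conform to
`σ`, each input can still be continued to an outcome of `σ` in `L`, and that are in `L` if they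
conform to `σ` forever. It is ensurable and, by means of `σ`, sufficient
(`isEnsurable_assumptionOf`, `sufficient_assumptionOf`). It is optimal
(`eq_assumptionOf_of_subset`): let `B` be a larger ensurable assumption, sufficient by means of
`σ'`. Suppose that `σ'` first departs from `σ` on a word of `B` along which every input so far can
be continued to an outcome of `σ` in `L`. Then all words that go on with the deviating output are in
the assumption, hence in `B`, so `σ'` wins from there on, and then `σ` wins there as well. Where
`σ'` has not departed from `σ`, ensurability of `B` yields a continuation in `L`. As `σ` wins
wherever that is possible and cooperates elsewhere, words of `B` satisfy both clauses above. A
deterministic automaton for the assumption is the given one with one additional component, for the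
words that have departed from `σ` (`Solution.isEnsurableOptimal`).

What has to be computed is therefore the winning region with winning strategies for both players,
and the set of vertices with an accepting path. All of this can be read off one memoryless winning
strategy in a parity game of linear size, `bigGame`: the disjoint union of the game, of the game in
which the controller makes all moves, and of the duals of these two, together with vertices at which
the controller chooses between a vertex and its dual. By determinacy (`exists_solves`, Zielonka's
theorem) one of the two alternatives is winning, so the choice of a winning strategy tells which one
(`solution_of_bigGame`). With an oracle this takes one query; without, the memoryless strategies are
searched exhaustively, where against each of them it suffices to try the memoryless
counter-strategies (`ParityGame.winsFrom_iff`).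

For the machine model, expressions with bounded loops are compiled to programs
(`Expr.runs_compile`). All loops are capped by a number `M`, so the running time of an expression is
at most a polynomial in `M` that depends on the expression only; it remains to choose `M` polynomial
in the size of the input, or exponential for the exhaustive search (`algorithm_correct`,
`solvesGames_search`).
-/

namespace Ensurable

/-! ### A calculus for the running time of programs -/

/-- Started in `m` with oracle `f`, the program `p` halts within `c` steps in a memory that
satisfies `Q`. -/
def Runs (f : List ℕ → List ℕ) (p : Prog) (m : Mem) (c : ℕ) (Q : Mem → Prop) : Prop :=
  ∃ m' t, Exec f p m m' t ∧ t ≤ c ∧ Q m'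

namespace Runs

variable {f : List ℕ → List ℕ} {m : Mem} {c c₁ c₂ : ℕ} {Q R : Mem → Prop} {p q : Prog}

theorem mono (h : Runs f p m c₁ R) (hc : c₁ ≤ c) (hQ : ∀ m', R m' → Q m') : Runs f p m c Q := by
  obtain ⟨m', t, he, ht, hR⟩ := h
  exact ⟨m', t, he, ht.trans hc, hQ _ hR⟩

theorem const {x k : ℕ} (h : Q (m.setReg x k)) : Runs f (.const x k) m 1 Q :=
  ⟨_, _, .const x k m, le_rfl, h⟩

theorem copy {x y : ℕ} (h : Q (m.setReg x (m.reg y))) : Runs f (.copy x y) m 1 Q :=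
  ⟨_, _, .copy x y m, le_rfl, h⟩

theorem add {x y z : ℕ} (h : Q (m.setReg x (m.reg y + m.reg z))) : Runs f (.add x y z) m 1 Q :=
  ⟨_, _, .add x y z m, le_rfl, h⟩

theorem sub {x y z : ℕ} (h : Q (m.setReg x (m.reg y - m.reg z))) : Runs f (.sub x y z) m 1 Q :=
  ⟨_, _, .sub x y z m, le_rfl, h⟩

theorem load {x a y : ℕ} (h : Q (m.setReg x (m.arr a (m.reg y)))) : Runs f (.load x a y) m 1 Q :=
  ⟨_, _, .load x a y m, le_rfl, h⟩

theorem store {a x y : ℕ}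
    (h : Q (m.setArr a (Function.update (m.arr a) (m.reg x) (m.reg y)))) :
    Runs f (.store a x y) m 1 Q :=
  ⟨_, _, .store a x y m, le_rfl, h⟩

theorem seq (h : Runs f p m c₁ fun m' => Runs f q m' c₂ Q) : Runs f (.seq p q) m (c₁ + c₂) Q := by
  obtain ⟨m₁, t₁, he₁, ht₁, m₂, t₂, he₂, ht₂, hQ⟩ := h
  exact ⟨m₂, _, .seq he₁ he₂, Nat.add_le_add ht₁ ht₂, hQ⟩

theorem cond {x : ℕ} (h₁ : m.reg x ≠ 0 → Runs f p m c₁ Q) (h₂ : m.reg x = 0 → Runs f q m c₂ Q) :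
    Runs f (.cond x p q) m (c₁ + c₂ + 1) Q := by
  by_cases hx : m.reg x = 0
  · obtain ⟨m', t, he, ht, hQ⟩ := h₂ hx
    exact ⟨m', _, .condFalse hx he, by omega, hQ⟩
  · obtain ⟨m', t, he, ht, hQ⟩ := h₁ hx
    exact ⟨m', _, .condTrue hx he, by omega, hQ⟩

/-- The rule for a loop whose counter register `x` holds the number of rounds still to go. -/
theorem loop {x : ℕ} (Inv : ℕ → Mem → Prop) (hreg : ∀ k m, Inv k m → m.reg x = k)
    (hstep : ∀ k m, Inv (k + 1) m → Runs f p m c (Inv k)) (k : ℕ) (m : Mem) (h : Inv k m) :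
    Runs f (.loop x p) m (k * (c + 1) + 1) (Inv 0) := by
  induction k generalizing m with
  | zero => exact ⟨m, 1, .loopDone (hreg _ _ h), by omega, h⟩
  | succ k ih =>
    obtain ⟨m₁, t₁, he₁, ht₁, h₁⟩ := hstep k m h
    obtain ⟨m₂, t₂, he₂, ht₂, h₂⟩ := ih m₁ h₁
    refine ⟨m₂, _, .loopStep (by rw [hreg _ _ h]; omega) he₁ he₂, ?_, h₂⟩
    have : (k + 1) * (c + 1) = k * (c + 1) + (c + 1) := by ring
    omega

end Runs

@[simp] theorem Mem.reg_setReg (m : Mem) (x v y : ℕ) :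
    (m.setReg x v).reg y = if y = x then v else m.reg y := by
  simp [Mem.setReg, Function.update_apply]

@[simp] theorem Mem.arr_setReg (m : Mem) (x v : ℕ) : (m.setReg x v).arr = m.arr := rfl

@[simp] theorem Mem.reg_setArr (m : Mem) (a : ℕ) (g : ℕ → ℕ) : (m.setArr a g).reg = m.reg := rfl

@[simp] theorem Mem.arr_setArr (m : Mem) (a : ℕ) (g : ℕ → ℕ) :
    (m.setArr a g).arr = Function.update m.arr a g := rfl

/-! ### Expressions with bounded loops -/

/-- Expressions over named variables and arrays. Their only loops are bounded sums and bounded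
iterations; the binders are `let2` (simultaneous local definition of two variables), `sum` and
`iter`. -/
inductive Expr
  | const (k : ℕ)
  | var (x : ℕ)
  | add (a b : Expr)
  | sub (a b : Expr)
  | load (a : ℕ) (e : Expr)
  | ite (c a b : Expr)
  | let2 (x : ℕ) (a : Expr) (y : ℕ) (b e : Expr)
  | sum (x : ℕ) (b e : Expr)
  | iter (x : ℕ) (b i e : Expr)

namespace Expr

/-- The value of an expression. The number of rounds of each loop is capped at `M`; this makes the
running time a function of `M` alone, and is harmless where the bounds are known to be at most
`M`. -/
def eval (α : ℕ → ℕ → ℕ) (M : ℕ) : Expr → (ℕ → ℕ) → ℕ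
  | const k, _ => k
  | var x, ρ => ρ x
  | add a b, ρ => a.eval α M ρ + b.eval α M ρ
  | sub a b, ρ => a.eval α M ρ - b.eval α M ρ
  | load a e, ρ => α a (e.eval α M ρ)
  | ite c a b, ρ => if c.eval α M ρ ≠ 0 then a.eval α M ρ else b.eval α M ρ
  | let2 x a y b e, ρ =>
    e.eval α M (Function.update (Function.update ρ x (a.eval α M ρ)) y (b.eval α M ρ))
  | sum x b e, ρ =>
    ∑ j ∈ Finset.range (min (b.eval α M ρ) M), e.eval α M (Function.update ρ x j)
  | iter x b i e, ρ =>
    (fun v => e.eval α M (Function.update ρ x v))^[min (b.eval α M ρ) M] (i.eval α M ρ)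

/-- A strict upper bound for the names of the variables of an expression. -/
def vars : Expr → ℕ
  | const _ => 0
  | var x => x + 1
  | add a b => max a.vars b.vars
  | sub a b => max a.vars b.vars
  | load _ e => e.vars
  | ite c a b => max c.vars (max a.vars b.vars)
  | let2 x a y b e => max (max (x + 1) (y + 1)) (max a.vars (max b.vars e.vars))
  | sum x b e => max (x + 1) (max b.vars e.vars)
  | iter x b i e => max (x + 1) (max b.vars (max i.vars e.vars))

/-- The program that leaves the value of an expression in register `d`. Variable `x` lives in
register `x + 2`, the cap for loops in register `1`; registers from `d` on are scratch space. -/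
def compile : Expr → ℕ → Prog
  | const k, d => .const d k
  | var x, d => .copy d (x + 2)
  | add a b, d => .seq (a.compile d) (.seq (b.compile (d + 1)) (.add d d (d + 1)))
  | sub a b, d => .seq (a.compile d) (.seq (b.compile (d + 1)) (.sub d d (d + 1)))
  | load a e, d => .seq (e.compile d) (.load d a d)
  | ite c a b, d => .seq (c.compile d) (.cond d (a.compile d) (b.compile d))
  | let2 x a y b e, d =>
    .seq (a.compile d) (.seq (b.compile (d + 1)) (.seq (.copy (d + 2) (x + 2))
      (.seq (.copy (d + 3) (y + 2)) (.seq (.copy (x + 2) d) (.seq (.copy (y + 2) (d + 1))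
        (.seq (e.compile (d + 4)) (.seq (.copy (y + 2) (d + 3)) (.seq (.copy (x + 2) (d + 2))
          (.copy d (d + 4))))))))))
  | sum x b e, d =>
    .seq (b.compile d) (.seq (.sub d 1 d) (.seq (.sub d 1 d) (.seq (.copy (d + 1) (x + 2))
      (.seq (.const (d + 2) 0) (.seq (.const (d + 3) 0) (.seq (.const (d + 4) 1)
        (.seq (.loop d (.seq (.copy (x + 2) (d + 2)) (.seq (e.compile (d + 5))
            (.seq (.add (d + 3) (d + 3) (d + 5)) (.seq (.add (d + 2) (d + 2) (d + 4))
              (.sub d d (d + 4)))))))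
          (.seq (.copy (x + 2) (d + 1)) (.copy d (d + 3))))))))))
  | iter x b i e, d =>
    .seq (b.compile d) (.seq (.sub d 1 d) (.seq (.sub d 1 d) (.seq (i.compile (d + 1))
      (.seq (.copy (d + 2) (x + 2)) (.seq (.const (d + 3) 1)
        (.seq (.loop d (.seq (.copy (x + 2) (d + 1)) (.seq (e.compile (d + 4))
            (.seq (.copy (d + 1) (d + 4)) (.sub d d (d + 3))))))
          (.seq (.copy (x + 2) (d + 2)) (.copy d (d + 1)))))))))

/-- A bound for the running time of the compiled expression, as a polynomial in the cap for
loops. -/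
noncomputable def cost : Expr → Polynomial ℕ
  | const _ => 1
  | var _ => 1
  | add a b => a.cost + b.cost + 1
  | sub a b => a.cost + b.cost + 1
  | load _ e => e.cost + 1
  | ite c a b => c.cost + a.cost + b.cost + 1
  | let2 _ a _ b e => a.cost + b.cost + e.cost + 7
  | sum _ b e => b.cost + Polynomial.X * (e.cost + 5) + 9
  | iter _ b i e => b.cost + i.cost + Polynomial.X * (e.cost + 4) + 7

theorem oracleFree_compile (e : Expr) (d : ℕ) : (e.compile d).OracleFree := by
  induction e generalizing d <;> simp_all [compile, Prog.OracleFree]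

/-- The compiled expression `e` delivers the value of `e` in register `d`, leaves the arrays and
all registers below `d` unchanged, and keeps to the time bound. -/
theorem runs_compile (f : List ℕ → List ℕ) (e : Expr) :
    ∀ (d : ℕ) (m : Mem) (ρ : ℕ → ℕ), e.vars + 2 ≤ d → (∀ x < e.vars, m.reg (x + 2) = ρ x) →
      Runs f (e.compile d) m (e.cost.eval (m.reg 1)) fun m' =>
        m'.arr = m.arr ∧ (∀ x < d, m'.reg x = m.reg x) ∧
          m'.reg d = e.eval m.arr (m.reg 1) ρ := by
  induction e with
  | const k =>
    intro d m ρ hd hρ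
    refine (Runs.const ?_).mono (by simp [cost]) fun _ h => h
    exact ⟨rfl, fun x hx => by simp [hx.ne], by simp [eval]⟩
  | var y =>
    intro d m ρ hd hρ
    simp only [vars] at hd hρ
    refine (Runs.copy ?_).mono (by simp [cost]) fun _ h => h
    exact ⟨rfl, fun x hx => by simp [hx.ne], by simpa [eval] using hρ y (by omega)⟩
  | add a b iha ihb =>
    intro d m ρ hd hρ
    simp only [vars] at hd hρ
    refine Runs.mono (c₁ := a.cost.eval (m.reg 1) + (b.cost.eval (m.reg 1) + 1))
      (Runs.seq ((iha d m ρ (by omega) fun x hx => hρ x (by omega)).mono le_rfl ?_))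
      (by simp [cost]; omega) fun _ h => h
    rintro m₁ ⟨ha₁, hr₁, hv₁⟩
    have e1 : m₁.reg 1 = m.reg 1 := hr₁ 1 (by omega)
    refine Runs.seq ((ihb (d + 1) m₁ ρ (by omega) fun x hx => ?_).mono (by rw [e1]) ?_)
    · rw [hr₁ _ (by omega), hρ _ (by omega)]
    rintro m₂ ⟨ha₂, hr₂, hv₂⟩
    refine Runs.add ⟨?_, fun x hx => ?_, ?_⟩
    · rw [Mem.arr_setReg, ha₂, ha₁]
    · rw [Mem.reg_setReg, if_neg hx.ne, hr₂ _ (by omega), hr₁ _ hx]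
    · rw [Mem.reg_setReg, if_pos rfl, hr₂ _ (by omega), hv₁, hv₂, ha₁, e1, eval]
  | sub a b iha ihb =>
    intro d m ρ hd hρ
    simp only [vars] at hd hρ
    refine Runs.mono (c₁ := a.cost.eval (m.reg 1) + (b.cost.eval (m.reg 1) + 1))
      (Runs.seq ((iha d m ρ (by omega) fun x hx => hρ x (by omega)).mono le_rfl ?_))
      (by simp [cost]; omega) fun _ h => h
    rintro m₁ ⟨ha₁, hr₁, hv₁⟩
    have e1 : m₁.reg 1 = m.reg 1 := hr₁ 1 (by omega)
    refine Runs.seq ((ihb (d + 1) m₁ ρ (by omega) fun x hx => ?_).mono (by rw [e1]) ?_)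
    · rw [hr₁ _ (by omega), hρ _ (by omega)]
    rintro m₂ ⟨ha₂, hr₂, hv₂⟩
    refine Runs.sub ⟨?_, fun x hx => ?_, ?_⟩
    · rw [Mem.arr_setReg, ha₂, ha₁]
    · rw [Mem.reg_setReg, if_neg hx.ne, hr₂ _ (by omega), hr₁ _ hx]
    · rw [Mem.reg_setReg, if_pos rfl, hr₂ _ (by omega), hv₁, hv₂, ha₁, e1, eval]
  | load a e ih =>
    intro d m ρ hd hρ
    simp only [vars] at hd hρ
    refine Runs.mono (c₁ := e.cost.eval (m.reg 1) + 1)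
      (Runs.seq ((ih d m ρ (by omega) fun x hx => hρ x (by omega)).mono le_rfl ?_))
      (by simp [cost]) fun _ h => h
    rintro m₁ ⟨ha₁, hr₁, hv₁⟩
    refine Runs.load ⟨?_, fun x hx => ?_, ?_⟩
    · rw [Mem.arr_setReg, ha₁]
    · rw [Mem.reg_setReg, if_neg hx.ne, hr₁ _ hx]
    · rw [Mem.reg_setReg, if_pos rfl, hv₁, ha₁, eval]
  | ite c a b ihc iha ihb =>
    intro d m ρ hd hρ
    simp only [vars] at hd hρ
    refine Runs.mono (c₁ := c.cost.eval (m.reg 1) +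
        (a.cost.eval (m.reg 1) + b.cost.eval (m.reg 1) + 1))
      (Runs.seq ((ihc d m ρ (by omega) fun x hx => hρ x (by omega)).mono le_rfl ?_))
      (by simp [cost]; omega) fun _ h => h
    rintro m₁ ⟨ha₁, hr₁, hv₁⟩
    have e1 : m₁.reg 1 = m.reg 1 := hr₁ 1 (by omega)
    refine Runs.cond (fun hx => ?_) (fun hx => ?_)
    · refine ((iha d m₁ ρ (by omega) fun x hx => ?_).mono (by rw [e1]) ?_)
      · rw [hr₁ _ (by omega), hρ _ (by omega)]
      · rintro m₂ ⟨ha₂, hr₂, hv₂⟩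
        refine ⟨by rw [ha₂, ha₁], fun x hx => by rw [hr₂ x hx, hr₁ x hx], ?_⟩
        rw [eval, if_pos (by rwa [← hv₁]), hv₂, ha₁, e1]
    · refine ((ihb d m₁ ρ (by omega) fun x hx => ?_).mono (by rw [e1]) ?_)
      · rw [hr₁ _ (by omega), hρ _ (by omega)]
      · rintro m₂ ⟨ha₂, hr₂, hv₂⟩
        refine ⟨by rw [ha₂, ha₁], fun x hx => by rw [hr₂ x hx, hr₁ x hx], ?_⟩
        rw [eval, if_neg (by rw [← hv₁, hx]; simp), hv₂, ha₁, e1]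
  | let2 x a y b e iha ihb ihe =>
    intro d m ρ hd hρ
    simp only [vars] at hd hρ
    refine Runs.mono (c₁ := a.cost.eval (m.reg 1) + (b.cost.eval (m.reg 1) +
        (1 + (1 + (1 + (1 + (e.cost.eval (m.reg 1) + (1 + (1 + 1)))))))))
      (Runs.seq ((iha d m ρ (by omega) fun x hx => hρ x (by omega)).mono le_rfl ?_))
      (by simp [cost]; omega) fun _ h => h
    rintro m₁ ⟨ha₁, hr₁, hv₁⟩
    have e1 : m₁.reg 1 = m.reg 1 := hr₁ 1 (by omega)
    refine Runs.seq ((ihb (d + 1) m₁ ρ (by omega) fun x hx => ?_).mono (by rw [e1]) ?_)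
    · rw [hr₁ _ (by omega), hρ _ (by omega)]
    rintro m₂ ⟨ha₂, hr₂, hv₂⟩
    have e2 : m₂.reg 1 = m.reg 1 := by rw [hr₂ 1 (by omega), e1]
    have hlow : ∀ z < d, m₂.reg z = m.reg z := fun z hz => by rw [hr₂ z (by omega), hr₁ z hz]
    have hval : m₂.reg d = a.eval m.arr (m.reg 1) ρ := by rw [hr₂ d (by omega), hv₁]
    have hval' : m₂.reg (d + 1) = b.eval m.arr (m.reg 1) ρ := by rw [hv₂, ha₁, e1]
    have harr : m₂.arr = m.arr := by rw [ha₂, ha₁]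
    refine Runs.seq (Runs.copy (Runs.seq (Runs.copy (Runs.seq (Runs.copy (Runs.seq (Runs.copy
      (Runs.seq ((ihe (d + 4) _ (Function.update (Function.update ρ x (a.eval m.arr (m.reg 1) ρ)) y
        (b.eval m.arr (m.reg 1) ρ)) (by omega) fun z hz => ?_).mono ?_ ?_)))))))))
    · simp only [Mem.reg_setReg, Function.update_apply, hval', hval, Nat.add_right_cancel_iff]
      have := hlow (z + 2) (by omega)
      have := hρ z (by omega)
      split_ifs <;> omega
    · simp only [Mem.reg_setReg]
      rw [if_neg (by omega), if_neg (by omega), if_neg (by omega), if_neg (by omega), e2]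
    rintro m₃ ⟨ha₃, hr₃, hv₃⟩
    simp only [Mem.reg_setReg, Mem.arr_setReg] at ha₃ hr₃ hv₃
    refine Runs.seq (Runs.copy (Runs.seq (Runs.copy (Runs.copy ⟨?_, fun z hz => ?_, ?_⟩))))
    · simp only [Mem.arr_setReg, ha₃, harr]
    · have h1 := hr₃ z (by omega)
      have h2 := hr₃ (d + 2) (by omega)
      have h3 := hr₃ (d + 3) (by omega)
      have h4 := hlow z hz
      simp only [Mem.reg_setReg] at h1 h2 h3 ⊢
      have h5 := hlow (x + 2) (by omega)
      have h6 := hlow (y + 2) (by omega)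
      grind
    · simp only [Mem.reg_setReg]
      rw [if_true, if_neg (by omega), if_neg (by omega), hv₃]
      rw [if_neg (by omega), if_neg (by omega), if_neg (by omega), if_neg (by omega), e2, harr,
        eval]
  | sum x b e ihb ihe =>
    intro d m ρ hd hρ
    simp only [vars] at hd hρ
    set M := m.reg 1 with hM
    set α := m.arr with hα
    set g : ℕ → ℕ := fun j => e.eval α M (Function.update ρ x j) with hg
    set K := min (b.eval α M ρ) M with hK
    have hKM : K ≤ M := min_le_right _ _
    have hcost : K * (1 + (e.cost.eval M + (1 + (1 + 1))) + 1) ≤ M * (e.cost.eval M + 5) := by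
      refine Nat.mul_le_mul hKM (by omega)
    refine Runs.mono (c₁ := b.cost.eval M + (1 + (1 + (1 + (1 + (1 + (1 +
        ((K * (1 + (e.cost.eval M + (1 + (1 + 1))) + 1) + 1) + (1 + 1)))))))))
      (Runs.seq ((ihb d m ρ (by omega) fun x hx => hρ x (by omega)).mono le_rfl ?_))
      (by simp only [cost, Polynomial.eval_add, Polynomial.eval_mul, Polynomial.eval_X,
          Polynomial.eval_ofNat]; omega) fun _ h => h
    rintro m₁ ⟨ha₁, hr₁, hv₁⟩
    rw [← hM, ← hα] at hv₁
    have e1 : m₁.reg 1 = M := hr₁ 1 (by omega)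
    refine Runs.seq (Runs.sub (Runs.seq (Runs.sub (Runs.seq (Runs.copy (Runs.seq (Runs.const
      (Runs.seq (Runs.const (Runs.seq (Runs.const (Runs.seq (Runs.mono (Runs.loop
        (fun k μ => k ≤ K ∧ μ.arr = α ∧ (∀ z < d, z ≠ x + 2 → μ.reg z = m.reg z) ∧ μ.reg d = k ∧
          μ.reg (d + 1) = m.reg (x + 2) ∧ μ.reg (d + 2) = K - k ∧
          μ.reg (d + 3) = ∑ j ∈ Finset.range (K - k), g j ∧ μ.reg (d + 4) = 1)
        (fun k μ h => h.2.2.2.1) ?_ K _ ?_) le_rfl ?_)))))))))))))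
    · rintro k μ ⟨hk, hα', hlow, h0, h1, h2, h3, h4⟩
      refine Runs.seq (Runs.copy (Runs.seq ((ihe (d + 5) _ (Function.update ρ x (K - (k + 1)))
        (by omega) fun z hz => ?_).mono ?_ ?_)))
      · simp only [Mem.reg_setReg, Function.update_apply, Nat.add_right_cancel_iff, h2]
        split_ifs with hzx
        · rfl
        · rw [hlow _ (by omega) (by omega), hρ _ (by omega)]
      · rw [Mem.reg_setReg, if_neg (by omega), hlow _ (by omega) (by omega)]
      rintro m₃ ⟨ha₃, hr₃, hv₃⟩
      rw [Mem.arr_setReg] at ha₃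
      have hlow3 : ∀ z < d + 5, z ≠ x + 2 → m₃.reg z = μ.reg z := fun z hz hzx => by
        rw [hr₃ z hz, Mem.reg_setReg, if_neg hzx]
      rw [Mem.arr_setReg, Mem.reg_setReg, if_neg (by omega), hlow _ (by omega) (by omega), hα']
        at hv₃
      have hs : K - k = K - (k + 1) + 1 := by omega
      have b0 := hlow3 d (by omega) (by omega)
      have b1 := hlow3 (d + 1) (by omega) (by omega)
      have b2 := hlow3 (d + 2) (by omega) (by omega)
      have b3 := hlow3 (d + 3) (by omega) (by omega)
      have b4 := hlow3 (d + 4) (by omega) (by omega)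
      refine Runs.seq (Runs.add (Runs.seq (Runs.add (Runs.sub
        ⟨by omega, ?_, fun z hz hzx => ?_, ?_, ?_, ?_, ?_, ?_⟩))))
      · simp only [Mem.arr_setReg, ha₃, hα']
      · simp only [Mem.reg_setReg]
        rw [if_neg (by omega), if_neg (by omega), if_neg (by omega), hlow3 z (by omega) hzx,
          hlow z hz hzx]
      · simp [b0, b4, h0, h4]
      · simp [b1, h1]
      · simp [b2, b4, h2, h4]; omega
      · rw [hs, Finset.sum_range_succ]
        simp [b3, h3, hv₃, hg, hM]
      · simp [b4, h4]
    · simp only [Mem.reg_setReg, Mem.arr_setReg]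
      refine ⟨le_rfl, ha₁, fun z hz hzx => ?_, ?_, ?_, ?_, ?_, ?_⟩
      · simp only [show z ≠ d + 4 by omega, show z ≠ d + 3 by omega, show z ≠ d + 2 by omega,
          show z ≠ d + 1 by omega, show z ≠ d by omega, if_false]
        exact hr₁ z hz
      · simp [show ¬ 1 = d by omega, e1, hv₁]
        omega
      · simp [show ¬ x + 2 = d by omega]
        exact hr₁ _ (by omega)
      · simp
      · simp
      · simp
    · rintro m₃ ⟨-, ha₃, hlow, h0, h1, h2, h3, h4⟩
      refine Runs.seq (Runs.copy (Runs.copy ⟨?_, fun z hz => ?_, ?_⟩))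
      · simp [ha₃]
      · simp only [Mem.reg_setReg]
        rw [if_neg (by omega)]
        split_ifs with hzx
        · rw [h1, hzx]
        · exact hlow z hz hzx
      · simp only [Mem.reg_setReg]
        rw [if_true, if_neg (by omega), h3, eval, Nat.sub_zero]
  | iter x b i e ihb ihi ihe =>
    intro d m ρ hd hρ
    simp only [vars] at hd hρ
    set M := m.reg 1 with hM
    set α := m.arr with hα
    set g : ℕ → ℕ := fun j => e.eval α M (Function.update ρ x j) with hg
    set K := min (b.eval α M ρ) M with hK
    have hKM : K ≤ M := min_le_right _ _
    have hcost : K * (1 + (e.cost.eval M + (1 + 1)) + 1) ≤ M * (e.cost.eval M + 4) := by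
      refine Nat.mul_le_mul hKM (by omega)
    refine Runs.mono (c₁ := b.cost.eval M + (1 + (1 + (i.cost.eval M + (1 + (1 +
        ((K * (1 + (e.cost.eval M + (1 + 1)) + 1) + 1) + (1 + 1))))))))
      (Runs.seq ((ihb d m ρ (by omega) fun x hx => hρ x (by omega)).mono le_rfl ?_))
      (by simp only [cost, Polynomial.eval_add, Polynomial.eval_mul, Polynomial.eval_X,
          Polynomial.eval_ofNat]; omega) fun _ h => h
    rintro m₁ ⟨ha₁, hr₁, hv₁⟩
    rw [← hM, ← hα] at hv₁
    have e1 : m₁.reg 1 = M := hr₁ 1 (by omega)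
    refine Runs.seq (Runs.sub (Runs.seq (Runs.sub (Runs.seq ((ihi (d + 1) _ ρ (by omega)
      fun z hz => ?_).mono ?_ ?_)))))
    · simp only [Mem.reg_setReg]
      rw [if_neg (by omega), if_neg (by omega), hr₁ _ (by omega), hρ _ (by omega)]
    · simp only [Mem.reg_setReg]
      rw [if_neg (by omega), if_neg (by omega), e1]
    rintro m₂ ⟨ha₂, hr₂, hv₂⟩
    simp only [Mem.reg_setReg, Mem.arr_setReg, if_neg (show ¬ 1 = d by omega), e1, ha₁]
      at ha₂ hr₂ hv₂
    have hlow2 : ∀ z < d, m₂.reg z = m.reg z := fun z hz => by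
      rw [hr₂ z (by omega), if_neg (by omega), if_neg (by omega), hr₁ z hz]
    have hd2 : m₂.reg d = K := by
      have := hr₂ d (by omega)
      simp [hv₁] at this
      omega
    refine Runs.seq (Runs.copy
      (Runs.seq (Runs.const (Runs.seq (Runs.mono (Runs.loop
        (fun k μ => k ≤ K ∧ μ.arr = α ∧ (∀ z < d, z ≠ x + 2 → μ.reg z = m.reg z) ∧ μ.reg d = k ∧
          μ.reg (d + 2) = m.reg (x + 2) ∧ μ.reg (d + 1) = g^[K - k] (i.eval α M ρ) ∧
          μ.reg (d + 3) = 1)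
        (fun k μ h => h.2.2.2.1) ?_ K _ ?_) le_rfl ?_)))))
    · rintro k μ ⟨hk, hα', hlow, h0, h1, h2, h3⟩
      refine Runs.seq (Runs.copy (Runs.seq ((ihe (d + 4) _
        (Function.update ρ x (g^[K - (k + 1)] (i.eval α M ρ)))
        (by omega) fun z hz => ?_).mono ?_ ?_)))
      · simp only [Mem.reg_setReg, Function.update_apply, Nat.add_right_cancel_iff, h2]
        split_ifs with hzx
        · rfl
        · rw [hlow _ (by omega) (by omega), hρ _ (by omega)]
      · rw [Mem.reg_setReg, if_neg (by omega), hlow _ (by omega) (by omega)]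
      rintro m₃ ⟨ha₃, hr₃, hv₃⟩
      rw [Mem.arr_setReg] at ha₃
      have hlow3 : ∀ z < d + 4, z ≠ x + 2 → m₃.reg z = μ.reg z := fun z hz hzx => by
        rw [hr₃ z hz, Mem.reg_setReg, if_neg hzx]
      rw [Mem.arr_setReg, Mem.reg_setReg, if_neg (by omega), hlow _ (by omega) (by omega), hα']
        at hv₃
      have hs : K - k = K - (k + 1) + 1 := by omega
      have b0 := hlow3 d (by omega) (by omega)
      have b2 := hlow3 (d + 2) (by omega) (by omega)
      have b3 := hlow3 (d + 3) (by omega) (by omega)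
      refine Runs.seq (Runs.copy (Runs.sub
        ⟨by omega, ?_, fun z hz hzx => ?_, ?_, ?_, ?_, ?_⟩))
      · simp only [Mem.arr_setReg, ha₃, hα']
      · simp only [Mem.reg_setReg]
        rw [if_neg (by omega), if_neg (by omega), hlow3 z (by omega) hzx,
          hlow z hz hzx]
      · simp [b0, b3, h0, h3]
      · simp [b2, h1]
      · rw [hs, Function.iterate_succ_apply']
        simp [hv₃, hg, hM]
      · simp [b3, h3]
    · simp only [Mem.reg_setReg, Mem.arr_setReg]
      refine ⟨le_rfl, ha₂, fun z hz hzx => ?_, ?_, ?_, ?_, ?_⟩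
      · simp only [show z ≠ d + 3 by omega, show z ≠ d + 2 by omega, if_false]
        exact hlow2 z hz
      · simp [hd2]
      · simp
        exact hlow2 _ (by omega)
      · simp [hv₂, hα]
      · simp
    · rintro m₃ ⟨-, ha₃, hlow, h0, h1, h2, h3⟩
      refine Runs.seq (Runs.copy (Runs.copy ⟨?_, fun z hz => ?_, ?_⟩))
      · simp [ha₃]
      · simp only [Mem.reg_setReg]
        rw [if_neg (by omega)]
        split_ifs with hzx
        · rw [h1, hzx]
        · exact hlow z hz hzx
      · simp only [Mem.reg_setReg]
        rw [if_true, if_neg (by omega), h2, eval, Nat.sub_zero]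

end Expr

namespace Expr

variable {α : ℕ → ℕ → ℕ} {M : ℕ} {ρ : ℕ → ℕ}

/-! ### Logic and arithmetic in expressions -/

/-- The truth of an expression read as a condition. -/
def Holds (α : ℕ → ℕ → ℕ) (M : ℕ) (e : Expr) (ρ : ℕ → ℕ) : Prop := e.eval α M ρ ≠ 0

theorem eval_const (k : ℕ) : (const k).eval α M ρ = k := rfl

theorem eval_var (x : ℕ) : (var x).eval α M ρ = ρ x := rfl

theorem eval_add (a b : Expr) : (a.add b).eval α M ρ = a.eval α M ρ + b.eval α M ρ := rfl

theorem eval_sub (a b : Expr) : (a.sub b).eval α M ρ = a.eval α M ρ - b.eval α M ρ := rfl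

theorem eval_load (a : ℕ) (e : Expr) : (load a e).eval α M ρ = α a (e.eval α M ρ) := rfl

open Classical in
theorem eval_ite (c a b : Expr) :
    (ite c a b).eval α M ρ = if c.Holds α M ρ then a.eval α M ρ else b.eval α M ρ := by
  simp only [eval, Holds]
  congr

theorem eval_let2 (x y : ℕ) (a b e : Expr) : (let2 x a y b e).eval α M ρ =
    e.eval α M (Function.update (Function.update ρ x (a.eval α M ρ)) y (b.eval α M ρ)) := rfl

theorem eval_iter (x : ℕ) {b i e : Expr} (h : b.eval α M ρ ≤ M) : (iter x b i e).eval α M ρ =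
    (fun v => e.eval α M (Function.update ρ x v))^[b.eval α M ρ] (i.eval α M ρ) := by
  rw [eval, min_eq_left h]

theorem eval_sum (x : ℕ) {b e : Expr} (h : b.eval α M ρ ≤ M) : (sum x b e).eval α M ρ =
    ∑ j ∈ Finset.range (b.eval α M ρ), e.eval α M (Function.update ρ x j) := by
  rw [eval, min_eq_left h]

/-- `a < b` -/
def lt (a b : Expr) : Expr := b.sub a

theorem holds_lt (a b : Expr) : (lt a b).Holds α M ρ ↔ a.eval α M ρ < b.eval α M ρ := by
  simp only [Holds, lt, eval]; omega

/-- `a = b` -/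
def eq (a b : Expr) : Expr := ite ((a.sub b).add (b.sub a)) (const 0) (const 1)

theorem holds_eq (a b : Expr) : (eq a b).Holds α M ρ ↔ a.eval α M ρ = b.eval α M ρ := by
  by_cases h : a.eval α M ρ = b.eval α M ρ
  · simp [Holds, eq, eval, h]
  · have : a.eval α M ρ - b.eval α M ρ + (b.eval α M ρ - a.eval α M ρ) ≠ 0 := by omega
    simp only [Holds, eq, eval, h]
    simp
    omega

/-- Negation. -/
def not (a : Expr) : Expr := ite a (const 0) (const 1)

theorem holds_not (a : Expr) : a.not.Holds α M ρ ↔ ¬ a.Holds α M ρ := by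
  simp only [Holds, not, eval]; split_ifs <;> omega

/-- Conjunction. -/
def and (a b : Expr) : Expr := ite a b (const 0)

theorem holds_and (a b : Expr) : (a.and b).Holds α M ρ ↔ a.Holds α M ρ ∧ b.Holds α M ρ := by
  simp only [Holds, and, eval]; split_ifs <;> simp_all

/-- Disjunction. -/
def or (a b : Expr) : Expr := a.add b

theorem holds_or (a b : Expr) : (a.or b).Holds α M ρ ↔ a.Holds α M ρ ∨ b.Holds α M ρ := by
  simp only [Holds, or, eval]; omega

theorem holds_ite (c a b : Expr) : (ite c a b).Holds α M ρ ↔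
    (c.Holds α M ρ ∧ a.Holds α M ρ) ∨ (¬ c.Holds α M ρ ∧ b.Holds α M ρ) := by
  simp only [Holds, eval]; split_ifs <;> simp_all

theorem holds_let2 (x y : ℕ) (a b e : Expr) : (let2 x a y b e).Holds α M ρ ↔
    e.Holds α M (Function.update (Function.update ρ x (a.eval α M ρ)) y (b.eval α M ρ)) := Iff.rfl

/-- There is `x < b` with `e`: the sum of the values of `e` is not zero. -/
def ex (x : ℕ) (b e : Expr) : Expr := sum x b e

theorem holds_ex (x : ℕ) {b e : Expr} (h : b.eval α M ρ ≤ M) : (ex x b e).Holds α M ρ ↔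
    ∃ j < b.eval α M ρ, e.Holds α M (Function.update ρ x j) := by
  simp only [Holds, ex, eval_sum x h]
  simp [Finset.sum_eq_zero_iff]

/-- For all `x < b`, `e`. -/
def all (x : ℕ) (b e : Expr) : Expr := (sum x b e.not).not

theorem holds_all (x : ℕ) {b e : Expr} (h : b.eval α M ρ ≤ M) : (all x b e).Holds α M ρ ↔
    ∀ j < b.eval α M ρ, e.Holds α M (Function.update ρ x j) := by
  have := holds_ex x (e := e.not) h
  rw [ex] at this
  rw [all, holds_not, this]
  simp [holds_not]

open Classical in
/-- The least `k < n` with `P k`, or `n` if there is none. -/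
noncomputable def leastBelow (P : ℕ → Prop) (n : ℕ) : ℕ :=
  if h : ∃ k, k < n ∧ P k then Nat.find h else n

theorem leastBelow_spec {P : ℕ → Prop} {n : ℕ} (h : ∃ k < n, P k) :
    leastBelow P n < n ∧ P (leastBelow P n) := by
  classical
  rw [leastBelow, dif_pos h]
  exact Nat.find_spec h

theorem leastBelow_min {P : ℕ → Prop} {n k : ℕ} (h : k < leastBelow P n) : ¬ P k := by
  classical
  rw [leastBelow] at h
  split_ifs at h with h'
  · have h1 := Nat.find_min h' h
    have h2 := (Nat.find_spec h').1
    exact fun hP => h1 ⟨h.trans h2, hP⟩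
  · exact fun hP => h' ⟨k, h, hP⟩

theorem leastBelow_of_not {P : ℕ → Prop} {n : ℕ} (h : ¬ ∃ k < n, P k) : leastBelow P n = n := by
  classical
  rw [leastBelow, dif_neg h]

theorem leastBelow_le {P : ℕ → Prop} {n : ℕ} : leastBelow P n ≤ n := by
  by_cases h : ∃ k < n, P k
  · exact (leastBelow_spec h).1.le
  · exact (leastBelow_of_not h).le

theorem leastBelow_eq {P : ℕ → Prop} {n k : ℕ} (hk : k < n) (hP : P k) (h : ∀ j < k, ¬ P j) :
    leastBelow P n = k := by
  have h1 := leastBelow_spec ⟨k, hk, hP⟩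
  rcases lt_trichotomy (leastBelow P n) k with h2 | h2 | h2
  · exact absurd h1.2 (h _ h2)
  · exact h2
  · exact absurd hP (leastBelow_min h2)

theorem leastBelow_congr {P R : ℕ → Prop} {n : ℕ} (h : ∀ k < n, (P k ↔ R k)) :
    leastBelow P n = leastBelow R n := by
  by_cases hP : ∃ k < n, P k
  · have h1 := leastBelow_spec hP
    exact (leastBelow_eq h1.1 ((h _ h1.1).1 h1.2)
      fun j hj hR => leastBelow_min hj ((h _ (hj.trans h1.1)).2 hR)).symm
  · rw [leastBelow_of_not hP, leastBelow_of_not]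
    rintro ⟨k, hk, hR⟩
    exact hP ⟨k, hk, (h k hk).2 hR⟩

/-- The least `x < b` with `e`, or `b` if there is none: the number of `x < b` such that no `y ≤ x`
satisfies `e`. -/
def find (x : ℕ) (b e : Expr) : Expr := sum x b (not (sum x ((var x).add (const 1)) e))

theorem eval_find (x : ℕ) {b e : Expr} (h : b.eval α M ρ ≤ M) : (find x b e).eval α M ρ =
    leastBelow (fun j => e.Holds α M (Function.update ρ x j)) (b.eval α M ρ) := by
  classical
  rw [find, eval_sum x h]
  set n := b.eval α M ρ
  set P : ℕ → Prop := fun j => e.Holds α M (Function.update ρ x j) with hP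
  have key : ∀ j < n, (not (sum x ((var x).add (const 1)) e)).eval α M (Function.update ρ x j) =
      if j < leastBelow P n then 1 else 0 := by
    intro j hj
    have hb : ((var x).add (const 1)).eval α M (Function.update ρ x j) = j + 1 := by
      simp [eval]
    have hex := holds_ex (α := α) (M := M) (ρ := Function.update ρ x j) x
      (b := (var x).add (const 1)) (e := e) (by rw [hb]; omega)
    rw [hb, ex] at hex
    simp only [Function.update_idem] at hex
    rw [not, eval_ite, eval_const, eval_const]
    split_ifs with h1 h2 h2
    · obtain ⟨i, hi, hPi⟩ := hex.1 h1
      exact absurd hPi (leastBelow_min (P := P) (n := n) (by omega))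
    · rfl
    · rfl
    · exfalso
      have h3 := leastBelow_spec (P := P) (n := n) (by
        by_contra h4
        rw [leastBelow_of_not h4] at h2
        omega)
      exact h1 (hex.2 ⟨leastBelow P n, by omega, h3.2⟩)
  rw [Finset.sum_congr rfl fun j hj => key j (Finset.mem_range.1 hj), Finset.sum_ite,
    Finset.sum_const_zero, add_zero, Finset.sum_const, smul_eq_mul, mul_one]
  rw [show (Finset.range n).filter (· < leastBelow P n) = Finset.range (leastBelow P n) by
    ext j
    have := leastBelow_le (P := P) (n := n)
    simp
    omega, Finset.card_range]

/-- `a * b`, by repeated addition. The local names `0`, `1`, `2` cannot capture variables of `a`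
and `b`, which are evaluated outside their scope. -/
def mul (a b : Expr) : Expr := let2 0 a 1 b (sum 2 (var 0) (var 1))

theorem eval_mul {a b : Expr} (h : a.eval α M ρ ≤ M) :
    (mul a b).eval α M ρ = a.eval α M ρ * b.eval α M ρ := by
  rw [mul, eval_let2, eval_sum] <;> simp [eval, h]

/-- `a / b`, as the least `q` with `a < (q + 1) * b`. -/
def div (a b : Expr) : Expr := let2 0 a 1 b
  (find 2 ((var 0).add (const 1)) (lt (var 0) (mul ((var 2).add (const 1)) (var 1))))

theorem eval_div {a b : Expr} (h : a.eval α M ρ < M) (hb : 0 < b.eval α M ρ) :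
    (div a b).eval α M ρ = a.eval α M ρ / b.eval α M ρ := by
  rw [div, eval_let2, eval_find _ (by simp [eval]; omega)]
  set q := a.eval α M ρ
  set p := b.eval α M ρ
  have hle : q / p ≤ q := Nat.div_le_self _ _
  rw [show ((var 0).add (const 1)).eval α M
    (Function.update (Function.update ρ 0 q) 1 p) = q + 1 by simp [eval]]
  refine leastBelow_eq (by omega) ?_ fun j hj => ?_
  · rw [holds_lt, eval_mul (by simp [eval]; omega)]
    simp only [eval, Function.update_apply]
    norm_num
    rw [mul_comm]
    exact Nat.lt_mul_div_succ q hb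
  · rw [holds_lt, eval_mul (by simp [eval]; omega)]
    simp only [eval, Function.update_apply]
    norm_num
    exact (Nat.mul_le_mul_right p (show j + 1 ≤ q / p by omega)).trans (Nat.div_mul_le_self q p)

/-- `a % b` -/
def mod (a b : Expr) : Expr :=
  let2 0 a 1 b ((var 0).sub (mul (div (var 0) (var 1)) (var 1)))

theorem eval_mod {a b : Expr} (h : a.eval α M ρ < M) (hb : 0 < b.eval α M ρ) :
    (mod a b).eval α M ρ = a.eval α M ρ % b.eval α M ρ := by
  have hle : a.eval α M ρ / b.eval α M ρ ≤ a.eval α M ρ := Nat.div_le_self _ _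
  have hdiv : (div (var 0) (var 1)).eval α M (Function.update (Function.update ρ 0
      (a.eval α M ρ)) 1 (b.eval α M ρ)) = a.eval α M ρ / b.eval α M ρ := by
    rw [eval_div] <;> simp [eval, h, hb]
  rw [mod, eval_let2, eval_sub, eval_mul (by rw [hdiv]; omega), hdiv]
  simp only [eval, Function.update_apply]
  norm_num
  have := Nat.div_add_mod (a.eval α M ρ) (b.eval α M ρ)
  rw [mul_comm] at this
  omega

theorem holds_mod_two {e : Expr} (h : e.eval α M ρ < M) :
    (mod e (const 2)).Holds α M ρ ↔ e.eval α M ρ % 2 = 1 := by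
  rw [Holds, eval_mod h (by rw [eval_const]; omega), eval_const]
  omega

theorem eval_div_two {e : Expr} (h : e.eval α M ρ < M) :
    (div e (const 2)).eval α M ρ = e.eval α M ρ / 2 := by
  rw [eval_div h (by rw [eval_const]; omega), eval_const]

end Expr

/-! ### Assignments and tabulations -/

/-- The program `x := e` for a register `x`. -/
def Prog.assign (x : ℕ) (e : Expr) : Prog :=
  .seq (e.compile (e.vars + 8)) (.copy x (e.vars + 8))

/-- The assignment of variables that the registers of a memory hold. -/
def Mem.vals (m : Mem) (x : ℕ) : ℕ := m.reg (x + 2)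

theorem Prog.oracleFree_assign (x : ℕ) (e : Expr) : (Prog.assign x e).OracleFree :=
  ⟨e.oracleFree_compile _, trivial⟩

theorem Runs.assign (f : List ℕ → List ℕ) (x : ℕ) (e : Expr) (m : Mem) :
    Runs f (Prog.assign x e) m ((e.cost + 1).eval (m.reg 1)) fun m' =>
      m'.arr = m.arr ∧ m'.reg x = e.eval m.arr (m.reg 1) m.vals ∧
        ∀ z < 8, z ≠ x → m'.reg z = m.reg z := by
  refine Runs.mono (Runs.seq ((e.runs_compile f (e.vars + 8) m m.vals (by omega)
    fun _ _ => rfl).mono le_rfl ?_)) (c₁ := e.cost.eval (m.reg 1) + 1) (by simp) fun _ h => h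
  rintro m₁ ⟨ha, hr, hv⟩
  refine Runs.copy ⟨ha, ?_, fun z hz hzx => ?_⟩
  · simp [hv]
  · simp only [Mem.reg_setReg]
    rw [if_neg hzx, hr z (by omega)]

/-- The program that stores the value of `e` at variable `0` equal to `k` in entry `k` of array `a`,
for all `k` below the cap for loops. -/
def Prog.fill (a : ℕ) (e : Expr) : Prog :=
  .seq (.const 2 0) (.seq (.copy (e.vars + 8) 1) (.seq (.const (e.vars + 8 + 1) 1)
    (.loop (e.vars + 8) (.seq (e.compile (e.vars + 8 + 2)) (.seq (.store a 2 (e.vars + 8 + 2))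
      (.seq (.add 2 2 (e.vars + 8 + 1)) (.sub (e.vars + 8) (e.vars + 8) (e.vars + 8 + 1))))))))

theorem Prog.oracleFree_fill (a : ℕ) (e : Expr) : (Prog.fill a e).OracleFree := by
  simp [Prog.fill, Prog.OracleFree, e.oracleFree_compile]

/-- The hypothesis `h` on arrays that differ from the present ones at `a` says that `e` does not
read the entries of `a` that are being written. -/
theorem Runs.fill (f : List ℕ → List ℕ) (a : ℕ) (e : Expr) (m : Mem) (F : ℕ → ℕ)
    (h : ∀ k < m.reg 1, ∀ g,
      e.eval (Function.update m.arr a g) (m.reg 1) (Function.update m.vals 0 k) = F k) :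
    Runs f (Prog.fill a e) m ((Polynomial.X * (e.cost + 4) + 4).eval (m.reg 1)) fun m' =>
      (∃ g, m'.arr = Function.update m.arr a g ∧ ∀ k < m.reg 1, g k = F k) ∧
        ∀ z < 8, z ≠ 2 → m'.reg z = m.reg z := by
  set M := m.reg 1 with hM
  set D := e.vars + 8 with hD
  refine Runs.mono (c₁ := 1 + (1 + (1 + (M * ((e.cost.eval M + (1 + (1 + 1))) + 1) + 1))))
    (Runs.seq (Runs.const (Runs.seq (Runs.copy (Runs.seq (Runs.const (Runs.mono (Runs.loop
    (fun k μ => k ≤ M ∧ (∃ g, μ.arr = Function.update m.arr a g ∧ ∀ j < M - k, g j = F j) ∧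
      (∀ z < D, z ≠ 2 → μ.reg z = m.reg z) ∧ μ.reg 2 = M - k ∧ μ.reg D = k ∧ μ.reg (D + 1) = 1)
    (fun k μ h => h.2.2.2.2.1) ?_ M _ ?_) le_rfl ?_))))))) ?_ fun _ h => h
  · rintro k μ ⟨hk, ⟨g, hg, hgF⟩, hlow, h2, h0, h1⟩
    have e1 : μ.reg 1 = M := hlow 1 (by omega) (by omega)
    refine Runs.seq ((e.runs_compile f (D + 2) μ (Function.update m.vals 0 (M - (k + 1)))
      (by omega) fun z hz => ?_).mono (by rw [e1]) ?_)
    · rw [Function.update_apply]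
      split_ifs with hz0
      · rw [hz0, zero_add, h2]
      · rw [hlow _ (by omega) (by omega)]
        rfl
    rintro m₁ ⟨ha₁, hr₁, hv₁⟩
    rw [hg, e1, h _ (by omega)] at hv₁
    have b2 := hr₁ 2 (by omega)
    have b0 := hr₁ D (by omega)
    have b1 := hr₁ (D + 1) (by omega)
    refine Runs.seq (Runs.store (Runs.seq (Runs.add (Runs.sub ⟨by omega, ?_, fun z hz hz2 => ?_,
      ?_, ?_, ?_⟩))))
    · refine ⟨Function.update g (M - (k + 1)) (F (M - (k + 1))), ?_, fun j hj => ?_⟩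
      · simp [ha₁, hg, b2, h2, ← hD, hv₁]
      · rw [Function.update_apply]
        split_ifs with hjk
        · rw [hjk]
        · exact hgF j (by omega)
    · simp only [Mem.reg_setReg, Mem.reg_setArr]
      rw [if_neg (by omega), if_neg (by omega), hr₁ z (by omega), hlow z hz hz2]
    · simp only [Mem.reg_setReg, Mem.reg_setArr]
      rw [if_neg (by omega), if_true, b2, b1, h2, h1]
      omega
    · simp only [Mem.reg_setReg, Mem.reg_setArr]
      rw [if_pos rfl, if_neg (by omega), if_neg (by omega), b0, b1, h0, h1]
      omega
    · simp only [Mem.reg_setReg, Mem.reg_setArr]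
      rw [if_neg (by omega), if_neg (by omega), b1, h1]
  · refine ⟨le_rfl, ⟨m.arr a, by simp, by simp⟩, fun z hz hz2 => ?_, ?_, ?_, ?_⟩
    · simp only [Mem.reg_setReg]
      rw [if_neg (by omega), if_neg (by omega), if_neg (by omega)]
    · simp only [Mem.reg_setReg]
      rw [if_neg (by omega), if_neg (by omega), if_true, Nat.sub_self]
    · simp only [Mem.reg_setReg]
      rw [if_neg (by omega), if_pos rfl, if_neg (by omega)]
    · simp only [Mem.reg_setReg]
      rw [if_pos rfl]
  · rintro m' ⟨-, ⟨g, hg, hgF⟩, hlow, -⟩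
    exact ⟨⟨g, hg, fun k hk => hgF k (by omega)⟩, fun z hz hz2 => hlow z (by omega) hz2⟩
  · simp only [Polynomial.eval_add, Polynomial.eval_mul, Polynomial.eval_X, Polynomial.eval_ofNat]
    have : M * ((e.cost.eval M + (1 + (1 + 1))) + 1) = M * (e.cost.eval M + 4) := by ring
    omega

/-! ### The parity condition -/

theorem parityAccepts_iff {c : ℕ → ℕ} {d : ℕ} (h : IsLeast {k | ∃ᶠ i in atTop, c i = k} d) :
    ParityAccepts c ↔ Even d :=
  ⟨fun ⟨_, hk, hk'⟩ => hk'.unique h ▸ hk, fun hd => ⟨d, hd, h⟩⟩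

theorem exists_isLeast_frequently {c : ℕ → ℕ} {N : ℕ} (h : ∀ i, c i ≤ N) :
    ∃ d, IsLeast {k | ∃ᶠ i in atTop, c i = k} d := by
  have hne : {k | ∃ᶠ i in atTop, c i = k}.Nonempty := by
    by_contra hemp
    have h1 : ∀ k ∈ Set.Iic N, ∀ᶠ i in atTop, c i ≠ k := by
      intro k _
      by_contra h2
      exact hemp ⟨k, h2⟩
    have h2 := (eventually_all_finite (Set.finite_Iic N)).2 h1
    obtain ⟨i, hi⟩ := h2.exists
    exact hi (c i) (h i) rfl
  exact ⟨_, Nat.sInf_mem hne, fun k hk => Nat.sInf_le hk⟩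

theorem frequently_atTop_add_iff (P : ℕ → Prop) (n : ℕ) :
    (∃ᶠ i in atTop, P (i + n)) ↔ ∃ᶠ i in atTop, P i := by
  conv_rhs => rw [← map_add_atTop_eq_nat n]
  rw [frequently_map]

theorem parityAccepts_add (c : ℕ → ℕ) (n : ℕ) :
    ParityAccepts (fun i => c (i + n)) ↔ ParityAccepts c := by
  simp only [ParityAccepts]
  simp only [fun k => frequently_atTop_add_iff (fun i => c i = k) n]

/-- Raising all colours by one exchanges the players. -/
theorem parityAccepts_succ {c : ℕ → ℕ} {N : ℕ} (h : ∀ i, c i ≤ N) :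
    ParityAccepts (fun i => c i + 1) ↔ ¬ ParityAccepts c := by
  obtain ⟨d, hd⟩ := exists_isLeast_frequently h
  have hd' : IsLeast {k | ∃ᶠ i in atTop, c i + 1 = k} (d + 1) := by
    refine ⟨hd.1.mono fun i hi => by rw [hi], fun k hk => ?_⟩
    obtain ⟨i, hi⟩ := Frequently.exists hk
    have : k - 1 ∈ {k | ∃ᶠ i in atTop, c i = k} := Frequently.mono hk fun i hi => by omega
    have := hd.2 this
    omega
  rw [parityAccepts_iff hd, parityAccepts_iff hd', Nat.even_add_one]

/-! ### Positional determinacy of parity games -/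

section Determinacy

variable {V : Type} (edge : V → V → Prop) (owner : V → Bool) (color : V → ℕ)

/-- The vertices of `S` from which player `q` can force a visit to `T` within `k` moves. -/
def attractor (S : Set V) (q : Bool) (T : Set V) : ℕ → Set V
  | 0 => T
  | k + 1 => attractor S q T k ∪ {v | v ∈ S ∧
      ((owner v = q ∧ ∃ u ∈ S, edge v u ∧ u ∈ attractor S q T k) ∨
        (owner v ≠ q ∧ ∀ u ∈ S, edge v u → u ∈ attractor S q T k))}

theorem attractor_mono (S : Set V) (q : Bool) (T : Set V) :
    Monotone (attractor edge owner S q T) :=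
  monotone_nat_of_le_succ fun _ => Set.subset_union_left

/-- The attractor `A` of player `q` to `T` in the game on `S`, with an attracting strategy `st`:
inside, `q` can move closer to `T` and the opponent cannot leave; outside, `q` cannot enter and the
opponent can stay outside. -/
theorem exists_attractor [Finite V] (S : Set V) (q : Bool) (T : Set V) (hT : T ⊆ S) :
    ∃ (A : Set V) (st : V → V), T ⊆ A ∧ A ⊆ S ∧
      (∀ v ∈ A, v ∉ T → owner v = q → edge v (st v) ∧ st v ∈ A) ∧
      (∀ v ∈ A, v ∉ T → owner v ≠ q → ∀ u ∈ S, edge v u → u ∈ A) ∧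
      (∀ v ∈ S, v ∉ A → owner v = q → ∀ u ∈ S, edge v u → u ∉ A) ∧
      (∀ v ∈ S, v ∉ A → owner v ≠ q → ∃ u ∈ S, edge v u ∧ u ∉ A) ∧
      (∀ ρ : ℕ → V, (∀ i, ρ i ∈ S) → (∀ i, edge (ρ i) (ρ (i + 1))) →
        (∀ i, ρ i ∈ A → ρ i ∉ T → owner (ρ i) = q → ρ (i + 1) = st (ρ i)) → ρ 0 ∈ A →
        ∃ i, ρ i ∈ T) := by
  classical
  set At := attractor edge owner S q T with hAt
  have hmono : Monotone At := attractor_mono edge owner S q T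
  -- By finiteness the attractor is complete after some number `K` of stages.
  obtain ⟨K, hK⟩ : ∃ K, ∀ k, At k ⊆ At K := by
    have : ∀ v, ∃ k, (∃ j, v ∈ At j) → v ∈ At k := by
      intro v
      by_cases h : ∃ j, v ∈ At j
      · exact ⟨h.choose, fun _ => h.choose_spec⟩
      · exact ⟨0, fun h' => absurd h' h⟩
    choose r hr using this
    obtain ⟨K, hK⟩ := Finite.exists_le r
    exact ⟨K, fun k v hv => hmono (hK v) (hr v ⟨k, hv⟩)⟩
  have hsub : ∀ k, At k ⊆ S := by
    intro k
    induction k with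
    | zero => exact hT
    | succ k ih =>
      rintro v (hv | hv)
      · exact ih hv
      · exact hv.1
  have hst : ∀ v, ∃ u, ∀ k, v ∈ At (k + 1) → v ∉ At k → owner v = q → edge v u ∧ u ∈ At k := by
    intro v
    by_cases h : ∃ k, v ∈ At (k + 1) ∧ v ∉ At k ∧ owner v = q
    · obtain ⟨k, hk1, hk2, hq⟩ := h
      have hk3 := hk1
      rcases hk3 with hk3 | ⟨-, ⟨-, u, -, hu, hu'⟩ | ⟨hne, -⟩⟩
      · exact absurd hk3 hk2
      · refine ⟨u, fun j hj1 hj2 _ => ?_⟩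
        rcases lt_trichotomy j k with hjk | rfl | hjk
        · exact absurd (hmono (by omega : j + 1 ≤ k) hj1) hk2
        · exact ⟨hu, hu'⟩
        · exact absurd (hmono (by omega : k + 1 ≤ j) hk1) hj2
      · exact absurd hq hne
    · exact ⟨v, fun k h1 h2 h3 => absurd ⟨k, h1, h2, h3⟩ h⟩
  choose st hst using hst
  -- The stage at which a vertex outside the target enters.
  have hstage : ∀ k, ∀ v ∈ At k, v ∉ T → ∃ j, j < k ∧ v ∈ At (j + 1) ∧ v ∉ At j := by
    intro k
    induction k with
    | zero => exact fun v hv hv' => absurd hv hv'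
    | succ k ih =>
      intro v hv hv'
      by_cases h : v ∈ At k
      · obtain ⟨j, hj, h1⟩ := ih v h hv'
        exact ⟨j, by omega, h1⟩
      · exact ⟨k, by omega, hv, h⟩
  refine ⟨At K, st, hK 0, hsub K, ?_, ?_, ?_, ?_, ?_⟩
  · intro v hv hvT hq
    obtain ⟨j, -, h1, h2⟩ := hstage K v hv hvT
    exact ⟨(hst v j h1 h2 hq).1, hK j (hst v j h1 h2 hq).2⟩
  · intro v hv hvT hq u hu hvu
    obtain ⟨j, -, h1, h2⟩ := hstage K v hv hvT
    rcases h1 with h1 | ⟨-, ⟨h1, -⟩ | ⟨-, h1⟩⟩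
    · exact absurd h1 h2
    · exact absurd h1 hq
    · exact hK j (h1 u hu hvu)
  · intro v hv hvA hq u hu hvu huA
    exact hvA (hK (K + 1) (Or.inr ⟨hv, Or.inl ⟨hq, u, hu, hvu, huA⟩⟩))
  · intro v hv hvA hq
    by_contra h
    push Not at h
    exact hvA (hK (K + 1) (Or.inr ⟨hv, Or.inr ⟨hq, h⟩⟩))
  · intro ρ hS hedge hcons
    have key : ∀ k i, ρ i ∈ At k → ∃ i, ρ i ∈ T := by
      intro k
      induction k using Nat.strong_induction_on with
      | _ k ih =>
        intro i hi
        by_cases hiT : ρ i ∈ T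
        · exact ⟨i, hiT⟩
        obtain ⟨j, hjk, h1, h2⟩ := hstage k _ hi hiT
        refine ih j hjk (i + 1) ?_
        by_cases hq : owner (ρ i) = q
        · rw [hcons i (hK k hi) hiT hq]
          exact (hst _ j h1 h2 hq).2
        · rcases h1 with h1 | ⟨-, ⟨h1, -⟩ | ⟨-, h1⟩⟩
          · exact absurd h1 h2
          · exact absurd h1 hq
          · exact h1 _ (hS _) (hedge i)
    exact fun h0 => key K 0 h0

/-- The positional profile `st` solves the game restricted to `S`: `win v` is the winner from `v`,
whose moves are those of `st`. -/
structure Solves (S : Set V) (win : V → Bool) (st : V → V) : Prop where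
  legal : ∀ v ∈ S, edge v (st v) ∧ st v ∈ S
  own : ∀ v ∈ S, owner v = win v → win (st v) = win v
  opp : ∀ v ∈ S, owner v ≠ win v → ∀ u ∈ S, edge v u → win u = win v
  good : ∀ ρ : ℕ → V, (∀ i, ρ i ∈ S) → (∀ i, edge (ρ i) (ρ (i + 1))) →
    (∀ i, owner (ρ i) = win (ρ 0) → ρ (i + 1) = st (ρ i)) →
    (ParityAccepts (fun i => color (ρ i)) ↔ win (ρ 0) = true)

/-- Zielonka's theorem: every finite parity game is solved by a positional profile. -/
theorem exists_solves [Finite V] (S : Set V) (htotal : ∀ v ∈ S, ∃ u ∈ S, edge v u) :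
    ∃ win st, Solves edge owner color S win st := by
  classical
  induction S using WellFoundedLT.induction with
  | _ S ih =>
  have hbdd : ∃ N, ∀ v, color v ≤ N := Finite.exists_le color
  obtain ⟨N, hN⟩ := hbdd
  rcases S.eq_empty_or_nonempty with rfl | hne
  · exact ⟨fun _ => true, id, by simp, by simp, by simp, fun ρ h => absurd (h 0) (by simp)⟩
  -- The least colour `d`, the player `p` whom it favours, and the attractor of `p` to it.
  obtain ⟨v₀, hv₀, hmin⟩ : ∃ v ∈ S, ∀ u ∈ S, color v ≤ color u :=
    S.toFinite.exists_minimalFor color S hne |>.imp fun v hv =>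
      ⟨hv.1, fun u hu => (le_total (color v) (color u)).elim id fun h => hv.2 hu h⟩
  set d := color v₀ with hd
  set p : Bool := decide (Even d) with hp
  obtain ⟨A, sA, hTA, hAS, hA1, hA2, hA3, hA4, hA5⟩ :=
    exists_attractor edge owner S p {v | v ∈ S ∧ color v = d} (fun v hv => hv.1)
  choose! nx hnx using htotal
  -- The rest is solved by induction.
  obtain ⟨w₁, s₁, h₁⟩ := ih (S \ A) ⟨Set.sdiff_subset, fun h => (h hv₀).2 (hTA ⟨hv₀, rfl⟩)⟩ (by
    rintro v ⟨hvS, hvA⟩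
    by_cases ho : owner v = p
    · exact ⟨nx v, ⟨(hnx v hvS).1, hA3 v hvS hvA ho _ (hnx v hvS).1 (hnx v hvS).2⟩, (hnx v hvS).2⟩
    · obtain ⟨u, hu, hvu, huA⟩ := hA4 v hvS hvA ho
      exact ⟨u, ⟨hu, huA⟩, hvu⟩)
  by_cases hcase : ∀ v ∈ S \ A, w₁ v = p
  · -- Player `p` wins everywhere.
    set st : V → V := fun v => if v ∈ A then
      (if color v = d then nx v else if owner v = p then sA v else nx v) else s₁ v with hst
    refine ⟨fun _ => p, st, ?_, fun _ _ _ => rfl, fun _ _ _ _ _ _ => rfl, ?_⟩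
    · intro v hv
      simp only [hst]
      split_ifs with h1 h2 h3
      · exact (hnx v hv).symm
      · exact ⟨(hA1 v h1 (fun h => h2 h.2) h3).1, hAS (hA1 v h1 (fun h => h2 h.2) h3).2⟩
      · exact (hnx v hv).symm
      · exact ⟨(h₁.legal v ⟨hv, h1⟩).1, (h₁.legal v ⟨hv, h1⟩).2.1⟩
    · intro ρ hS hedge hcons
      have hpE : p = true ↔ Even d := by simp [hp]
      by_cases hinf : ∃ᶠ i in atTop, ρ i ∈ A
      · -- The attractor is visited infinitely often, hence so is colour `d`.
        have hfreq : ∃ᶠ i in atTop, color (ρ i) = d := by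
          rw [frequently_atTop] at hinf ⊢
          intro a
          obtain ⟨b, hab, hb⟩ := hinf a
          obtain ⟨i, hi⟩ := hA5 (fun i => ρ (b + i)) (fun i => hS _) (fun i => hedge _)
            (fun i h1 h2 h3 => by
              have := hcons (b + i) h3
              rw [← add_assoc, this]
              simp only [hst]
              rw [if_pos h1, if_neg (fun h => h2 ⟨hS _, h⟩), if_pos h3]) hb
          exact ⟨b + i, by omega, hi.2⟩
        rw [parityAccepts_iff (d := d) ⟨hfreq, fun k hk => ?_⟩, hpE]
        obtain ⟨i, hi⟩ := Frequently.exists hk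
        exact hi ▸ hmin _ (hS i)
      · rw [not_frequently, eventually_atTop] at hinf
        obtain ⟨a, ha⟩ := hinf
        have hmem : ∀ i, ρ (i + a) ∈ S \ A := fun i => ⟨hS _, ha _ (by omega)⟩
        have h0 : w₁ (ρ (0 + a)) = p := hcase _ (hmem 0)
        have := h₁.good (fun i => ρ (i + a)) hmem (fun i => by
          have := hedge (i + a)
          rwa [show i + a + 1 = i + 1 + a by omega] at this) (fun i hi => by
          have := hcons (i + a) (hi.trans h0)
          rw [show i + a + 1 = i + 1 + a by omega] at this
          simp only [this, hst]
          rw [if_neg (hmem i).2])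
        rw [← parityAccepts_add _ a]
        exact this.trans (by rw [h0])
  · -- The opponent wins on a set `X`, hence on its attractor `B`.
    push Not at hcase
    obtain ⟨x₀, hx₀, hx₀p⟩ := hcase
    set X : Set V := {v | v ∈ S \ A ∧ w₁ v ≠ p} with hX
    obtain ⟨B, sB, hXB, hBS, hB1, hB2, hB3, hB4, hB5⟩ :=
      exists_attractor edge owner S (!p) X (fun v hv => hv.1.1)
    obtain ⟨w₂, s₂, h₂⟩ := ih (S \ B)
      ⟨Set.sdiff_subset, fun h => (h hx₀.1).2 (hXB ⟨hx₀, hx₀p⟩)⟩ (by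
      rintro v ⟨hvS, hvB⟩
      by_cases ho : owner v = !p
      · exact ⟨nx v, ⟨(hnx v hvS).1, hB3 v hvS hvB ho _ (hnx v hvS).1 (hnx v hvS).2⟩,
          (hnx v hvS).2⟩
      · obtain ⟨u, hu, hvu, huB⟩ := hB4 v hvS hvB ho
        exact ⟨u, ⟨hu, huB⟩, hvu⟩)
    have hne' : ∀ {a b : Bool}, a ≠ b → a = !b := by decide
    have hne'' : ∀ {a b : Bool}, a ≠ !b → a = b := by decide
    have hXw : ∀ v ∈ X, w₁ v = !p := fun v hv => hne' hv.2
    set win : V → Bool := fun v => if v ∈ B then !p else w₂ v with hwin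
    set st : V → V := fun v => if v ∈ X then s₁ v else if v ∈ B then
      (if owner v = !p then sB v else nx v) else s₂ v with hst
    have winB : ∀ {v}, v ∈ B → win v = !p := fun h => if_pos h
    have winN : ∀ {v}, v ∉ B → win v = w₂ v := fun h => if_neg h
    have hstX : ∀ v ∈ X, owner v = !p → s₁ v ∈ X := fun v hv ho =>
      ⟨(h₁.legal v hv.1).2, by rw [h₁.own v hv.1 (by rw [ho, hXw v hv])]; exact hv.2⟩
    have hXclosed : ∀ v ∈ X, owner v ≠ !p → ∀ u ∈ S, edge v u → u ∈ X := fun v hv ho u hu hvu => by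
      have huA : u ∈ S \ A := ⟨hu, hA3 v hv.1.1 hv.1.2 (hne'' ho) u hu hvu⟩
      exact ⟨huA, by rw [h₁.opp v hv.1 (by rwa [hXw v hv]) u huA hvu]; exact hv.2⟩
    have hclosed : ∀ v ∈ S, v ∉ B → win v = p → owner v ≠ p → ∀ u ∈ S, edge v u →
        u ∉ B ∧ win u = p := fun v hv hvB hw ho u hu hvu => by
      have huB := hB3 v hv hvB (hne' ho) u hu hvu
      rw [winN hvB] at hw
      exact ⟨huB, by rw [winN huB, h₂.opp v ⟨hv, hvB⟩ (by rwa [hw]) u ⟨hu, huB⟩ hvu, hw]⟩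
    have hsol : ∀ v ∈ S, (edge v (st v) ∧ st v ∈ S) ∧ (owner v = win v → win (st v) = win v) ∧
        (owner v ≠ win v → ∀ u ∈ S, edge v u → win u = win v) := by
      intro v hv
      by_cases hvX : v ∈ X
      · have hsv : st v = s₁ v := if_pos hvX
        rw [winB (hXB hvX), hsv]
        refine ⟨⟨(h₁.legal v hvX.1).1, (h₁.legal v hvX.1).2.1⟩,
          fun ho => winB (hXB (hstX v hvX ho)),
          fun ho u hu hvu => winB (hXB (hXclosed v hvX ho u hu hvu))⟩
      by_cases hvB : v ∈ B
      · have hsv : st v = if owner v = !p then sB v else nx v := by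
          simp only [hst]; rw [if_neg hvX, if_pos hvB]
        rw [winB hvB, hsv]
        split_ifs with ho
        · have := hB1 v hvB hvX ho
          exact ⟨⟨this.1, hBS this.2⟩, fun _ => winB this.2, fun h => absurd ho h⟩
        · exact ⟨(hnx v hv).symm, fun h => absurd h ho,
            fun _ u hu hvu => winB (hB2 v hvB hvX ho u hu hvu)⟩
      · have hsv : st v = s₂ v := by simp only [hst]; rw [if_neg hvX, if_neg hvB]
        have hl := h₂.legal v ⟨hv, hvB⟩
        rw [hsv]
        refine ⟨⟨hl.1, hl.2.1⟩, fun ho => ?_, fun ho u hu hvu => ?_⟩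
        · rw [winN hvB] at ho ⊢
          rw [winN hl.2.2, h₂.own v ⟨hv, hvB⟩ ho]
        · by_cases hw : win v = p
          · rw [hw] at ho ⊢
            exact (hclosed v hv hvB hw ho u hu hvu).2
          · by_cases huB : u ∈ B
            · rw [winB huB, hne' hw]
            · rw [winN hvB] at ho ⊢
              rw [winN huB, h₂.opp v ⟨hv, hvB⟩ ho u ⟨hu, huB⟩ hvu]
    refine ⟨win, st, fun v hv => (hsol v hv).1, fun v hv => (hsol v hv).2.1,
      fun v hv => (hsol v hv).2.2, ?_⟩
    intro ρ hS hedge hcons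
    have hwini : ∀ i, win (ρ i) = win (ρ 0) := by
      intro i
      induction i with
      | zero => rfl
      | succ i ih =>
        by_cases ho : owner (ρ i) = win (ρ 0)
        · rw [hcons i ho, (hsol _ (hS i)).2.1 (by rw [ho, ih]), ih]
        · rw [(hsol _ (hS i)).2.2 (by rwa [ih]) _ (hS _) (hedge i), ih]
    by_cases hB : ∃ a, ρ a ∈ B
    · -- The play reaches `X` and stays there.
      obtain ⟨a, ha⟩ := hB
      have hw0 : win (ρ 0) = !p := by rw [← hwini a, winB ha]
      rw [hw0] at hcons
      obtain ⟨b, hb⟩ := hB5 (fun i => ρ (a + i)) (fun i => hS _) (fun i => hedge _)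
        (fun i h1 h2 h3 => by
          rw [← add_assoc, hcons _ h3]
          simp only [hst]
          rw [if_neg h2, if_pos h1, if_pos h3]) ha
      have hmem : ∀ i, ρ (i + (a + b)) ∈ X := by
        intro i
        induction i with
        | zero => rwa [zero_add]
        | succ i ih =>
          rw [show i + 1 + (a + b) = i + (a + b) + 1 by omega]
          by_cases ho : owner (ρ (i + (a + b))) = !p
          · rw [hcons _ ho, show st _ = s₁ _ from if_pos ih]
            exact hstX _ ih ho
          · exact hXclosed _ ih ho _ (hS _) (hedge _)
      have h0 : w₁ (ρ (0 + (a + b))) = !p := hXw _ (hmem 0)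
      have := h₁.good (fun i => ρ (i + (a + b))) (fun i => (hmem i).1) (fun i => by
          have := hedge (i + (a + b))
          rwa [show i + (a + b) + 1 = i + 1 + (a + b) by omega] at this) (fun i hi => by
          have := hcons (i + (a + b)) (hi.trans h0)
          rw [show i + (a + b) + 1 = i + 1 + (a + b) by omega] at this
          rw [this]
          exact if_pos (hmem i))
      rw [← parityAccepts_add _ (a + b), hw0]
      exact this.trans (by rw [h0])
    · push Not at hB
      have h0 : win (ρ 0) = w₂ (ρ 0) := winN (hB 0)
      rw [h0]
      refine h₂.good ρ (fun i => ⟨hS i, hB i⟩) hedge fun i hi => ?_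
      rw [hcons i (by rw [h0, hi])]
      simp only [hst]
      rw [if_neg fun h => hB i (hXB h), if_neg (hB i)]

end Determinacy

/-- The history and the current vertex after `i` rounds of the play from `v` in which the next
vertex is given by `next`. -/
def playFrom {V : Type} (next : List V → V → V) (v : V) : ℕ → List V × V
  | 0 => ([], v)
  | i + 1 => ((playFrom next v i).1 ++ [(playFrom next v i).2],
      next (playFrom next v i).1 (playFrom next v i).2)

theorem pre_succ {α : Type} (w : ℕ → α) (k : ℕ) : pre w (k + 1) = pre w k ++ [w k] := by
  simp [pre, List.range_succ]

theorem exists_play {V : Type} (next : List V → V → V) (v : V) :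
    ∃ ρ : ℕ → V, ρ 0 = v ∧ ∀ i, ρ (i + 1) = next (pre ρ i) (ρ i) := by
  refine ⟨fun i => (playFrom next v i).2, rfl, fun i => ?_⟩
  have : ∀ i, pre (fun i => (playFrom next v i).2) i = (playFrom next v i).1 := by
    intro i
    induction i with
    | zero => rfl
    | succ i ih => rw [pre_succ, ih]; rfl
  rw [this]
  rfl

namespace ParityGame

variable (G : ParityGame)

/-- Every play from `v` in which the environment follows `r` violates the parity condition. -/
def LosesFrom (r : Fin G.n → Fin G.n) (v : Fin G.n) : Prop :=
  ∀ ρ : ℕ → Fin G.n, ρ 0 = v → (∀ i, G.edge (ρ i) (ρ (i + 1)) = true) →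
    (∀ i, G.owner (ρ i) = false → ρ (i + 1) = r (ρ i)) → ¬ ParityAccepts fun i => G.color (ρ i)

/-- A positional strategy of the environment that defeats all plays defeats every strategy of the
controller, also one with memory. -/
theorem not_mem_winRegion {r : Fin G.n → Fin G.n} (hr : ∀ v, G.edge v (r v) = true) {v : Fin G.n}
    (h : G.LosesFrom r v) : v ∉ G.WinRegion := by
  rintro ⟨τ, hτ, hwin⟩
  obtain ⟨ρ, h0, hρ⟩ := exists_play (fun h v => if G.owner v = true then τ h v else r v) v
  refine h ρ h0 (fun i => ?_) (fun i hi => ?_) (hwin ρ h0 (fun i => ?_) fun i hi => ?_)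
  · rw [hρ]; split_ifs with ho
    exacts [hτ _ _ ho, hr _]
  · rw [hρ, if_neg (by simp [hi])]
  · rw [hρ]; split_ifs with ho
    exacts [hτ _ _ ho, hr _]
  · rw [hρ, if_pos hi]

/-- Positional determinacy, with strategies that do not depend on the starting vertex. -/
theorem exists_positional : ∃ s r : Fin G.n → Fin G.n, (∀ v, G.edge v (s v) = true) ∧
    (∀ v, G.edge v (r v) = true) ∧ ∀ v, G.WinsFrom (fun _ => s) v ∨ G.LosesFrom r v := by
  obtain ⟨win, st, h⟩ := exists_solves (fun v u => G.edge v u = true) G.owner G.color Set.univ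
    (fun v _ => (G.total v).imp fun u hu => ⟨trivial, hu⟩)
  refine ⟨st, st, fun v => (h.legal v trivial).1, fun v => (h.legal v trivial).1, fun v => ?_⟩
  cases hv : win v with
  | true =>
    exact Or.inl fun ρ h0 hedge hcons => (h.good ρ (fun _ => trivial) hedge
      (fun i hi => hcons i (by rw [hi, h0, hv]))).2 (by rw [h0, hv])
  | false =>
    refine Or.inr fun ρ h0 hedge hcons hacc => ?_
    have := (h.good ρ (fun _ => trivial) hedge
      (fun i hi => hcons i (by rw [hi, h0, hv]))).1 hacc
    rw [h0, hv] at this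
    exact Bool.false_ne_true this

theorem exists_isMemorylessWinning : ∃ s, G.IsMemorylessWinning s := by
  obtain ⟨s, r, hs, hr, h⟩ := G.exists_positional
  exact ⟨s, fun _ v _ => hs v, fun v hv => (h v).resolve_right fun hl =>
    G.not_mem_winRegion hr hl hv⟩

theorem mem_winRegion_or (v : Fin G.n) :
    v ∈ G.WinRegion ∨ ∃ r, (∀ v, G.edge v (r v) = true) ∧ G.LosesFrom r v := by
  obtain ⟨s, r, hs, hr, h⟩ := G.exists_positional
  exact (h v).imp (fun hw => ⟨fun _ => s, fun _ v _ => hs v, hw⟩) fun hl => ⟨r, hr, hl⟩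

end ParityGame

/-! ### The assumption attached to a strategy of the controller -/

section Assumption

variable {I O : Type}

theorem pre_eq_pre_iff {α : Type} {u w : ℕ → α} {k : ℕ} :
    pre u k = pre w k ↔ ∀ j < k, u j = w j := by
  simp [pre]

theorem pre_congr {α : Type} {u w : ℕ → α} {k : ℕ} (h : ∀ j < k, u j = w j) : pre u k = pre w k :=
  pre_eq_pre_iff.2 h

@[simp] theorem length_pre {α : Type} (w : ℕ → α) (k : ℕ) : (pre w k).length = k := by simp [pre]

theorem take_pre {α : Type} (w : ℕ → α) {j k : ℕ} (h : j ≤ k) : (pre w k).take j = pre w j := by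
  simp [pre, ← List.map_take, List.take_range, h]

theorem exists_word {α : Type} (next : List α → α) : ∃ w : ℕ → α, ∀ i, w i = next (pre w i) := by
  obtain ⟨w, h0, h⟩ := exists_play (fun h a => next (h ++ [a])) (next [])
  refine ⟨w, fun i => ?_⟩
  cases i with
  | zero => exact h0
  | succ i => rw [h, pre_succ]

/-- The first `k` output letters of `w` are those prescribed by `σ`. -/
def Conforms (σ : Strategy I O) (w : ℕ → I × O) (k : ℕ) : Prop :=
  ∀ j < k, (w j).2 = σ (pre w j) (w j).1

theorem Conforms.congr {σ : Strategy I O} {u w : ℕ → I × O} {k : ℕ} (h : Conforms σ w k)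
    (huw : ∀ j < k, u j = w j) : Conforms σ u k := fun j hj => by
  rw [huw j hj, h j hj, pre_congr fun i hi => huw i (hi.trans hj)]

theorem Conforms.mono {σ : Strategy I O} {w : ℕ → I × O} {j k : ℕ} (h : Conforms σ w k)
    (hjk : j ≤ k) : Conforms σ w j := fun i hi => h i (hi.trans_le hjk)

/-- A word that does not conform to `σ` has a first deviation. -/
theorem exists_first_deviation {σ : Strategy I O} {w : ℕ → I × O} {k : ℕ}
    (h : ¬ Conforms σ w k) : ∃ j < k, Conforms σ w j ∧ (w j).2 ≠ σ (pre w j) (w j).1 := by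
  induction k with
  | zero => exact absurd (fun j hj => absurd hj (Nat.not_lt_zero j)) h
  | succ k ih =>
    by_cases hk : Conforms σ w k
    · refine ⟨k, Nat.lt_succ_self k, hk, fun heq => h fun j hj => ?_⟩
      rcases Nat.lt_succ_iff_lt_or_eq.1 hj with hj | rfl
      exacts [hk j hj, heq]
    · obtain ⟨j, hj, h'⟩ := ih hk
      exact ⟨j, hj.trans (Nat.lt_succ_self k), h'⟩

/-- While the word conforms to `σ`, each of its inputs can still be continued to an outcome of `σ`
in `L`; and if it conforms to `σ` forever, it is in `L`. This is the largest ensurable subset of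
the words that are in `L` or deviate from `σ`. -/
def assumptionOf (σ : Strategy I O) (L : Set (ℕ → I × O)) : Set (ℕ → I × O) :=
  {w | (∀ k, Conforms σ w k →
      ∃ u ∈ L, u ∈ Out σ ∧ (∀ j < k, u j = w j) ∧ (u k).1 = (w k).1) ∧ (w ∈ Out σ → w ∈ L)}

theorem sufficient_assumptionOf (σ : Strategy I O) (L : Set (ℕ → I × O)) :
    Sufficient (assumptionOf σ L) L := ⟨σ, fun _ hw => hw.2.2 hw.1⟩

/-- Along the inputs of an outcome of `σ` in `L`, the assumption holds whatever the controller
does. -/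
theorem mem_assumptionOf {σ : Strategy I O} {L : Set (ℕ → I × O)} {u v : ℕ → I × O} (hL : u ∈ L)
    (hσ : u ∈ Out σ) (h : ∀ i, (v i).1 = (u i).1) : v ∈ assumptionOf σ L := by
  have key : ∀ k, Conforms σ v k → ∀ j < k, u j = v j := by
    intro k hk j
    induction j using Nat.strong_induction_on with
    | _ j ih =>
      intro hj
      refine Prod.ext (h j).symm ?_
      rw [hk j hj, hσ j, h j, pre_congr fun i hi => ih i hi (hi.trans hj)]
  refine ⟨fun k hk => ⟨u, hL, hσ, key k hk, (h k).symm⟩, fun hv => ?_⟩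
  have : u = v := funext fun j => key (j + 1) (fun i _ => hv i) j (Nat.lt_succ_self j)
  exact this ▸ hL

theorem isEnsurable_assumptionOf (σ : Strategy I O) (L : Set (ℕ → I × O)) :
    IsEnsurable (assumptionOf σ L) := by
  classical
  rintro h ⟨w, hwh, hw⟩
  by_cases hc : Conforms σ w h.length
  · obtain ⟨u, huL, huσ, huw, -⟩ := hw.1 _ hc
    refine ⟨fun g => (u g.length).1, ⟨u, ?_, fun i => by simp⟩, fun v hv => ?_⟩
    · exact (pre_congr huw).trans hwh
    · exact mem_assumptionOf huL huσ fun i => by rw [hv i]; simp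
  · obtain ⟨j, hj, hcj, hdev⟩ := exists_first_deviation hc
    obtain ⟨u, huL, huσ, huw, huj⟩ := hw.1 _ hcj
    have huw' : ∀ i ≤ j, (u i).1 = (w i).1 := fun i hi => by
      rcases hi.lt_or_eq with hi | rfl
      exacts [by rw [huw i hi], huj]
    have htake : ∀ (v : ℕ → I × O) i, i ≤ j → (pre v i).take (j + 1) ≠ pre w (j + 1) := by
      intro v i hi heq
      have := congrArg List.length heq
      simp at this
      omega
    refine ⟨fun g => if g.take (j + 1) = pre w (j + 1) then (w g.length).1 else (u g.length).1,
      ⟨w, hwh, fun i => ?_⟩, fun v hv => ?_⟩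
    · beta_reduce
      rcases Nat.lt_or_ge j i with hi | hi
      · rw [if_pos (take_pre w (by omega)), length_pre]
      · rw [if_neg (htake w i hi), length_pre, huw' i hi]
    · by_cases hvw : pre v (j + 1) = pre w (j + 1)
      · have hvw' := pre_eq_pre_iff.1 hvw
        have hnot : ∀ k, j < k → ¬ Conforms σ v k := fun k hk hck => hdev <| by
          have := hck j hk
          rwa [hvw' j (by omega), pre_congr fun i hi => hvw' i (by omega)] at this
        refine ⟨fun k hk => ?_, fun hvσ => absurd (fun i _ => hvσ i) (hnot (j + 1) (by omega))⟩
        have hkj : k ≤ j := not_lt.1 fun hjk => hnot k hjk hk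
        exact ⟨u, huL, huσ, fun i hi => by rw [huw i (by omega), hvw' i (by omega)],
          by rw [huw' k hkj, hvw' k (by omega)]⟩
      · refine mem_assumptionOf huL huσ fun i => ?_
        rw [hv i]
        beta_reduce
        rw [if_neg, length_pre]
        rcases Nat.lt_or_ge j i with hi | hi
        · rwa [take_pre v (by omega)]
        · exact htake v i hi

/-- No ensurable assumption beyond `assumptionOf σ L` is sufficient for `L`, if `σ` wins wherever
the controller can win (`h₁`, where the first move is `o` and the further moves are those of `σ'`),
and lets the environment reach `L` wherever some word of `L` is left (`h₂`). -/
theorem eq_assumptionOf_of_subset {σ : Strategy I O} {L : Set (ℕ → I × O)}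
    (h₁ : ∀ (b : ℕ → I × O) (k : ℕ) (o : O) (σ' : Strategy I O), Conforms σ b k →
      (∀ u : ℕ → I × O, (∀ j < k, u j = b j) → u k = ((b k).1, o) →
        (∀ i, k < i → (u i).2 = σ' (pre u i) (u i).1) → u ∈ L) →
      ∀ w ∈ Out σ, (∀ j < k, w j = b j) → (w k).1 = (b k).1 → w ∈ L)
    (h₂ : ∀ w ∈ L, ∀ k, Conforms σ w k →
      ∃ u ∈ L, u ∈ Out σ ∧ (∀ j < k, u j = w j) ∧ (u k).1 = (w k).1)
    {B : Set (ℕ → I × O)} (hB : IsEnsurable B) (hBL : Sufficient B L)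
    (hsub : assumptionOf σ L ⊆ B) : B ⊆ assumptionOf σ L := by
  obtain ⟨σ', hσ'⟩ := hBL
  intro b hb
  -- Where `σ'` and `σ` part on `b`, the assumption leaves `σ'` on its own, so `σ'` wins there.
  have hwin : ∀ j, Conforms σ b (j + 1) → Conforms σ' b j → (b j).2 ≠ σ' (pre b j) (b j).1 →
      (∀ i ≤ j, ∃ u ∈ L, u ∈ Out σ ∧ (∀ l < i, u l = b l) ∧ (u i).1 = (b i).1) →
      ∀ w ∈ Out σ, (∀ i < j, w i = b i) → (w j).1 = (b j).1 → w ∈ L := by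
    intro j hc hc' hdev hwit
    refine h₁ b j (σ' (pre b j) (b j).1) σ' (hc.mono (by omega)) fun u hub huj hu => ?_
    have hnot : ∀ k, j < k → ¬ Conforms σ u k := fun k hk hck => hdev <| by
      have h1 := hck j hk
      rw [huj, pre_congr hub] at h1
      exact (hc j (by omega)).trans h1.symm
    have huσ' : u ∈ Out σ' := fun i => by
      rcases lt_trichotomy i j with hi | rfl | hi
      · exact (hc'.congr hub) i hi
      · rw [huj, pre_congr hub]
      · exact hu i hi
    refine hσ' ⟨huσ', hsub ⟨fun k hk => ?_, fun h => absurd (fun i _ => h i) (hnot (j + 1)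
      (by omega))⟩⟩
    have hkj : k ≤ j := not_lt.1 fun hjk => hnot k hjk hk
    obtain ⟨v, hvL, hvσ, hvb, hvk⟩ := hwit k hkj
    refine ⟨v, hvL, hvσ, fun i hi => by rw [hvb i hi, hub i (by omega)], ?_⟩
    rcases hkj.lt_or_eq with hkj | rfl
    exacts [by rw [hvk, hub k hkj], by rw [hvk, huj]]
  have hwit : ∀ k, Conforms σ b k →
      ∃ u ∈ L, u ∈ Out σ ∧ (∀ j < k, u j = b j) ∧ (u k).1 = (b k).1 := by
    intro k
    induction k using Nat.strong_induction_on with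
    | _ k ih =>
      intro hk
      -- In either case some word of `L` continues `b`.
      suffices h : ∃ w ∈ L, (∀ j < k, w j = b j) ∧ (w k).1 = (b k).1 by
        obtain ⟨w, hwL, hwb, hwk⟩ := h
        obtain ⟨u, huL, huσ, huw, huk⟩ := h₂ w hwL k (hk.congr hwb)
        exact ⟨u, huL, huσ, fun j hj => by rw [huw j hj, hwb j hj], huk.trans hwk⟩
      by_cases hc' : Conforms σ' b k
      · obtain ⟨τ, ⟨v, hvb, hvτ⟩, hτB⟩ := hB (pre b (k + 1)) ⟨b, by simp [Cone], hb⟩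
        have hvb' : ∀ j < k + 1, v j = b j := pre_eq_pre_iff.1 (by simpa [Cone] using hvb)
        obtain ⟨u, hu⟩ := exists_word fun h : List (I × O) => (τ h, σ' h (τ h))
        have hub : ∀ j < k, u j = b j := by
          intro j
          induction j using Nat.strong_induction_on with
          | _ j ihj =>
            intro hj
            have hpre : pre u j = pre v j :=
              pre_congr fun i hi => by rw [ihj i hi (hi.trans hj), hvb' i (by omega)]
            have hfst : τ (pre u j) = (b j).1 := by rw [hpre, ← hvτ j, hvb' j (by omega)]
            rw [hu j]
            refine Prod.ext hfst ?_
            simp only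
            rw [hfst, hc' j hj, pre_congr fun i hi => ihj i hi (hi.trans hj)]
        refine ⟨u, hσ' ⟨fun i => ?_, hτB fun i => ?_⟩, hub, ?_⟩
        · rw [hu i]
        · rw [hu i]
        · rw [hu k, ← hvb' k (by omega), hvτ k]
          simp only
          rw [pre_congr fun j hj => (hub j hj).trans (hvb' j (by omega)).symm]
      · obtain ⟨j, hj, hcj, hdev⟩ := exists_first_deviation hc'
        have hall := hwin j (hk.mono hj) hcj hdev fun i hi =>
          ih i (by omega) (hk.mono (by omega))
        -- Continue `b` with its next input and any further ones against `σ`.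
        obtain ⟨u, hu⟩ := exists_word fun h : List (I × O) =>
          ((b h.length).1, σ h (b h.length).1)
        have hub : ∀ j < k, u j = b j := by
          intro j
          induction j using Nat.strong_induction_on with
          | _ j ihj =>
            intro hj
            rw [hu j, length_pre]
            refine Prod.ext rfl ?_
            simp only
            rw [hk j hj, pre_congr fun i hi => ihj i hi (hi.trans hj)]
        have huσ : u ∈ Out σ := fun i => by rw [hu i]
        exact ⟨u, hall u huσ (fun i hi => hub i (by omega)) (by rw [hub j hj]), hub,
          by rw [hu k, length_pre]⟩
  refine ⟨hwit, fun hbσ => ?_⟩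
  by_cases hbσ' : b ∈ Out σ'
  · exact hσ' ⟨hbσ', hb⟩
  · obtain ⟨i, hi⟩ := not_forall.1 hbσ'
    obtain ⟨j, hj, hcj, hdev⟩ := exists_first_deviation (σ := σ') (w := b) (k := i + 1)
      fun h => hi (h i (by omega))
    exact hwin j (fun i _ => hbσ i) hcj hdev (fun i _ => hwit i fun i _ => hbσ i) b hbσ
      (fun _ _ => rfl) rfl

end Assumption

/-! ### The game of a deterministic automaton -/

theorem parityAccepts_const (d : ℕ) : (ParityAccepts fun _ => d) ↔ Even d :=
  parityAccepts_iff ⟨(Frequently.of_forall fun _ => rfl), fun k hk => by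
    obtain ⟨_, h⟩ := Frequently.exists hk
    exact h.le⟩

theorem parityAccepts_congr_add {c c' : ℕ → ℕ} (n : ℕ) (h : ∀ i, c (i + n) = c' (i + n)) :
    ParityAccepts c ↔ ParityAccepts c' := by
  rw [← parityAccepts_add c n, ← parityAccepts_add c' n]
  simp only [h]

theorem flat_even {I O : Type} (w : ℕ → I × O) (k : ℕ) : flat w (2 * k) = Sum.inl (w k).1 := by
  simp [flat]

theorem flat_odd {I O : Type} (w : ℕ → I × O) (k : ℕ) : flat w (2 * k + 1) = Sum.inr (w k).2 := by
  have : (2 * k + 1) / 2 = k := by omega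
  simp [flat, this]

theorem flat_injective {I O : Type} : Function.Injective (flat : (ℕ → I × O) → ℕ → I ⊕ O) := by
  intro w w' h
  funext k
  refine Prod.ext (Sum.inl_injective (β := O) ?_) (Sum.inr_injective (α := I) ?_)
  · rw [← flat_even, ← flat_even, h]
  · rw [← flat_odd, ← flat_odd, h]

namespace ParityAutomaton

variable {kI kO : ℕ} (A : ParityAutomaton kI kO)

/-- The transition relation on numbers. -/
def Tr (s : ℕ) (a : Fin kI ⊕ Fin kO) (t : ℕ) : Prop :=
  ∃ (hs : s < A.n) (ht : t < A.n), A.trans ⟨s, hs⟩ a ⟨t, ht⟩ = true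

/-- The transition function on numbers, with `A.n` as a rejecting sink. -/
noncomputable def step (s : ℕ) (a : Fin kI ⊕ Fin kO) : ℕ := Expr.leastBelow (A.Tr s a) A.n

/-- The colours, with an odd colour for the sink. -/
def col (s : ℕ) : ℕ := if h : s < A.n then A.color ⟨s, h⟩ else 1

theorem step_le (s : ℕ) (a : Fin kI ⊕ Fin kO) : A.step s a ≤ A.n := Expr.leastBelow_le

theorem step_sink (a : Fin kI ⊕ Fin kO) : A.step A.n a = A.n :=
  Expr.leastBelow_of_not fun ⟨_, _, h, _⟩ => lt_irrefl _ h

variable {A} in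
theorem Deterministic.step_eq (hA : A.Deterministic) {s t : Fin A.n} {a : Fin kI ⊕ Fin kO}
    (h : A.trans s a t = true) : A.step s a = t := by
  obtain ⟨h1, h2, h3, h4⟩ := Expr.leastBelow_spec (P := A.Tr s a) (n := A.n)
    ⟨(t : ℕ), t.2, s.2, t.2, h⟩
  exact congrArg Fin.val (hA s a _ _ h4 h)

/-- The sequence of states on an infinite word. -/
noncomputable def run (v : ℕ → Fin kI ⊕ Fin kO) : ℕ → ℕ
  | 0 => A.start
  | i + 1 => A.step (run v i) (v i)

theorem run_le (v : ℕ → Fin kI ⊕ Fin kO) (i : ℕ) : A.run v i ≤ A.n := by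
  cases i with
  | zero => exact A.start.2.le
  | succ i => exact A.step_le _ _

theorem exists_col_le : ∃ N, ∀ s, A.col s ≤ N := by
  obtain ⟨N, hN⟩ := Finite.exists_le A.color
  refine ⟨N + 1, fun s => ?_⟩
  rw [col]
  split_ifs with h
  · exact (hN _).trans (by omega)
  · omega

variable {A} in
theorem Deterministic.mem_language_iff (hA : A.Deterministic) (v : ℕ → Fin kI ⊕ Fin kO) :
    v ∈ A.language ↔ ParityAccepts fun i => A.col (A.run v i) := by
  constructor
  · rintro ⟨ρ, h0, hρ, hacc⟩
    have : ∀ i, A.run v i = ρ i := by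
      intro i
      induction i with
      | zero => rw [run, h0]
      | succ i ih => rw [run, ih, hA.step_eq (hρ i)]
    simpa [this, col] using hacc
  · intro hacc
    by_cases hn : ∃ i, A.run v i = A.n
    · obtain ⟨i, hi⟩ := hn
      have : ∀ j, A.run v (j + i) = A.n := by
        intro j
        induction j with
        | zero => rwa [zero_add]
        | succ j ih => rw [show j + 1 + i = j + i + 1 by omega, run, ih, step_sink]
      rw [← parityAccepts_add _ i] at hacc
      simp only [this, col, lt_irrefl, dite_false] at hacc
      rw [parityAccepts_const] at hacc
      exact absurd hacc (by decide)
    · have hlt : ∀ i, A.run v i < A.n := fun i =>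
        lt_of_le_of_ne (A.run_le v i) fun h => hn ⟨i, h⟩
      refine ⟨fun i => ⟨A.run v i, hlt i⟩, rfl, fun i => ?_, by simpa [col, hlt] using hacc⟩
      have h1 : A.step (A.run v i) (v i) < A.n := hlt (i + 1)
      have h2 : ∃ t < A.n, A.Tr (A.run v i) (v i) t := by
        by_contra h
        rw [step, Expr.leastBelow_of_not h] at h1
        exact lt_irrefl _ h1
      exact (Expr.leastBelow_spec h2).2.2.2

/-- The state reached on a finite word of pairs. -/
noncomputable def stateAt (h : List (Fin kI × Fin kO)) : ℕ :=
  h.foldl (fun s p => A.step (A.step s (Sum.inl p.1)) (Sum.inr p.2)) A.start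

theorem stateAt_pre (w : ℕ → Fin kI × Fin kO) (k : ℕ) :
    A.stateAt (pre w k) = A.run (flat w) (2 * k) := by
  induction k with
  | zero => rfl
  | succ k ih =>
    rw [pre_succ, stateAt, List.foldl_append]
    change A.step (A.step (A.stateAt (pre w k)) _) _ = _
    rw [ih, ← flat_even, ← flat_odd]
    rfl

theorem run_flat_odd (w : ℕ → Fin kI × Fin kO) (k : ℕ) :
    A.run (flat w) (2 * k + 1) = A.step (A.stateAt (pre w k)) (Sum.inl (w k).1) := by
  rw [stateAt_pre, run, flat_even]

theorem run_flat_even_succ (w : ℕ → Fin kI × Fin kO) (k : ℕ) :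
    A.run (flat w) (2 * k + 2) = A.step (A.run (flat w) (2 * k + 1)) (Sum.inr (w k).2) := by
  rw [run, flat_odd]

/-- The edges of the game in which the environment chooses the inputs and the controller chooses
the outputs. Vertex `2 * s` is state `s` before an input, vertex `2 * s + 1` is state `s` before an
output. -/
def GEdge (x y : ℕ) : Prop :=
  (x % 2 = 0 ∧ y % 2 = 1 ∧ ∃ i, A.step (x / 2) (Sum.inl i) = y / 2) ∨
    (x % 2 = 1 ∧ y % 2 = 0 ∧ ∃ o, A.step (x / 2) (Sum.inr o) = y / 2)

theorem GEdge.lt {A : ParityAutomaton kI kO} {x y : ℕ} (h : A.GEdge x y) : y < 2 * (A.n + 1) := by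
  rcases h with ⟨-, -, i, hi⟩ | ⟨-, -, o, ho⟩
  · have := A.step_le (x / 2) (Sum.inl i)
    omega
  · have := A.step_le (x / 2) (Sum.inr o)
    omega

/-- The vertex of the game after `i` letters of the word `w`. -/
noncomputable def vertexAt (w : ℕ → Fin kI × Fin kO) (i : ℕ) : ℕ := 2 * A.run (flat w) i + i % 2

theorem vertexAt_lt (w : ℕ → Fin kI × Fin kO) (i : ℕ) : A.vertexAt w i < 2 * (A.n + 1) := by
  have := A.run_le (flat w) i
  rw [vertexAt]
  omega

theorem gEdge_vertexAt (w : ℕ → Fin kI × Fin kO) (i : ℕ) :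
    A.GEdge (A.vertexAt w i) (A.vertexAt w (i + 1)) := by
  have e1 : A.vertexAt w i / 2 = A.run (flat w) i := by rw [vertexAt]; omega
  have e2 : A.vertexAt w (i + 1) / 2 = A.run (flat w) (i + 1) := by rw [vertexAt]; omega
  rw [GEdge, e1, e2, vertexAt, vertexAt, run]
  obtain ⟨k, rfl | rfl⟩ : ∃ k, i = 2 * k ∨ i = 2 * k + 1 := ⟨i / 2, by omega⟩
  · exact Or.inl ⟨by omega, by omega, _, by rw [flat_even]⟩
  · exact Or.inr ⟨by omega, by omega, _, by rw [flat_odd]⟩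

theorem col_vertexAt (w : ℕ → Fin kI × Fin kO) (i : ℕ) :
    A.col (A.vertexAt w i / 2) = A.col (A.run (flat w) i) := by
  congr 1; rw [vertexAt]; omega

/-- What is needed to know about the game: the winning region `W` of the controller with winning
strategies `s₀` and `s₁` of the controller and of the environment, and the set `E` of vertices from
which some path is accepting, with a choice of moves `s₂` that produces one. -/
structure Solution (s₀ s₁ s₂ : ℕ → ℕ) (W E : ℕ → Prop) : Prop where
  edge₀ : ∀ x < 2 * (A.n + 1), x % 2 = 1 → A.GEdge x (s₀ x)
  edge₁ : ∀ x < 2 * (A.n + 1), x % 2 = 0 → A.GEdge x (s₁ x)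
  edge₂ : ∀ x < 2 * (A.n + 1), A.GEdge x (s₂ x)
  win : ∀ ρ : ℕ → ℕ, ρ 0 < 2 * (A.n + 1) → W (ρ 0) → (∀ i, A.GEdge (ρ i) (ρ (i + 1))) →
    (∀ i, ρ i % 2 = 1 → ρ (i + 1) = s₀ (ρ i)) → ParityAccepts fun i => A.col (ρ i / 2)
  lose : ∀ ρ : ℕ → ℕ, ρ 0 < 2 * (A.n + 1) → ¬ W (ρ 0) → (∀ i, A.GEdge (ρ i) (ρ (i + 1))) →
    (∀ i, ρ i % 2 = 0 → ρ (i + 1) = s₁ (ρ i)) → ¬ ParityAccepts fun i => A.col (ρ i / 2)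
  accept : ∀ ρ : ℕ → ℕ, ρ 0 < 2 * (A.n + 1) → E (ρ 0) → (∀ i, ρ (i + 1) = s₂ (ρ i)) →
    ParityAccepts fun i => A.col (ρ i / 2)
  reject : ∀ ρ : ℕ → ℕ, ρ 0 < 2 * (A.n + 1) → ¬ E (ρ 0) → (∀ i, A.GEdge (ρ i) (ρ (i + 1))) →
    ¬ ParityAccepts fun i => A.col (ρ i / 2)

section Strategy

open Classical in
/-- The vertex that the controller aims at: it wins if it can, and cooperates otherwise. -/
noncomputable def target (s₀ s₂ : ℕ → ℕ) (W : ℕ → Prop) (x : ℕ) : ℕ :=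
  if W x then s₀ x else s₂ x

/-- The least output that leads from state `s` to state `t`. -/
noncomputable def outputTo (s t : ℕ) : ℕ :=
  Expr.leastBelow (fun o => ∃ h : o < kO, A.step s (Sum.inr ⟨o, h⟩) = t) kO

/-- The strategy of the controller that moves to the target. -/
noncomputable def ctrl (hO : 0 < kO) (s₀ s₂ : ℕ → ℕ) (W : ℕ → Prop) : Strategy (Fin kI) (Fin kO) :=
  fun h i =>
    let s := A.step (A.stateAt h) (Sum.inl i)
    let o := A.outputTo s (target s₀ s₂ W (2 * s + 1) / 2)
    if ho : o < kO then ⟨o, ho⟩ else ⟨0, hO⟩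

open Classical in
/-- An input that leads from state `s` to state `t`. -/
noncomputable def inputTo (hI : 0 < kI) (s t : ℕ) : Fin kI :=
  if h : ∃ i, A.step s (Sum.inl i) = t then h.choose else ⟨0, hI⟩

variable {A} (hI : 0 < kI) (hO : 0 < kO) {s₀ s₁ s₂ : ℕ → ℕ} {W E : ℕ → Prop}
  (hS : A.Solution s₀ s₁ s₂ W E)

include hS

theorem Solution.gEdge_target {x : ℕ} (hx : x < 2 * (A.n + 1)) (hodd : x % 2 = 1) :
    A.GEdge x (target s₀ s₂ W x) := by
  rw [target]
  split_ifs
  exacts [hS.edge₀ x hx hodd, hS.edge₂ x hx]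

theorem Solution.outputTo_lt {s : ℕ} (hs : s ≤ A.n) :
    A.outputTo s (target s₀ s₂ W (2 * s + 1) / 2) < kO := by
  rcases hS.gEdge_target (x := 2 * s + 1) (by omega) (by omega) with h | ⟨-, -, o, ho⟩
  · omega
  · rw [show (2 * s + 1) / 2 = s by omega] at ho
    exact (Expr.leastBelow_spec ⟨(o : ℕ), o.2, o.2, ho⟩).1

theorem Solution.step_outputTo {s : ℕ} (hs : s ≤ A.n) {o : Fin kO}
    (ho : (o : ℕ) = A.outputTo s (target s₀ s₂ W (2 * s + 1) / 2)) :
    2 * A.step s (Sum.inr o) = target s₀ s₂ W (2 * s + 1) := by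
  rcases hS.gEdge_target (x := 2 * s + 1) (by omega) (by omega) with h | ⟨-, h0, o', ho'⟩
  · omega
  · rw [show (2 * s + 1) / 2 = s by omega] at ho'
    obtain ⟨h1, h2⟩ := (Expr.leastBelow_spec
      (P := fun o => ∃ h : o < kO, A.step s (Sum.inr ⟨o, h⟩) = target s₀ s₂ W (2 * s + 1) / 2)
      ⟨(o' : ℕ), o'.2, o'.2, ho'⟩).2
    have h3 : o = ⟨_, h1⟩ := Fin.ext ho
    rw [h3, h2]
    omega

theorem Solution.val_ctrl (h : List (Fin kI × Fin kO)) (i : Fin kI) :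
    ((A.ctrl hO s₀ s₂ W h i : Fin kO) : ℕ) =
      A.outputTo (A.step (A.stateAt h) (Sum.inl i))
        (target s₀ s₂ W (2 * A.step (A.stateAt h) (Sum.inl i) + 1) / 2) := by
  rw [ctrl, dif_pos (hS.outputTo_lt (A.step_le _ _))]

theorem Solution.vertexAt_ctrl {w : ℕ → Fin kI × Fin kO} {k : ℕ}
    (h : (w k).2 = A.ctrl hO s₀ s₂ W (pre w k) (w k).1) :
    A.vertexAt w (2 * k + 1 + 1) = target s₀ s₂ W (A.vertexAt w (2 * k + 1)) := by
  have h1 := congrArg Fin.val h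
  rw [hS.val_ctrl hO, ← run_flat_odd] at h1
  have h2 := hS.step_outputTo (A.run_le _ _) h1
  rw [← run_flat_even_succ] at h2
  rw [vertexAt, vertexAt, show (2 * k + 1) % 2 = 1 by omega, ← h2,
    show 2 * k + 1 + 1 = 2 * k + 2 by omega]
  omega

omit hS in
theorem vertexAt_inputTo {r : ℕ → ℕ} (hr : ∀ x < 2 * (A.n + 1), x % 2 = 0 →
    A.GEdge x (r x)) {w : ℕ → Fin kI × Fin kO} {k : ℕ}
    (h : (w k).1 = A.inputTo hI (A.stateAt (pre w k)) (r (2 * A.stateAt (pre w k)) / 2)) :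
    A.vertexAt w (2 * k + 1) = r (A.vertexAt w (2 * k)) := by
  have h0 := A.run_le (flat w) (2 * k)
  rw [stateAt_pre] at h
  rw [vertexAt, vertexAt, show (2 * k) % 2 = 0 by omega, show (2 * k + 1) % 2 = 1 by omega, run,
    flat_even, add_zero]
  rcases hr (2 * A.run (flat w) (2 * k)) (by omega) (by omega) with ⟨-, h1, h2⟩ | h1
  · rw [show 2 * A.run (flat w) (2 * k) / 2 = A.run (flat w) (2 * k) by omega] at h2
    rw [h, inputTo, dif_pos h2, h2.choose_spec]
    omega
  · omega

/-- The controller strategy `s₀` does not leave the winning region. -/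
theorem Solution.stable {x y : ℕ} (hx : x < 2 * (A.n + 1)) (hW : W x) (hodd : x % 2 = 1)
    (hy : A.GEdge (s₀ x) y) : W y := by
  by_contra hWy
  have hedge : ∀ z < 2 * (A.n + 1), A.GEdge z (if z % 2 = 1 then s₀ z else s₁ z) := by
    intro z hz
    split_ifs with h
    exacts [hS.edge₀ z hz h, hS.edge₁ z hz (by omega)]
  -- From `y` on, both players follow their winning strategies.
  obtain ⟨ρ, h0, hρ⟩ := exists_play (fun _ z => if z % 2 = 1 then s₀ z else s₁ z) y
  have hlt : ∀ i, ρ i < 2 * (A.n + 1) := by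
    intro i
    induction i with
    | zero => rw [h0]; exact hy.lt
    | succ i ih => rw [hρ]; exact (hedge _ ih).lt
  refine hS.lose ρ (hlt 0) (by rwa [h0]) (fun i => by rw [hρ]; exact hedge _ (hlt i))
    (fun i hi => by rw [hρ, if_neg (by omega)]) ?_
  have h1 := hS.edge₀ x hx hodd
  have heven : s₀ x % 2 = 0 := by
    rcases h1 with h1 | h1 <;> omega
  let ρ' : ℕ → ℕ := fun i => if i = 0 then x else if i = 1 then s₀ x else ρ (i - 2)
  have key := hS.win ρ' hx hW
  rw [← parityAccepts_add _ 2] at key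
  refine key (fun i => ?_) fun i hi => ?_
  · obtain _ | _ | i := i
    · exact h1
    · simpa [ρ', h0] using hy
    · simp only [ρ', Nat.add_eq_zero_iff]
      norm_num
      rw [show i + 1 + 1 + 1 - 2 = i + 1 by omega, show i + 1 + 1 - 2 = i by omega, hρ]
      exact hedge _ (hlt i)
  · obtain _ | _ | i := i
    · rfl
    · simp [ρ'] at hi
      omega
    · simp only [ρ', Nat.add_eq_zero_iff] at hi ⊢
      norm_num at hi ⊢
      rw [show i + 1 + 1 - 2 = i by omega] at hi ⊢
      rw [show i + 1 + 1 + 1 - 2 = i + 1 by omega, hρ, if_pos hi]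

/-- If the controller strategy is followed from a winning vertex on, the word is accepted. -/
theorem Solution.accepts_of_win {w : ℕ → Fin kI × Fin kO} {k : ℕ}
    (hw : ∀ j, k ≤ j → (w j).2 = A.ctrl hO s₀ s₂ W (pre w j) (w j).1)
    (hW : W (A.vertexAt w (2 * k + 1))) : ParityAccepts fun i => A.col (A.run (flat w) i) := by
  have hmod : ∀ i, A.vertexAt w i % 2 = i % 2 := fun i => by rw [vertexAt]; omega
  have hWs : ∀ j, W (A.vertexAt w (2 * (k + j) + 1)) := by
    intro j
    induction j with
    | zero => exact hW
    | succ j ih =>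
      refine hS.stable (A.vertexAt_lt w _) ih (by rw [hmod]; omega) ?_
      have h1 := hS.vertexAt_ctrl hO (hw (k + j) (by omega))
      rw [target, if_pos ih] at h1
      rw [← h1]
      exact A.gEdge_vertexAt w _
  have key := hS.win (fun i => A.vertexAt w (i + (2 * k + 1))) (A.vertexAt_lt w _)
    (by simpa using hW) (fun i => by
      have := A.gEdge_vertexAt w (i + (2 * k + 1))
      rwa [show i + (2 * k + 1) + 1 = i + 1 + (2 * k + 1) by omega] at this) (fun i hi => by
      rw [hmod] at hi
      obtain ⟨j, hj⟩ : ∃ j, i + (2 * k + 1) = 2 * (k + j) + 1 := ⟨i / 2, by omega⟩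
      have h1 := hS.vertexAt_ctrl hO (hw (k + j) (by omega))
      rw [target, if_pos (hWs j)] at h1
      rw [hj, show i + 1 + (2 * k + 1) = 2 * (k + j) + 1 + 1 by omega, h1])
  rw [← parityAccepts_add _ (2 * k + 1)]
  simpa only [col_vertexAt] using key

variable {L : Set (ℕ → Fin kI × Fin kO)}
  (hL : ∀ w, w ∈ L ↔ ParityAccepts fun i => A.col (A.run (flat w) i))

omit hS in
theorem vertexAt_congr {u w : ℕ → Fin kI × Fin kO} {k : ℕ} (h : ∀ j < k, u j = w j)
    (hk : (u k).1 = (w k).1) : A.vertexAt u (2 * k + 1) = A.vertexAt w (2 * k + 1) := by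
  rw [vertexAt, vertexAt, run_flat_odd, run_flat_odd, pre_congr h, hk]

include hL

theorem Solution.exists_accepting {w : ℕ → Fin kI × Fin kO} {k : ℕ} (hw : w ∈ L) :
    E (A.vertexAt w (2 * k + 1)) := by
  by_contra hE
  refine hS.reject (fun i => A.vertexAt w (i + (2 * k + 1))) (A.vertexAt_lt w _) (by simpa using hE)
    (fun i => ?_) ?_
  · have := A.gEdge_vertexAt w (i + (2 * k + 1))
    rwa [show i + (2 * k + 1) + 1 = i + 1 + (2 * k + 1) by omega] at this
  · simp only [col_vertexAt]
    rw [parityAccepts_add (fun i => A.col (A.run (flat w) i)), ← hL]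
    exact hw

include hI

/-- The controller strategy wins wherever some strategy does. -/
theorem Solution.ctrl_wins (b : ℕ → Fin kI × Fin kO) (k : ℕ) (o : Fin kO)
    (σ' : Strategy (Fin kI) (Fin kO))
    (hwin : ∀ u : ℕ → Fin kI × Fin kO, (∀ j < k, u j = b j) → u k = ((b k).1, o) →
      (∀ i, k < i → (u i).2 = σ' (pre u i) (u i).1) → u ∈ L) :
    ∀ w ∈ Out (A.ctrl hO s₀ s₂ W), (∀ j < k, w j = b j) → (w k).1 = (b k).1 → w ∈ L := by
  intro w hw hwb hwk
  refine (hL w).2 (hS.accepts_of_win hO (k := k) (fun j _ => hw j) ?_)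
  rw [vertexAt_congr hwb hwk]
  by_contra hW
  -- The environment answers the given strategy with its own winning strategy.
  obtain ⟨u, hu⟩ := exists_word fun h : List (Fin kI × Fin kO) =>
    if h.length < k then b h.length else if h.length = k then ((b k).1, o) else
      (A.inputTo hI (A.stateAt h) (s₁ (2 * A.stateAt h) / 2),
        σ' h (A.inputTo hI (A.stateAt h) (s₁ (2 * A.stateAt h) / 2)))
  have hub : ∀ j < k, u j = b j := fun j hj => by
    rw [hu, length_pre, if_pos hj]
  have huk : u k = ((b k).1, o) := by rw [hu, length_pre, if_neg (lt_irrefl k), if_pos rfl]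
  have hui : ∀ i, k < i → u i = (A.inputTo hI (A.stateAt (pre u i))
      (s₁ (2 * A.stateAt (pre u i)) / 2), σ' (pre u i) (A.inputTo hI (A.stateAt (pre u i))
        (s₁ (2 * A.stateAt (pre u i)) / 2))) := fun i hi => by
    rw [hu i, length_pre, if_neg (by omega), if_neg (by omega)]
  have huL : u ∈ L := hwin u hub huk fun i hi => by rw [hui i hi]
  rw [hL, ← parityAccepts_add _ (2 * k + 1)] at huL
  simp only [← col_vertexAt] at huL
  refine hS.lose (fun i => A.vertexAt u (i + (2 * k + 1))) (A.vertexAt_lt u _) ?_ (fun i => ?_)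
    (fun i hi => ?_) huL
  · rw [zero_add, vertexAt_congr hub (by rw [huk])]
    exact hW
  · have := A.gEdge_vertexAt u (i + (2 * k + 1))
    rwa [show i + (2 * k + 1) + 1 = i + 1 + (2 * k + 1) by omega] at this
  · have hi' : (i + (2 * k + 1)) % 2 = 0 := by
      rw [vertexAt] at hi; omega
    obtain ⟨l, hl⟩ : ∃ l, i + (2 * k + 1) = 2 * l := ⟨(i + (2 * k + 1)) / 2, by omega⟩
    rw [hl, show i + 1 + (2 * k + 1) = 2 * l + 1 by omega]
    exact vertexAt_inputTo hI hS.edge₁ (by rw [hui l (by omega)])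

/-- Where an accepting path is left, the environment can reach `L` together with the controller
strategy. -/
theorem Solution.ctrl_cooperates {w : ℕ → Fin kI × Fin kO} {k : ℕ}
    (hE : E (A.vertexAt w (2 * k + 1))) (hc : Conforms (A.ctrl hO s₀ s₂ W) w k) :
    ∃ u ∈ L, u ∈ Out (A.ctrl hO s₀ s₂ W) ∧ (∀ j < k, u j = w j) ∧ (u k).1 = (w k).1 := by
  set σ := A.ctrl hO s₀ s₂ W with hσ
  obtain ⟨u, hu⟩ := exists_word fun h : List (Fin kI × Fin kO) =>
    if h.length < k then w h.length else if h.length = k then ((w k).1, σ h (w k).1) else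
      (A.inputTo hI (A.stateAt h) (s₂ (2 * A.stateAt h) / 2),
        σ h (A.inputTo hI (A.stateAt h) (s₂ (2 * A.stateAt h) / 2)))
  have huw : ∀ j < k, u j = w j := fun j hj => by
    rw [hu, length_pre, if_pos hj]
  have huk : u k = ((w k).1, σ (pre u k) (w k).1) := by
    rw [hu k, length_pre, if_neg (lt_irrefl k), if_pos rfl]
  have hui : ∀ i, k < i → u i = (A.inputTo hI (A.stateAt (pre u i))
      (s₂ (2 * A.stateAt (pre u i)) / 2), σ (pre u i) (A.inputTo hI (A.stateAt (pre u i))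
        (s₂ (2 * A.stateAt (pre u i)) / 2))) := fun i hi => by
    rw [hu i, length_pre, if_neg (by omega), if_neg (by omega)]
  have huσ : u ∈ Out σ := fun i => by
    rcases lt_trichotomy i k with hi | rfl | hi
    · exact (hc.congr huw) i hi
    · rw [huk]
    · rw [hui i hi]
  refine ⟨u, (hL u).2 ?_, huσ, huw, by rw [huk]⟩
  by_cases hW : ∃ l, k ≤ l ∧ W (A.vertexAt u (2 * l + 1))
  · obtain ⟨l, -, hW⟩ := hW
    exact hS.accepts_of_win hO (fun j _ => huσ j) hW
  · push Not at hW
    rw [← parityAccepts_add _ (2 * k + 1)]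
    simp only [← col_vertexAt]
    refine hS.accept (fun i => A.vertexAt u (i + (2 * k + 1))) (A.vertexAt_lt u _) ?_ (fun i => ?_)
    · rw [zero_add, vertexAt_congr huw (by rw [huk])]
      exact hE
    · obtain ⟨l, hl | hl⟩ : ∃ l, i + (2 * k + 1) = 2 * l ∨ i + (2 * k + 1) = 2 * l + 1 :=
        ⟨(i + (2 * k + 1)) / 2, by omega⟩
      · rw [hl, show i + 1 + (2 * k + 1) = 2 * l + 1 by omega]
        exact vertexAt_inputTo hI (fun x hx _ => hS.edge₂ x hx) (by rw [hui l (by omega)])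
      · rw [hl, show i + 1 + (2 * k + 1) = 2 * l + 1 + 1 by omega,
          hS.vertexAt_ctrl hO (huσ l), target, if_neg (hW l (by omega))]

end Strategy

end ParityAutomaton

namespace ParityAutomaton

/-! ### The automaton of the optimal assumption -/

variable {kI kO : ℕ} (A : ParityAutomaton kI kO)

/-- The transition relation of the assumption automaton, on numbers. State `2 * s + b` with
`s ≤ A.n` is the corresponding vertex of the game; the state component `A.n + 1` is reached when the
controller deviates, and from there on every word is accepted. An input is disabled if no
accepting path is left after it. -/
def BTr (s₀ s₂ : ℕ → ℕ) (W E : ℕ → Prop) (x : ℕ) : Fin kI ⊕ Fin kO → ℕ → Prop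
  | Sum.inl i, y => x % 2 = 0 ∧ y % 2 = 1 ∧
      ((x / 2 ≤ A.n ∧ A.step (x / 2) (Sum.inl i) = y / 2 ∧ E y) ∨
        (A.n < x / 2 ∧ y / 2 = A.n + 1))
  | Sum.inr o, y => x % 2 = 1 ∧ y % 2 = 0 ∧
      ((x / 2 ≤ A.n ∧ (o : ℕ) = A.outputTo (x / 2) (target s₀ s₂ W x / 2) ∧
          A.step (x / 2) (Sum.inr o) = y / 2) ∨
        ((x / 2 ≤ A.n → (o : ℕ) ≠ A.outputTo (x / 2) (target s₀ s₂ W x / 2)) ∧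
          y / 2 = A.n + 1))

/-- The colours of the assumption automaton, on numbers. -/
def bCol (x : ℕ) : ℕ := if x / 2 ≤ A.n then A.col (x / 2) else 0

open Classical in
/-- The automaton of the assumption attached to the controller strategy of a solution of the
game. -/
noncomputable def assumptionAutomaton (s₀ s₂ : ℕ → ℕ) (W E : ℕ → Prop) : ParityAutomaton kI kO where
  n := 2 * (A.n + 2)
  start := ⟨2 * A.start, by omega⟩
  trans x a y := decide (A.BTr s₀ s₂ W E x a y)
  color x := A.bCol x

theorem deterministic_assumptionAutomaton (s₀ s₂ : ℕ → ℕ) (W E : ℕ → Prop) :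
    (A.assumptionAutomaton s₀ s₂ W E).Deterministic := by
  classical
  rintro x a y z hy hz
  have hy' : A.BTr s₀ s₂ W E x a y := of_decide_eq_true hy
  have hz' : A.BTr s₀ s₂ W E x a z := of_decide_eq_true hz
  refine Fin.ext ?_
  rcases a with i | o
  · obtain ⟨-, h1, ⟨h2, h3, -⟩ | ⟨h2, h3⟩⟩ := hy' <;>
      obtain ⟨-, h4, ⟨h5, h6, -⟩ | ⟨h5, h6⟩⟩ := hz' <;> omega
  · obtain ⟨-, h1, ⟨h2, h2', h3⟩ | ⟨h2, h3⟩⟩ := hy' <;>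
      obtain ⟨-, h4, ⟨h5, h5', h6⟩ | ⟨h5, h6⟩⟩ := hz'
    · omega
    · exact absurd h2' (h5 h2)
    · exact absurd h5' (h2 h5)
    · omega

section

variable {A} {s₀ s₁ s₂ : ℕ → ℕ} {W E : ℕ → Prop}

/-- As long as the word conforms to the strategy, the state of the automaton is the current vertex
of the game; after a deviation it is in the accepting component. -/
theorem Solution.recognises (hI : 0 < kI) (hO : 0 < kO) (hS : A.Solution s₀ s₁ s₂ W E)
    {L : Set (ℕ → Fin kI × Fin kO)}
    (hL : ∀ w, w ∈ L ↔ ParityAccepts fun i => A.col (A.run (flat w) i)) :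
    (A.assumptionAutomaton s₀ s₂ W E).Recognises (assumptionOf (A.ctrl hO s₀ s₂ W) L) := by
  classical
  set σ := A.ctrl hO s₀ s₂ W with hσ
  have hmod : ∀ w i, A.vertexAt w i % 2 = i % 2 := fun w i => by rw [vertexAt]; omega
  have hdiv : ∀ w i, A.vertexAt w i / 2 = A.run (flat w) i := fun w i => by rw [vertexAt]; omega
  -- The output tested by the automaton is the one prescribed by the strategy.
  have hout : ∀ (w : ℕ → Fin kI × Fin kO) k, (((w k).2 : Fin kO) : ℕ) =
      A.outputTo (A.vertexAt w (2 * k + 1) / 2) (target s₀ s₂ W (A.vertexAt w (2 * k + 1)) / 2) ↔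
        (w k).2 = σ (pre w k) (w k).1 := fun w k => by
    rw [Fin.ext_iff, hσ, hS.val_ctrl hO, hdiv, vertexAt, run_flat_odd,
      show (2 * k + 1) % 2 = 1 by omega]
  have hcsucc : ∀ (w : ℕ → Fin kI × Fin kO) k, Conforms σ w k →
      (w k).2 = σ (pre w k) (w k).1 → Conforms σ w (k + 1) := fun w k hk h j hj => by
    rcases Nat.lt_succ_iff_lt_or_eq.1 hj with hj | rfl
    exacts [hk j hj, h]
  ext v
  constructor
  · rintro ⟨ρ, h0, hρ, hacc⟩
    have hρ' : ∀ i, A.BTr s₀ s₂ W E (ρ i) (v i) (ρ (i + 1)) := fun i => of_decide_eq_true (hρ i)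
    have hpar : ∀ i, (ρ i : ℕ) % 2 = i % 2 := by
      intro i
      induction i with
      | zero => rw [h0]; simp [assumptionAutomaton]
      | succ i ih =>
        have := hρ' i
        rcases hv : v i with a | a <;> rw [hv] at this <;> obtain ⟨h1, h2, -⟩ := this <;> omega
    have hl : ∀ k, ∃ i, v (2 * k) = Sum.inl i := fun k => by
      rcases hv : v (2 * k) with a | a
      · exact ⟨a, rfl⟩
      · have := hρ' (2 * k)
        rw [hv] at this
        have := this.1
        have := hpar (2 * k)
        omega
    have hr : ∀ k, ∃ o, v (2 * k + 1) = Sum.inr o := fun k => by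
      rcases hv : v (2 * k + 1) with a | a
      · have := hρ' (2 * k + 1)
        rw [hv] at this
        have := this.1
        have := hpar (2 * k + 1)
        omega
      · exact ⟨a, rfl⟩
    choose inp hinp using hl
    choose out hout' using hr
    obtain ⟨w, hw⟩ : ∃ w : ℕ → Fin kI × Fin kO, flat w = v := by
      refine ⟨fun k => (inp k, out k), funext fun j => ?_⟩
      obtain ⟨k, rfl | rfl⟩ : ∃ k, j = 2 * k ∨ j = 2 * k + 1 := ⟨j / 2, by omega⟩
      · rw [flat_even, hinp]
      · rw [flat_odd, hout']
    subst hw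
    refine ⟨w, ?_, rfl⟩
    have hin : ∀ k, (ρ (2 * k) : ℕ) = A.vertexAt w (2 * k) →
        (ρ (2 * k + 1) : ℕ) = A.vertexAt w (2 * k + 1) ∧ E (A.vertexAt w (2 * k + 1)) := by
      intro k hk
      have h1 := hρ' (2 * k)
      rw [hk, flat_even] at h1
      obtain ⟨-, h2, h3⟩ := h1
      have h4 := A.run_le (flat w) (2 * k)
      rw [hdiv] at h3
      obtain ⟨-, h5, h6⟩ := h3.resolve_right fun h => by omega
      rw [← flat_even, ← run] at h5
      have h7 : (ρ (2 * k + 1) : ℕ) = A.vertexAt w (2 * k + 1) := by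
        rw [vertexAt, h5]; omega
      exact ⟨h7, h7 ▸ h6⟩
    have htrack : ∀ k, Conforms σ w k → (ρ (2 * k) : ℕ) = A.vertexAt w (2 * k) := by
      intro k
      induction k with
      | zero => exact fun _ => by rw [mul_zero, h0, vertexAt, run]; simp [assumptionAutomaton]
      | succ k ih =>
        intro hk
        obtain ⟨h1, -⟩ := hin k (ih (hk.mono (Nat.le_succ k)))
        have h2 := hρ' (2 * k + 1)
        have h3 := A.run_le (flat w) (2 * k + 1)
        have h4 := (hout w k).2 (hk k (Nat.lt_succ_self k))
        rw [h1, flat_odd] at h2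
        obtain ⟨-, h5, ⟨-, -, h6⟩ | ⟨h6, -⟩⟩ := h2
        · rw [hdiv, ← flat_odd, ← run] at h6
          rw [show 2 * (k + 1) = 2 * k + 1 + 1 by omega, vertexAt, h6]
          omega
        · exact absurd h4 (h6 (by rw [hdiv]; exact h3))
    refine ⟨fun k hk => hS.ctrl_cooperates hI hO hL (hin k (htrack k hk)).2 hk, fun hwσ => ?_⟩
    have hall : ∀ i, (ρ i : ℕ) = A.vertexAt w i := fun i => by
      obtain ⟨k, rfl | rfl⟩ : ∃ k, i = 2 * k ∨ i = 2 * k + 1 := ⟨i / 2, by omega⟩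
      · exact htrack k fun j _ => hwσ j
      · exact (hin k (htrack k fun j _ => hwσ j)).1
    rw [hL]
    have hcol : ∀ i, (A.assumptionAutomaton s₀ s₂ W E).color (ρ i) = A.col (A.run (flat w) i) :=
      fun i => by
        change A.bCol (ρ i) = _
        rw [hall, bCol, hdiv, if_pos (A.run_le _ _)]
    simpa only [hcol] using hacc
  · rintro ⟨w, hw, rfl⟩
    set ρ : ℕ → ℕ := fun i => if Conforms σ w (i / 2) then A.vertexAt w i else
      2 * (A.n + 1) + i % 2 with hρ
    have hlt : ∀ i, ρ i < 2 * (A.n + 2) := fun i => by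
      have := A.vertexAt_lt w i
      simp only [hρ]
      split_ifs <;> omega
    refine ⟨fun i => ⟨ρ i, hlt i⟩, ?_, fun i => decide_eq_true ?_, ?_⟩
    · have h0 : Conforms σ w (0 / 2) := fun j hj => absurd hj (by omega)
      simp only [hρ, if_pos h0]
      exact Fin.ext (by simp [vertexAt, run, assumptionAutomaton])
    · change A.BTr s₀ s₂ W E (ρ i) (flat w i) (ρ (i + 1))
      obtain ⟨k, rfl | rfl⟩ : ∃ k, i = 2 * k ∨ i = 2 * k + 1 := ⟨i / 2, by omega⟩
      · simp only [hρ, show 2 * k / 2 = k by omega, show (2 * k + 1) / 2 = k by omega, flat_even]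
        split_ifs with hc
        · obtain ⟨u, huL, -, huw, huk⟩ := hw.1 k hc
          refine ⟨by rw [hmod]; omega, by rw [hmod]; omega, Or.inl ⟨?_, ?_, ?_⟩⟩
          · rw [hdiv]; exact A.run_le _ _
          · rw [hdiv, hdiv, run, flat_even]
          · rw [← vertexAt_congr huw huk]
            exact hS.exists_accepting hL huL
        · exact ⟨by omega, by omega, Or.inr ⟨by omega, by omega⟩⟩
      · simp only [hρ, show (2 * k + 1) / 2 = k by omega, show (2 * k + 1 + 1) / 2 = k + 1 by omega,
          flat_odd]
        by_cases hc : Conforms σ w k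
        · rw [if_pos hc]
          refine ⟨by rw [hmod]; omega, ?_, ?_⟩
          · split_ifs
            · rw [hmod]; omega
            · omega
          by_cases hk : (w k).2 = σ (pre w k) (w k).1
          · rw [if_pos (hcsucc w k hc hk)]
            refine Or.inl ⟨?_, (hout w k).2 hk, ?_⟩
            · rw [hdiv]; exact A.run_le _ _
            · rw [hdiv, hdiv, ← flat_odd]
              rfl
          · rw [if_neg fun h => hk (h k (Nat.lt_succ_self k))]
            exact Or.inr ⟨fun _ h => hk ((hout w k).1 h), by omega⟩
        · rw [if_neg hc, if_neg fun h => hc (h.mono (Nat.le_succ k))]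
          exact ⟨by omega, by omega, Or.inr ⟨fun h => absurd h (by omega), by omega⟩⟩
    · change ParityAccepts fun i => A.bCol (ρ i)
      by_cases hwσ : w ∈ Out σ
      · have hcol : ∀ i, A.bCol (ρ i) = A.col (A.run (flat w) i) := fun i => by
          simp only [hρ]
          rw [if_pos (show Conforms σ w (i / 2) from fun j _ => hwσ j), bCol, hdiv,
            if_pos (A.run_le _ _)]
        simp only [hcol]
        exact (hL w).1 (hw.2 hwσ)
      · obtain ⟨k, hk⟩ := not_forall.1 hwσ
        refine (parityAccepts_congr_add (c' := fun _ => 0) (2 * (k + 1)) fun i => ?_).2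
          ((parityAccepts_const 0).2 (by decide))
        simp only [hρ]
        rw [if_neg fun h => hk (h k (by omega)), bCol, if_neg (by omega)]

/-- The assumption automaton recognises an ensurable-optimal assumption. -/
theorem Solution.isEnsurableOptimal (hI : 0 < kI) (hO : 0 < kO) (hS : A.Solution s₀ s₁ s₂ W E)
    {L : Set (ℕ → Fin kI × Fin kO)} (hA : A.Deterministic) (hAL : A.Recognises L) :
    ∃ H, (A.assumptionAutomaton s₀ s₂ W E).Recognises H ∧ IsEnsurableOptimal L H := by
  have hL : ∀ w, w ∈ L ↔ ParityAccepts fun i => A.col (A.run (flat w) i) := fun w => by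
    rw [← hA.mem_language_iff, hAL, flat_injective.mem_set_image]
  have hrec := hS.recognises hI hO hL
  refine ⟨_, hrec, ⟨_, hrec⟩, isEnsurable_assumptionOf _ _, sufficient_assumptionOf _ _, ?_⟩
  rintro ⟨B, -, hB, hBL, hsub⟩
  refine hsub.2 (eq_assumptionOf_of_subset (fun b k o σ' _ h => ?_) (fun w hw k hc => ?_) hB hBL
    hsub.1)
  · exact hS.ctrl_wins hI hO hL b k o σ' h
  · exact hS.ctrl_cooperates hI hO hL (hS.exists_accepting hL hw) hc

end

end ParityAutomaton

namespace ParityAutomaton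

/-! ### A parity game whose winning strategies solve the game of the automaton -/

variable {kI kO : ℕ} (A : ParityAutomaton kI kO)

/-- The number of vertices of the game of the automaton. -/
def width : ℕ := 2 * (A.n + 1)

/-- The edges of the big game, on numbers. Vertex `c * A.width + x` is vertex `x` in copy `c`. In
copy `4` there is a choice between copies `0` and `1`, in copy `5` one between `2` and `3`. -/
def BigEdge (v u : ℕ) : Prop :=
  (v / A.width < 4 ∧ u / A.width = v / A.width ∧ A.GEdge (v % A.width) (u % A.width)) ∨
    (4 ≤ v / A.width ∧ u % A.width = v % A.width ∧
      (u / A.width = 2 * (v / A.width - 4) ∨ u / A.width = 2 * (v / A.width - 4) + 1))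

/-- The vertices of the controller in the big game: in copy `0` those before an output, in
copy `1` those before an input, in copy `2` all, in copy `3` none, and all in the copies with a
choice. -/
def BigOwner (v : ℕ) : Prop :=
  (v / A.width = 0 ∧ (v % A.width) % 2 = 1) ∨ (v / A.width = 1 ∧ (v % A.width) % 2 = 0) ∨
    v / A.width = 2 ∨ 4 ≤ v / A.width

/-- The colours of the big game: copies `1` and `3` have the dual winning condition. -/
def bigCol (v : ℕ) : ℕ :=
  if 4 ≤ v / A.width then 0 else A.col ((v % A.width) / 2) + (v / A.width) % 2

theorem width_pos : 0 < A.width := by rw [width]; omega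

theorem div_width {c x : ℕ} (hx : x < A.width) : (c * A.width + x) / A.width = c := by
  rw [mul_comm, Nat.mul_add_div A.width_pos, Nat.div_eq_of_lt hx, add_zero]

theorem mod_width {c x : ℕ} (hx : x < A.width) : (c * A.width + x) % A.width = x := by
  rw [mul_comm, Nat.mul_add_mod, Nat.mod_eq_of_lt hx]

theorem vertex_lt {c x : ℕ} (hc : c < 6) (hx : x < A.width) : c * A.width + x < 6 * A.width := by
  nlinarith

theorem exists_gEdge (hI : 0 < kI) (hO : 0 < kO) (x : ℕ) : ∃ y, A.GEdge x y := by
  rcases Nat.mod_two_eq_zero_or_one x with h | h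
  · refine ⟨2 * A.step (x / 2) (Sum.inl ⟨0, hI⟩) + 1, Or.inl ⟨h, by omega, ⟨0, hI⟩, by omega⟩⟩
  · refine ⟨2 * A.step (x / 2) (Sum.inr ⟨0, hO⟩), Or.inr ⟨h, by omega, ⟨0, hO⟩, by omega⟩⟩

open Classical in
/-- The disjoint union of the game of the automaton (copy `0`), its dual (copy `1`), the game in
which the controller makes all moves (copy `2`), its dual (copy `3`), and for each vertex the
choices between the first two and between the last two. By determinacy each of these choices can be
won, so the choices made by a winning strategy reveal the winning regions. -/
noncomputable def bigGame (hI : 0 < kI) (hO : 0 < kO) : ParityGame where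
  n := 6 * A.width
  owner v := decide (A.BigOwner v)
  edge v u := decide (A.BigEdge v u)
  color v := A.bigCol v
  total := by
    rintro ⟨v, hv⟩
    have hv' : v / A.width < 6 := by
      rw [Nat.div_lt_iff_lt_mul A.width_pos]; exact hv
    rcases Nat.lt_or_ge (v / A.width) 4 with h | h
    · obtain ⟨y, hy⟩ := A.exists_gEdge hI hO (v % A.width)
      refine ⟨⟨v / A.width * A.width + y, A.vertex_lt (by omega) hy.lt⟩, ?_⟩
      rw [decide_eq_true_eq, BigEdge]
      refine Or.inl ⟨h, ?_⟩
      rw [A.div_width hy.lt, A.mod_width hy.lt]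
      exact ⟨rfl, hy⟩
    · have hm := Nat.mod_lt v A.width_pos
      refine ⟨⟨2 * (v / A.width - 4) * A.width + v % A.width,
        A.vertex_lt (by omega) hm⟩, ?_⟩
      rw [decide_eq_true_eq, BigEdge]
      refine Or.inr ⟨h, ?_⟩
      rw [A.div_width hm, A.mod_width hm]
      exact ⟨rfl, Or.inl rfl⟩

variable {A} {hI : 0 < kI} {hO : 0 < kO}

theorem bigGame_edge {v u : Fin (A.bigGame hI hO).n} :
    (A.bigGame hI hO).edge v u = true ↔ A.BigEdge v u := by
  classical
  exact decide_eq_true_iff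

theorem bigGame_owner {v : Fin (A.bigGame hI hO).n} :
    (A.bigGame hI hO).owner v = true ↔ A.BigOwner v := by
  classical
  exact decide_eq_true_iff

theorem bigEdge_copy {c x y : ℕ} (hc : c < 4) (hx : x < A.width) (h : A.GEdge x y) :
    A.BigEdge (c * A.width + x) (c * A.width + y) := by
  rw [BigEdge, A.div_width hx, A.mod_width hx, A.div_width h.lt, A.mod_width h.lt]
  exact Or.inl ⟨hc, rfl, h⟩

/-- A path in a copy of the game of the automaton, as a path of the big game. -/
theorem exists_lift {ρ : ℕ → ℕ} {c : ℕ} (hc : c < 4) (h0 : ρ 0 < A.width)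
    (hρ : ∀ i, A.GEdge (ρ i) (ρ (i + 1))) :
    ∃ π : ℕ → Fin (A.bigGame hI hO).n, (∀ i, (π i : ℕ) = c * A.width + ρ i) ∧
      (∀ i, ρ i < A.width) ∧ ∀ i, (A.bigGame hI hO).edge (π i) (π (i + 1)) = true := by
  have hlt : ∀ i, ρ i < A.width := fun i => by
    cases i with
    | zero => exact h0
    | succ i => exact (hρ i).lt
  exact ⟨fun i => ⟨c * A.width + ρ i, A.vertex_lt (by omega) (hlt i)⟩, fun i => rfl, hlt,
    fun i => bigGame_edge.2 (bigEdge_copy hc (hlt i) (hρ i))⟩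

/-- A path of the big game that starts in one of the first four copies stays there. -/
theorem path_in_copy {π : ℕ → Fin (A.bigGame hI hO).n} {c : ℕ} (hc : c < 4)
    (h0 : (π 0 : ℕ) / A.width = c)
    (hπ : ∀ i, (A.bigGame hI hO).edge (π i) (π (i + 1)) = true) (i : ℕ) :
    (π i : ℕ) / A.width = c ∧ A.GEdge (π i % A.width) (π (i + 1) % A.width) := by
  have key : ∀ i, (π i : ℕ) / A.width = c →
      (π (i + 1) : ℕ) / A.width = c ∧ A.GEdge (π i % A.width) (π (i + 1) % A.width) := by
    intro i hi
    rcases bigGame_edge.1 (hπ i) with ⟨-, h1, h2⟩ | ⟨h1, -⟩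
    · exact ⟨h1.trans hi, h2⟩
    · omega
  have : ∀ i, (π i : ℕ) / A.width = c := by
    intro i
    induction i with
    | zero => exact h0
    | succ i ih => exact (key i ih).1
  exact ⟨this i, (key i (this i)).2⟩

theorem parityAccepts_bigCol_dual {ρ : ℕ → ℕ} :
    ParityAccepts (fun i => A.col (ρ i / 2) + 1) ↔ ¬ ParityAccepts fun i => A.col (ρ i / 2) := by
  obtain ⟨N, hN⟩ := A.exists_col_le
  exact parityAccepts_succ fun i => hN _

/-- Copies `0` and `1`, and likewise copies `2` and `3`, are dual to each other. -/
theorem bigOwner_dual {c x : ℕ} (hc : c = 0 ∨ c = 2) (hx : x < A.width) :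
    A.BigOwner ((c + 1) * A.width + x) ↔ ¬ A.BigOwner (c * A.width + x) := by
  simp only [BigOwner, A.div_width hx, A.mod_width hx]
  omega

/-- By determinacy the controller wins from a vertex or from its dual. -/
theorem mem_winRegion_or_dual {c x : ℕ} (hc : c = 0 ∨ c = 2) (hx : x < A.width)
    {v v' : Fin (A.bigGame hI hO).n} (hv : (v : ℕ) = c * A.width + x)
    (hv' : (v' : ℕ) = (c + 1) * A.width + x) :
    v ∈ (A.bigGame hI hO).WinRegion ∨ v' ∈ (A.bigGame hI hO).WinRegion := by
  classical
  refine ((A.bigGame hI hO).mem_winRegion_or v).imp_right ?_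
  rintro ⟨r, hr, hlose⟩
  have hmod : ∀ u : ℕ, u % A.width < A.width := fun u => Nat.mod_lt _ A.width_pos
  -- The environment's strategy in copy `c` is the controller's strategy in copy `c + 1`.
  let d : Fin (A.bigGame hI hO).n → Fin (A.bigGame hI hO).n := fun u =>
    ⟨c * A.width + u % A.width, A.vertex_lt (by omega) (hmod u)⟩
  let s : Fin (A.bigGame hI hO).n → Fin (A.bigGame hI hO).n := fun u =>
    if (u : ℕ) / A.width = c + 1 then
      ⟨(c + 1) * A.width + r (d u) % A.width, A.vertex_lt (by omega) (hmod _)⟩ else r u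
  have hrd : ∀ u : Fin (A.bigGame hI hO).n,
      A.GEdge (u % A.width) (r (d u) % A.width) ∧ (r (d u) : ℕ) / A.width = c := by
    intro u
    rcases bigGame_edge.1 (hr (d u)) with ⟨-, h1, h2⟩ | ⟨h1, -⟩
    · simp only [d, A.div_width (hmod u), A.mod_width (hmod u)] at h1 h2 ⊢
      exact ⟨h2, h1⟩
    · simp only [d, A.div_width (hmod u)] at h1
      omega
  refine ⟨fun _ => s, fun _ u _ => ?_, fun π h0 hπ hcons => ?_⟩
  · simp only [s]
    split_ifs with h
    · have h1 := bigEdge_copy (c := c + 1) (by omega) (hmod u) (hrd u).1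
      have h2 := Nat.div_add_mod (u : ℕ) A.width
      rw [h, mul_comm] at h2
      rw [h2] at h1
      exact bigGame_edge.2 h1
    · exact hr u
  · have hcopy := path_in_copy (c := c + 1) (by omega)
      (by rw [h0, hv', A.div_width hx]) hπ
    have hval : ∀ i, (π i : ℕ) = (c + 1) * A.width + π i % A.width := fun i => by
      rw [← (hcopy i).1, mul_comm, Nat.div_add_mod]
    have h1 := hlose (fun i => d (π i)) (Fin.ext (by simp [d, h0, hv', hv, A.mod_width hx]))
      (fun i => bigGame_edge.2 (bigEdge_copy (by omega) (hmod _) (hcopy i).2)) fun i hi => by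
        have h2 : ¬ A.BigOwner (d (π i)) := fun h => by
          rw [bigGame_owner.2 h] at hi
          exact Bool.noConfusion hi
        have h3 : (A.bigGame hI hO).owner (π i) = true := by
          rw [bigGame_owner, hval i, bigOwner_dual hc (hmod _)]
          exact h2
        refine Fin.ext ?_
        simp only [hcons i h3, s, if_pos (hcopy i).1]
        have := Nat.div_add_mod (r (d (π i)) : ℕ) A.width
        rw [(hrd (π i)).2, mul_comm] at this
        refine Eq.trans ?_ this
        change c * A.width + ((c + 1) * A.width + r (d (π i)) % A.width) % A.width = _
        rw [A.mod_width (hmod _)]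
    have hcol : ∀ i, (A.bigGame hI hO).color (π i) = A.col (π i % A.width / 2) + 1 := fun i => by
      change A.bigCol _ = _
      rw [bigCol, (hcopy i).1, if_neg (by omega)]
      omega
    have hcol' : ∀ i, (A.bigGame hI hO).color (d (π i)) = A.col (π i % A.width / 2) := fun i => by
      change A.bigCol _ = _
      simp only [bigCol, d, A.div_width (hmod _), A.mod_width (hmod _)]
      rw [if_neg (by omega)]
      omega
    simp only [hcol'] at h1
    simp only [hcol]
    exact parityAccepts_bigCol_dual.2 h1

/-- A winning strategy wins from the vertices it chooses in the copies with a choice. -/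
theorem winsFrom_choice {s : Fin (A.bigGame hI hO).n → Fin (A.bigGame hI hO).n}
    (hs : (A.bigGame hI hO).IsMemorylessWinning s) {c x : ℕ} (hc : c = 0 ∨ c = 2)
    (hx : x < A.width) {y : Fin (A.bigGame hI hO).n}
    (hy : (y : ℕ) = (c / 2 + 4) * A.width + x) :
    (A.bigGame hI hO).WinsFrom (fun _ => s) (s y) ∧
      ((s y : ℕ) = c * A.width + x ∨ (s y : ℕ) = (c + 1) * A.width + x) := by
  classical
  have hyd : (y : ℕ) / A.width = c / 2 + 4 := by rw [hy, A.div_width hx]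
  have hym : (y : ℕ) % A.width = x := by rw [hy, A.mod_width hx]
  have hyo : (A.bigGame hI hO).owner y = true :=
    bigGame_owner.2 (Or.inr (Or.inr (Or.inr (by omega))))
  have hedge : ∀ z : Fin (A.bigGame hI hO).n,
      ((z : ℕ) = c * A.width + x ∨ (z : ℕ) = (c + 1) * A.width + x) ↔
        (A.bigGame hI hO).edge y z = true := by
    intro z
    rw [bigGame_edge, BigEdge, hyd, hym]
    constructor
    · rintro (h | h) <;> rw [h, A.div_width hx, A.mod_width hx] <;>
        exact Or.inr ⟨by omega, rfl, by omega⟩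
    · rintro (h | ⟨-, h1, h2⟩)
      · omega
      · have := Nat.div_add_mod (z : ℕ) A.width
        rw [h1, mul_comm] at this
        rcases h2 with h2 | h2
        · left; rw [← this, h2]; congr 2; omega
        · right; rw [← this, h2]; congr 2; omega
  -- Some vertex `z` that can be chosen is winning, hence `y` is.
  obtain ⟨z, hz, hzw⟩ :
      ∃ z, (A.bigGame hI hO).edge y z = true ∧ z ∈ (A.bigGame hI hO).WinRegion := by
    rcases mem_winRegion_or_dual (v := ⟨c * A.width + x, A.vertex_lt (by omega) hx⟩)
      (v' := ⟨(c + 1) * A.width + x, A.vertex_lt (by omega) hx⟩) hc hx rfl rfl with h | h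
    · exact ⟨_, (hedge _).1 (Or.inl rfl), h⟩
    · exact ⟨_, (hedge _).1 (Or.inr rfl), h⟩
  have hyw : y ∈ (A.bigGame hI hO).WinRegion := by
    refine ⟨fun _ => Function.update s y z, fun h v hv => ?_, fun π h0 hπ hcons => ?_⟩
    · by_cases hvy : v = y
      · subst hvy
        simpa using hz
      · simpa [hvy] using hs.1 h v hv
    · have h1 : π 1 = z := by
        have := hcons 0 (by rw [h0]; exact hyo)
        simpa [h0] using this
      have hcopy : ∃ c' < 4, (z : ℕ) / A.width = c' := by
        refine ⟨_, ?_, rfl⟩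
        rcases (hedge z).2 hz with h | h <;> rw [h, A.div_width hx] <;> omega
      obtain ⟨c', hc', hzc⟩ := hcopy
      have hstay := path_in_copy (π := fun i => π (i + 1)) hc' (by rwa [zero_add, h1])
        fun i => hπ (i + 1)
      have := hs.2 z hzw (fun i => π (i + 1)) h1 (fun i => hπ (i + 1)) fun i hi => by
        have h2 := hcons (i + 1) hi
        refine h2.trans (Function.update_of_ne ?_ _ _)
        intro heq
        have h3 := (hstay i).1
        simp only [heq, hyd] at h3
        omega
      rwa [parityAccepts_add fun i => (A.bigGame hI hO).color (π i)] at this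
  refine ⟨fun π h0 hπ hcons => ?_, (hedge _).2 (hs.1 [] y hyo)⟩
  let π' : ℕ → Fin (A.bigGame hI hO).n := fun i => if i = 0 then y else π (i - 1)
  have := hs.2 y hyw π' rfl (fun i => ?_) fun i hi => ?_
  · rw [← parityAccepts_add _ 1] at this
    simpa [π'] using this
  · cases i with
    | zero => simpa [π', h0] using hs.1 [] y hyo
    | succ i => simpa [π'] using hπ i
  · cases i with
    | zero => simp [π', h0]
    | succ i => simpa [π'] using hcons i (by simpa [π'] using hi)

/-- The table `g` of a winning strategy in the big game solves the game of the automaton. -/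
theorem solution_of_bigGame {s : Fin (A.bigGame hI hO).n → Fin (A.bigGame hI hO).n}
    (hs : (A.bigGame hI hO).IsMemorylessWinning s) {g : ℕ → ℕ}
    (hg : ∀ v : Fin (A.bigGame hI hO).n, g v = s v) :
    A.Solution (fun x => g x % A.width) (fun x => g (A.width + x) % A.width)
      (fun x => g (2 * A.width + x) % A.width) (fun x => g (4 * A.width + x) / A.width = 0)
      (fun x => g (5 * A.width + x) / A.width = 2) := by
  -- The strategy stays in the copies.
  have hmove : ∀ c x, c < 4 → x < A.width → A.BigOwner (c * A.width + x) →
      A.GEdge x (g (c * A.width + x) % A.width) ∧ c * A.width + g (c * A.width + x) % A.width =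
        g (c * A.width + x) := by
    intro c x hc hx ho
    have h1 := hs.1 [] ⟨c * A.width + x, A.vertex_lt (by omega) hx⟩ (bigGame_owner.2 ho)
    rw [bigGame_edge, ← hg, BigEdge, A.div_width hx, A.mod_width hx] at h1
    rcases h1 with ⟨-, h1, h2⟩ | ⟨h1, -⟩
    · have := Nat.div_add_mod (g (c * A.width + x)) A.width
      rw [h1, mul_comm] at this
      exact ⟨h2, this⟩
    · omega
  -- Paths in the copies from vertices won by the strategy.
  have hplay : ∀ c, c < 4 → ∀ ρ : ℕ → ℕ, ρ 0 < A.width →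
      (∀ v : Fin (A.bigGame hI hO).n, (v : ℕ) = c * A.width + ρ 0 →
        (A.bigGame hI hO).WinsFrom (fun _ => s) v) →
      (∀ i, A.GEdge (ρ i) (ρ (i + 1))) →
      (∀ i, A.BigOwner (c * A.width + ρ i) → ρ (i + 1) = g (c * A.width + ρ i) % A.width) →
      ParityAccepts fun i => A.col (ρ i / 2) + c % 2 := by
    intro c hc ρ h0 hw hρ hcons
    obtain ⟨π, hπ, hlt, hedge⟩ := exists_lift (hI := hI) (hO := hO) hc h0 hρ
    have := hw (π 0) (hπ 0) π rfl hedge fun i hi => by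
      have ho := bigGame_owner.1 hi
      rw [hπ] at ho
      refine Fin.ext ?_
      rw [hπ, hcons i ho, (hmove c _ hc (hlt i) ho).2, ← hg, hπ]
    have hcol : ∀ i, (A.bigGame hI hO).color (π i) = A.col (ρ i / 2) + c % 2 := fun i => by
      change A.bigCol _ = _
      rw [hπ, bigCol, A.div_width (hlt i), A.mod_width (hlt i), if_neg (by omega)]
    simpa only [hcol] using this
  have hchoice : ∀ c, c = 0 ∨ c = 2 → ∀ x, x < A.width → ∀ v : Fin (A.bigGame hI hO).n,
      (g ((c / 2 + 4) * A.width + x) / A.width = c → (v : ℕ) = c * A.width + x →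
        (A.bigGame hI hO).WinsFrom (fun _ => s) v) ∧
      (g ((c / 2 + 4) * A.width + x) / A.width ≠ c → (v : ℕ) = (c + 1) * A.width + x →
        (A.bigGame hI hO).WinsFrom (fun _ => s) v) := by
    intro c hc x hx v
    obtain ⟨h1, h2⟩ := winsFrom_choice hs hc hx
      (y := ⟨(c / 2 + 4) * A.width + x, A.vertex_lt (by omega) hx⟩) rfl
    rw [hg ⟨(c / 2 + 4) * A.width + x, A.vertex_lt (by omega) hx⟩]
    constructor
    · intro h3 h4
      rcases h2 with h2 | h2
      · rwa [Fin.ext (h4.trans h2.symm)]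
      · rw [h2, A.div_width hx] at h3; omega
    · intro h3 h4
      rcases h2 with h2 | h2
      · rw [h2, A.div_width hx] at h3; omega
      · rwa [Fin.ext (h4.trans h2.symm)]
  have ho : ∀ c x, x < A.width → (A.BigOwner (c * A.width + x) ↔
      (c = 0 ∧ x % 2 = 1) ∨ (c = 1 ∧ x % 2 = 0) ∨ c = 2 ∨ 4 ≤ c) := fun c x hx => by
    rw [BigOwner, A.div_width hx, A.mod_width hx]
  constructor
  · intro x hx hodd
    have := (hmove 0 x (by omega) hx ((ho 0 x hx).2 (Or.inl ⟨rfl, hodd⟩))).1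
    simpa using this
  · intro x hx heven
    have := (hmove 1 x (by omega) hx ((ho 1 x hx).2 (by omega))).1
    simpa using this
  · intro x hx
    exact (hmove 2 x (by omega) hx ((ho 2 x hx).2 (by omega))).1
  · intro ρ h0 hW hρ hcons
    have hlt : ∀ i, ρ i < A.width := fun i => by
      cases i with
      | zero => exact h0
      | succ i => exact (hρ i).lt
    have := hplay 0 (by omega) ρ h0 (fun v hv => (hchoice 0 (Or.inl rfl) _ h0 v).1 hW hv) hρ
      fun i hi => by
        rw [ho _ _ (hlt i)] at hi
        rw [hcons i (by omega), zero_mul, zero_add]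
    simpa using this
  · intro ρ h0 hW hρ hcons
    have hlt : ∀ i, ρ i < A.width := fun i => by
      cases i with
      | zero => exact h0
      | succ i => exact (hρ i).lt
    have := hplay 1 (by omega) ρ h0 (fun v hv => (hchoice 0 (Or.inl rfl) _ h0 v).2 hW hv) hρ
      fun i hi => by
        rw [ho _ _ (hlt i)] at hi
        rw [hcons i (by omega), one_mul]
    exact parityAccepts_bigCol_dual.1 this
  · intro ρ h0 hE hcons
    have hlt : ∀ i, ρ i < A.width := fun i => by
      induction i with
      | zero => exact h0
      | succ i ih =>
        rw [hcons]
        exact Nat.mod_lt _ A.width_pos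
    have := hplay 2 (by omega) ρ h0 (fun v hv => (hchoice 2 (Or.inr rfl) _ h0 v).1 hE hv)
      (fun i => by
        rw [hcons]
        exact (hmove 2 _ (by omega) (hlt i) ((ho 2 _ (hlt i)).2 (by omega))).1)
      fun i hi => hcons i
    simpa using this
  · intro ρ h0 hE hρ
    have hlt : ∀ i, ρ i < A.width := fun i => by
      cases i with
      | zero => exact h0
      | succ i => exact (hρ i).lt
    have := hplay 3 (by omega) ρ h0 (fun v hv => (hchoice 2 (Or.inr rfl) _ h0 v).2 hE hv) hρ
      fun i hi => by
        rw [ho _ _ (hlt i)] at hi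
        omega
    exact parityAccepts_bigCol_dual.1 this

end ParityAutomaton

/-! ### Entries of the encodings -/

theorem length_flatMap_const {β : Type} (xs : List β) (l : β → List ℕ) (m : ℕ)
    (h : ∀ x, (l x).length = m) : (xs.flatMap l).length = xs.length * m := by
  induction xs with
  | nil => simp
  | cons x xs ih => rw [List.flatMap_cons, List.length_append, h, ih, List.length_cons]; ring

theorem getD_flatMap {β : Type} (xs : List β) (l : β → List ℕ) (m : ℕ)
    (h : ∀ x, (l x).length = m) {i r : ℕ} (hi : i < xs.length) (hr : r < m) :
    (xs.flatMap l).getD (i * m + r) 0 = (l xs[i]).getD r 0 := by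
  induction xs generalizing i with
  | nil => simp at hi
  | cons x xs ih =>
    rw [List.flatMap_cons]
    cases i with
    | zero =>
      rw [zero_mul, zero_add, List.getD_append _ _ _ _ (by rwa [h])]
      rfl
    | succ i =>
      rw [List.getD_append_right _ _ _ _ (by rw [h]; nlinarith), h,
        show (i + 1) * m + r - m = i * m + r by rw [add_mul, one_mul]; omega,
        ih (by simpa using hi)]
      rfl

theorem getD_finRange_map {n : ℕ} (F : Fin n → ℕ) {t : ℕ} (ht : t < n) :
    ((List.finRange n).map F).getD t 0 = F ⟨t, ht⟩ := by
  rw [List.getD_eq_getElem _ _ (by simpa using ht)]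
  simp

theorem getD_ofFn {n : ℕ} (F : Fin n → ℕ) {t : ℕ} (ht : t < n) :
    (List.ofFn F).getD t 0 = F ⟨t, ht⟩ := by
  rw [List.getD_eq_getElem _ _ (by simpa using ht)]
  simp

theorem eq_map_range {l : List ℕ} {F : ℕ → ℕ} {k : ℕ} (hk : l.length = k)
    (h : ∀ i < k, l.getD i 0 = F i) : l = (List.range k).map F := by
  refine List.ext_getElem (by simpa using hk) fun i h1 h2 => ?_
  rw [← List.getD_eq_getElem l 0 h1, h i (by omega)]
  simp

namespace ParityAutomaton

variable {kI kO : ℕ} (A : ParityAutomaton kI kO)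

/-- The position of a letter in the list of all letters. -/
def code : Fin kI ⊕ Fin kO → ℕ
  | Sum.inl i => i
  | Sum.inr o => kI + o

theorem code_lt (a : Fin kI ⊕ Fin kO) : code a < kI + kO := by
  rcases a with i | o <;> simp only [code] <;> omega

theorem exists_code {a : ℕ} (h : a < kI + kO) : ∃ b : Fin kI ⊕ Fin kO, code b = a := by
  by_cases ha : a < kI
  · exact ⟨Sum.inl ⟨a, ha⟩, rfl⟩
  · exact ⟨Sum.inr ⟨a - kI, by omega⟩, by simp only [code]; omega⟩

theorem length_letters : (letters kI kO).length = kI + kO := by simp [letters]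

theorem getElem_letters (a : Fin kI ⊕ Fin kO) :
    (letters kI kO)[code a]'(by rw [length_letters]; exact code_lt a) = a := by
  rcases a with i | o
  · simp [letters, code]
  · simp [letters, code, List.getElem_append_right]

theorem length_encode : A.encode.length = 2 + A.n + A.n * ((kI + kO) * A.n) := by
  simp only [encode, List.length_cons, List.length_append, List.length_ofFn]
  rw [length_flatMap_const _ _ ((kI + kO) * A.n), List.length_finRange]
  · omega
  · intro s
    rw [length_flatMap_const _ _ A.n, length_letters]
    simp

theorem getD_encode_one : A.encode.getD 1 0 = A.start := rfl

theorem getD_encode_color {s : ℕ} (hs : s < A.n) :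
    A.encode.getD (s + 2) 0 = A.color ⟨s, hs⟩ := by
  rw [encode, List.getD_cons_succ, List.getD_cons_succ,
    List.getD_append _ _ _ _ (by simpa using hs), getD_ofFn]

theorem getD_encode_trans {s t : ℕ} (hs : s < A.n) (ht : t < A.n) (a : Fin kI ⊕ Fin kO) :
    A.encode.getD (2 + A.n + ((s * (kI + kO) + code a) * A.n + t)) 0 =
      (A.trans ⟨s, hs⟩ a ⟨t, ht⟩).toNat := by
  rw [encode, show 2 + A.n + ((s * (kI + kO) + code a) * A.n + t) =
    A.n + ((s * (kI + kO) + code a) * A.n + t) + 1 + 1 by omega, List.getD_cons_succ,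
    List.getD_cons_succ, List.getD_append_right _ _ _ _ (by simp), List.length_ofFn,
    Nat.add_sub_cancel_left]
  have hc := code_lt a
  rw [show (s * (kI + kO) + code a) * A.n + t = s * ((kI + kO) * A.n) + (code a * A.n + t) by ring,
    getD_flatMap _ _ ((kI + kO) * A.n) _ (by simpa using hs) (by nlinarith),
    getD_flatMap _ _ A.n (by simp) (by rwa [length_letters]) ht, getD_finRange_map _ ht,
    getElem_letters]
  · simp
  · intro s
    rw [length_flatMap_const _ _ A.n, length_letters]
    simp

end ParityAutomaton

namespace ParityGame

variable (G : ParityGame)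

theorem length_encode : G.encode.length = 1 + 2 * G.n + G.n * G.n := by
  simp only [encode, List.length_cons, List.length_append, List.length_ofFn]
  rw [length_flatMap_const _ _ G.n (by simp), List.length_finRange]
  omega

theorem getD_encode_zero : G.encode.getD 0 0 = G.n := rfl

theorem getD_encode_owner {v : ℕ} (hv : v < G.n) :
    G.encode.getD (1 + v) 0 = (G.owner ⟨v, hv⟩).toNat := by
  rw [encode, add_comm 1 v, List.getD_cons_succ, List.append_assoc,
    List.getD_append _ _ _ _ (by simpa using hv), getD_ofFn _ hv]

theorem getD_encode_color {v : ℕ} (hv : v < G.n) :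
    G.encode.getD (1 + G.n + v) 0 = G.color ⟨v, hv⟩ := by
  rw [encode, show 1 + G.n + v = G.n + v + 1 by omega, List.getD_cons_succ, List.append_assoc,
    List.getD_append_right _ _ _ _ (by simp), List.length_ofFn, Nat.add_sub_cancel_left,
    List.getD_append _ _ _ _ (by simpa using hv), getD_ofFn _ hv]

theorem getD_encode_edge {v u : ℕ} (hv : v < G.n) (hu : u < G.n) :
    G.encode.getD (1 + 2 * G.n + (v * G.n + u)) 0 = (G.edge ⟨v, hv⟩ ⟨u, hu⟩).toNat := by
  rw [encode, show 1 + 2 * G.n + (v * G.n + u) = G.n + G.n + (v * G.n + u) + 1 by omega,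
    List.getD_cons_succ, List.getD_append_right _ _ _ _ (by simp), List.length_append,
    List.length_ofFn, List.length_ofFn, Nat.add_sub_cancel_left,
    getD_flatMap _ _ G.n (by simp) (by simpa using hv) hu, getD_finRange_map _ hu]
  simp

end ParityGame

namespace ParityAutomaton

/-! ### Expressions for the big game and the assumption automaton -/

open Ensurable.Expr

variable {kI kO : ℕ} (A : ParityAutomaton kI kO)

/-- The cap `M` for loops exceeds all indices used in the computation for `A`, so that no loop is
cut short: the sizes of the alphabets and games, the rows of the transition table, and the lengths
of the codes of the big game and of the assumption automaton. -/
structure Fits (M : ℕ) : Prop where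
  small : 12 * (A.n + 1) + kI + kO + 10 < M
  row : (A.n + 1) * (kI + kO) + kI + kO < M
  game : 1 + 2 * (6 * A.width) + 6 * A.width * (6 * A.width) < M
  out : 2 + 2 * (A.n + 2) + 2 * (A.n + 2) * ((kI + kO) * (2 * (A.n + 2))) < M

theorem fits_of_le {M : ℕ} (h : (16 * (A.encode.length + (kI + kO))) ^ 3 ≤ M) : A.Fits M := by
  have hl : A.n + 2 ≤ A.encode.length := by rw [length_encode]; omega
  obtain ⟨q, hq⟩ : ∃ q, q = A.n + 1 + (kI + kO) := ⟨_, rfl⟩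
  have h1 : (16 * q) ^ 3 ≤ M := (Nat.pow_le_pow_left (by omega) 3).trans h
  have hq1 : 1 ≤ q := by omega
  have hn : A.n + 1 ≤ q := by omega
  have hk : kI + kO ≤ q := by omega
  have hqq : q ≤ q * q := Nat.le_mul_of_pos_left q hq1
  have hqqq : q * q ≤ q * q * q := Nat.le_mul_of_pos_right _ hq1
  have h2 : 4096 * (q * q * q) ≤ M := by
    refine le_trans (le_of_eq ?_) h1
    ring
  have hnn : (A.n + 1) * (A.n + 1) ≤ q * q := Nat.mul_le_mul hn hn
  have hnk : (A.n + 1) * (kI + kO) ≤ q * q := Nat.mul_le_mul hn hk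
  have hnnk : (A.n + 2) * (A.n + 2) * (kI + kO) ≤ 4 * (q * q * q) := by
    calc (A.n + 2) * (A.n + 2) * (kI + kO) ≤ (2 * q) * (2 * q) * q :=
          Nat.mul_le_mul (Nat.mul_le_mul (by omega) (by omega)) hk
      _ = _ := by ring
  constructor
  · omega
  · omega
  · rw [width, show 6 * (2 * (A.n + 1)) * (6 * (2 * (A.n + 1))) = 144 * ((A.n + 1) * (A.n + 1)) by
      ring]
    omega
  · rw [show 2 * (A.n + 2) * ((kI + kO) * (2 * (A.n + 2))) =
      4 * ((A.n + 2) * (A.n + 2) * (kI + kO)) by ring]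
    omega

/-- The number of states, read from the input. -/
def nE : Expr := load 0 (const 0)

/-- `A.step` at state `var 10` and letter `var 11`. Like all expressions below, it takes its
arguments in variables of its own, so that they do not clash when expressions are nested. -/
def stepE (kI kO : ℕ) : Expr := find 12 nE (and (lt (var 10) nE)
  (load 0 (((const 2).add nE).add
    ((mul ((mul (var 10) (const (kI + kO))).add (var 11)) nE).add (var 12)))))

/-- `A.step` at given arguments. -/
def stepCall (kI kO : ℕ) (s a : Expr) : Expr := let2 10 s 11 a (stepE kI kO)

/-- The edges of the game of the automaton between `var 13` and `var 14`. -/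
def gEdgeE (kI kO : ℕ) : Expr :=
  ite (mod (var 13) (const 2))
    (and (not (mod (var 14) (const 2))) (ex 15 (const kO)
      (eq (stepCall kI kO (div (var 13) (const 2)) ((const kI).add (var 15)))
        (div (var 14) (const 2)))))
    (and (mod (var 14) (const 2)) (ex 15 (const kI)
      (eq (stepCall kI kO (div (var 13) (const 2)) (var 15)) (div (var 14) (const 2)))))

/-- `A.col` at `var 16`. -/
def colE : Expr := ite (lt (var 16) nE) (load 0 ((var 16).add (const 2))) (const 1)

/-- `A.width`. -/
def widthE : Expr := (nE.add (const 1)).add (nE.add (const 1))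

/-- The number of vertices of the big game. -/
def bigE : Expr := mul (const 6) widthE

/-- The edges of the big game between `var 17` and `var 18`. -/
def bigEdgeE (kI kO : ℕ) : Expr :=
  let2 19 (div (var 17) widthE) 20 (mod (var 17) widthE)
    (let2 21 (div (var 18) widthE) 22 (mod (var 18) widthE)
      (ite (lt (var 19) (const 4))
        (and (eq (var 21) (var 19)) (let2 13 (var 20) 14 (var 22) (gEdgeE kI kO)))
        (and (eq (var 22) (var 20))
          (or (eq (var 21) (mul (const 2) ((var 19).sub (const 4))))
            (eq (var 21) ((mul (const 2) ((var 19).sub (const 4))).add (const 1)))))))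

/-- The owner of `var 17` in the big game. -/
def bigOwnerE : Expr :=
  let2 19 (div (var 17) widthE) 20 (mod (var 17) widthE)
    (ite (eq (var 19) (const 0)) (mod (var 20) (const 2))
      (ite (eq (var 19) (const 1)) (not (mod (var 20) (const 2)))
        (or (eq (var 19) (const 2)) (lt (const 3) (var 19)))))

/-- The colour of `var 17` in the big game. -/
def bigColE : Expr :=
  let2 19 (div (var 17) widthE) 20 (mod (var 17) widthE)
    (ite (lt (const 3) (var 19)) (const 0)
      ((let2 16 (div (var 20) (const 2)) 12 (const 0) colE).add (mod (var 19) (const 2))))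

/-- Entry `var 0` of the encoding of the big game. -/
def gameE (kI kO : ℕ) : Expr :=
  ite (lt (var 0) (const 1)) bigE
    (ite (lt (var 0) ((const 1).add bigE))
      (let2 17 ((var 0).sub (const 1)) 18 (const 0) (ite bigOwnerE (const 1) (const 0)))
      (ite (lt (var 0) ((const 1).add (bigE.add bigE)))
        (let2 17 ((var 0).sub ((const 1).add bigE)) 18 (const 0) bigColE)
        (let2 17 (div ((var 0).sub ((const 1).add (bigE.add bigE))) bigE)
          18 (mod ((var 0).sub ((const 1).add (bigE.add bigE))) bigE)
          (ite (bigEdgeE kI kO) (const 1) (const 0)))))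

section

variable {A} {α : ℕ → ℕ → ℕ} {M : ℕ} {ρ : ℕ → ℕ}
  (hα : ∀ i, α 0 i = A.encode.getD i 0) (hM : A.Fits M)

include hα

theorem eval_nE : nE.eval α M ρ = A.n := by
  rw [nE, eval_load, hα]; rfl

theorem eval_widthE : widthE.eval α M ρ = A.width := by
  simp only [widthE, eval_add, eval_nE hα, eval_const, width]; omega

include hM

theorem eval_bigE : bigE.eval α M ρ = 6 * A.width := by
  have := hM.small
  rw [bigE, eval_mul (by rw [eval_const]; omega), eval_const, eval_widthE hα]

theorem eval_stepCall {s a : Expr} {b : Fin kI ⊕ Fin kO}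
    (ha : a.eval α M ρ = code b) :
    (stepCall kI kO s a).eval α M ρ = A.step (s.eval α M ρ) b := by
  have hb := code_lt b
  have h1 := hM.small
  have h2 := hM.row
  rw [stepCall, eval_let2, stepE, eval_find _ (by rw [eval_nE hα]; omega), eval_nE hα, step]
  refine leastBelow_congr fun t ht => ?_
  rw [holds_and, holds_lt, eval_nE hα]
  simp only [eval_var, Function.update_apply]
  norm_num
  have key : ∀ hs' : s.eval α M ρ < A.n,
      (load 0 (((const 2).add nE).add ((mul ((mul (var 10) (const (kI + kO))).add (var 11)) nE).add
        (var 12)))).Holds α M (Function.update (Function.update (Function.update ρ 10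
          (s.eval α M ρ)) 11 (a.eval α M ρ)) 12 t) ↔ A.trans ⟨_, hs'⟩ b ⟨t, ht⟩ = true := by
    intro hs'
    have h3 : s.eval α M ρ * (kI + kO) ≤ (A.n + 1) * (kI + kO) :=
      Nat.mul_le_mul_right _ (by omega)
    have hm : ∀ ρ' : ℕ → ℕ, ρ' 10 = s.eval α M ρ →
        (mul (var 10) (const (kI + kO))).eval α M ρ' = s.eval α M ρ * (kI + kO) := fun ρ' h => by
      rw [eval_mul (by rw [eval_var, h]; omega), eval_var, h, eval_const]
    have hm' : ((mul (var 10) (const (kI + kO))).add (var 11)).eval α M (Function.update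
        (Function.update (Function.update ρ 10 (s.eval α M ρ)) 11 (a.eval α M ρ)) 12 t) =
          s.eval α M ρ * (kI + kO) + code b := by
      rw [eval_add, hm _ (by simp), eval_var]
      simp [ha]
    rw [Holds, eval_load, eval_add, eval_add, eval_add, eval_const, eval_nE hα,
      eval_mul (by rw [hm']; omega), hm', eval_nE hα, hα, eval_var, Function.update_self,
      A.getD_encode_trans hs' ht]
    cases A.trans ⟨_, hs'⟩ b ⟨t, ht⟩ <;> simp
  constructor
  · rintro ⟨h3, h4⟩
    exact ⟨h3, ht, (key h3).1 h4⟩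
  · rintro ⟨h3, h4⟩
    exact ⟨h3, (key h3).2 h4.2⟩

theorem holds_gEdgeE (hx : ρ 13 < A.width) (hy : ρ 14 < M) :
    (gEdgeE kI kO).Holds α M ρ ↔ A.GEdge (ρ 13) (ρ 14) := by
  have h1 := hM.small
  rw [width] at hx
  have hx' : (var 13).eval α M ρ < M := by rw [eval_var]; omega
  rw [gEdgeE, holds_ite, holds_and, holds_and, holds_not, holds_mod_two hx',
    holds_mod_two (e := var 14) (by rwa [eval_var]), holds_ex _ (by rw [eval_const]; omega),
    holds_ex _ (by rw [eval_const]; omega), eval_var, eval_var, eval_const, eval_const, GEdge]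
  have hO : (∃ j < kO, (eq (stepCall kI kO (div (var 13) (const 2)) ((const kI).add (var 15)))
      (div (var 14) (const 2))).Holds α M (Function.update ρ 15 j)) ↔
        ∃ o : Fin kO, A.step (ρ 13 / 2) (Sum.inr o) = ρ 14 / 2 := by
    have key : ∀ o : Fin kO, (eq (stepCall kI kO (div (var 13) (const 2)) ((const kI).add (var 15)))
        (div (var 14) (const 2))).Holds α M (Function.update ρ 15 o) ↔
          A.step (ρ 13 / 2) (Sum.inr o) = ρ 14 / 2 := by
      intro o
      have e13 : (div (var 13) (const 2)).eval α M (Function.update ρ 15 o) = ρ 13 / 2 := by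
        rw [eval_div_two] <;> simp [eval_var]
        omega
      have e14 : (div (var 14) (const 2)).eval α M (Function.update ρ 15 o) = ρ 14 / 2 := by
        rw [eval_div_two] <;> simp [eval_var]
        omega
      rw [holds_eq, eval_stepCall hα hM (b := Sum.inr o)
        (by simp [eval_add, eval_const, eval_var, code]), e13, e14]
    constructor
    · rintro ⟨j, hj, h⟩
      exact ⟨⟨j, hj⟩, (key ⟨j, hj⟩).1 h⟩
    · rintro ⟨o, h⟩
      exact ⟨o, o.2, (key o).2 h⟩
  have hI : (∃ j < kI, (eq (stepCall kI kO (div (var 13) (const 2)) (var 15))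
      (div (var 14) (const 2))).Holds α M (Function.update ρ 15 j)) ↔
        ∃ i : Fin kI, A.step (ρ 13 / 2) (Sum.inl i) = ρ 14 / 2 := by
    have key : ∀ i : Fin kI, (eq (stepCall kI kO (div (var 13) (const 2)) (var 15))
        (div (var 14) (const 2))).Holds α M (Function.update ρ 15 i) ↔
          A.step (ρ 13 / 2) (Sum.inl i) = ρ 14 / 2 := by
      intro i
      have e13 : (div (var 13) (const 2)).eval α M (Function.update ρ 15 i) = ρ 13 / 2 := by
        rw [eval_div_two] <;> simp [eval_var]
        omega
      have e14 : (div (var 14) (const 2)).eval α M (Function.update ρ 15 i) = ρ 14 / 2 := by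
        rw [eval_div_two] <;> simp [eval_var]
        omega
      rw [holds_eq, eval_stepCall hα hM (b := Sum.inl i)
        (by simp [eval_var, code]), e13, e14]
    constructor
    · rintro ⟨j, hj, h⟩
      exact ⟨⟨j, hj⟩, (key ⟨j, hj⟩).1 h⟩
    · rintro ⟨o, h⟩
      exact ⟨o, o.2, (key o).2 h⟩
  rw [hO, hI]
  have m1 := Nat.mod_two_eq_zero_or_one (ρ 13)
  have m2 := Nat.mod_two_eq_zero_or_one (ρ 14)
  rcases m1 with m1 | m1 <;> rcases m2 with m2 | m2 <;> simp [m1, m2]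

omit hM in
theorem eval_colE : colE.eval α M ρ = A.col (ρ 16) := by
  rw [colE, eval_ite, holds_lt, eval_nE hα, eval_var, eval_load, eval_add, eval_var, eval_const,
    eval_const, hα, col]
  split_ifs with h
  · exact A.getD_encode_color h
  · rfl

omit hM in
theorem eval_div_width {e : Expr} (h : e.eval α M ρ < M) :
    (div e widthE).eval α M ρ = e.eval α M ρ / A.width := by
  rw [eval_div h (by rw [eval_widthE hα]; exact A.width_pos), eval_widthE hα]

omit hM in
theorem eval_mod_width {e : Expr} (h : e.eval α M ρ < M) :
    (mod e widthE).eval α M ρ = e.eval α M ρ % A.width := by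
  rw [eval_mod h (by rw [eval_widthE hα]; exact A.width_pos), eval_widthE hα]

theorem holds_bigEdgeE (hv : ρ 17 < 6 * A.width) (hu : ρ 18 < 6 * A.width) :
    (bigEdgeE kI kO).Holds α M ρ ↔ A.BigEdge (ρ 17) (ρ 18) := by
  have h1 := hM.small
  have hw : 6 * A.width < M := by rw [width]; omega
  have hmv := Nat.mod_lt (ρ 17) A.width_pos
  have hmu := Nat.mod_lt (ρ 18) A.width_pos
  rw [bigEdgeE, holds_let2, eval_div_width hα (by rw [eval_var]; omega),
    eval_mod_width hα (by rw [eval_var]; omega), holds_let2,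
    eval_div_width hα (by simp [eval_var]; omega),
    eval_mod_width hα (by simp [eval_var]; omega)]
  rw [holds_ite, holds_lt, holds_and, holds_and, holds_or, holds_eq, holds_eq, holds_eq, holds_eq,
    holds_let2, holds_gEdgeE hα hM (by simp [eval_var, hmv])
      (by simp [eval_var]; omega), eval_add,
    eval_mul (by rw [eval_const]; omega), eval_sub, eval_const, eval_const, eval_const]
  simp only [eval_var, Function.update_apply]
  norm_num
  rfl

theorem holds_bigOwnerE (hv : ρ 17 < 6 * A.width) :
    bigOwnerE.Holds α M ρ ↔ A.BigOwner (ρ 17) := by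
  have h1 := hM.small
  have hw : 6 * A.width < M := by rw [width]; omega
  have hmv := Nat.mod_lt (ρ 17) A.width_pos
  rw [bigOwnerE, holds_let2, eval_div_width hα (by rw [eval_var]; omega),
    eval_mod_width hα (by rw [eval_var]; omega), holds_ite, holds_ite, holds_eq, holds_eq,
    holds_not, holds_or, holds_eq, holds_lt,
    holds_mod_two (by simp [eval_var]; omega)]
  simp only [eval_var, eval_const, Function.update_apply]
  rw [BigOwner]
  generalize ρ 17 / A.width = c
  norm_num
  omega

theorem eval_bigColE (hv : ρ 17 < 6 * A.width) : bigColE.eval α M ρ = A.bigCol (ρ 17) := by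
  have h1 := hM.small
  have hw : 6 * A.width < M := by rw [width]; omega
  have hmv := Nat.mod_lt (ρ 17) A.width_pos
  have hdv := Nat.div_le_self (ρ 17) A.width
  rw [bigColE, eval_let2, eval_div_width hα (by rw [eval_var]; omega),
    eval_mod_width hα (by rw [eval_var]; omega), eval_ite, holds_lt, eval_add, eval_let2,
    eval_colE hα, eval_div_two (by simp [eval_var]; omega),
    eval_mod (by simp [eval_var]; omega) (by rw [eval_const]; omega)]
  simp only [eval_var, eval_const, Function.update_apply]
  norm_num
  rfl

theorem eval_gameE (hI : 0 < kI) (hO : 0 < kO)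
    (hk : ρ 0 < 1 + 2 * (6 * A.width) + 6 * A.width * (6 * A.width)) :
    (gameE kI kO).eval α M ρ = (A.bigGame hI hO).encode.getD (ρ 0) 0 := by
  classical
  have h1 := hM.game
  have hN : 0 < 6 * A.width := by have := A.width_pos; omega
  have hn : (A.bigGame hI hO).n = 6 * A.width := rfl
  have hsub : ((var 0).sub ((const 1).add (bigE.add bigE))).eval α M ρ =
      ρ 0 - (1 + 2 * (6 * A.width)) := by
    simp only [eval_sub, eval_add, eval_const, eval_var, eval_bigE hα hM]
    omega
  rw [gameE, eval_ite, eval_ite, eval_ite, holds_lt, holds_lt, holds_lt]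
  simp only [eval_add, eval_const, eval_var, eval_bigE hα hM]
  split_ifs with c1 c2 c3
  · rw [show ρ 0 = 0 by omega]; rfl
  · rw [eval_let2, eval_ite, holds_bigOwnerE hα hM (by
      simp [eval_sub, eval_var, eval_const]; omega)]
    obtain ⟨v, hv⟩ : ∃ v, ρ 0 = 1 + v := ⟨ρ 0 - 1, by omega⟩
    have hvlt : v < (A.bigGame hI hO).n := by omega
    rw [hv, ParityGame.getD_encode_owner _ hvlt]
    have := bigGame_owner (A := A) (hI := hI) (hO := hO) (v := ⟨v, hvlt⟩)
    simp only [eval_sub, eval_var, eval_const, Function.update_apply]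
    norm_num
    rw [hv, Nat.add_sub_cancel_left]
    split_ifs with h
    · rw [this.2 h]; rfl
    · rw [Bool.eq_false_iff.2 fun h' => h (this.1 h')]; rfl
  · rw [eval_let2, eval_bigColE hα hM (by
      simp [eval_sub, eval_add, eval_var, eval_const, eval_bigE hα hM]
      omega)]
    obtain ⟨v, hv⟩ : ∃ v, ρ 0 = 1 + 6 * A.width + v := ⟨ρ 0 - (1 + 6 * A.width), by omega⟩
    have hvlt : v < (A.bigGame hI hO).n := by omega
    have e1 : (A.bigGame hI hO).encode.getD (1 + 6 * A.width + v) 0 = _ :=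
      ParityGame.getD_encode_color _ hvlt
    rw [← hv] at e1
    rw [e1]
    simp only [eval_sub, eval_add, eval_var, eval_const, Function.update_apply, eval_bigE hα hM]
    norm_num
    rw [hv, Nat.add_sub_cancel_left]
    rfl
  · obtain ⟨j, hj⟩ : ∃ j, ρ 0 = 1 + 2 * (6 * A.width) + j :=
      ⟨ρ 0 - (1 + 2 * (6 * A.width)), by omega⟩
    have hdlt : j / (6 * A.width) < 6 * A.width := by
      rw [Nat.div_lt_iff_lt_mul hN]; omega
    have hmlt := Nat.mod_lt j hN
    have hdm := Nat.div_add_mod j (6 * A.width)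
    rw [mul_comm] at hdm
    rw [eval_let2, eval_div (by rw [hsub]; omega) (by rwa [eval_bigE hα hM]),
      eval_mod (by rw [hsub]; omega) (by rwa [eval_bigE hα hM]), hsub, eval_bigE hα hM, hj,
      Nat.add_sub_cancel_left, eval_ite, holds_bigEdgeE hα hM
        (by simpa [Function.update_apply] using hdlt) (by simpa [Function.update_apply] using hmlt)]
    have e1 : (A.bigGame hI hO).encode.getD (1 + 2 * (6 * A.width) +
        (j / (6 * A.width) * (6 * A.width) + j % (6 * A.width))) 0 = _ :=
      ParityGame.getD_encode_edge (A.bigGame hI hO) hdlt hmlt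
    rw [hdm] at e1
    rw [e1]
    have := bigGame_edge (A := A) (hI := hI) (hO := hO) (v := ⟨j / (6 * A.width), hdlt⟩)
      (u := ⟨j % (6 * A.width), hmlt⟩)
    simp only [eval_const, Function.update_apply]
    norm_num
    split_ifs with h
    · rw [this.2 h]; rfl
    · rw [Bool.eq_false_iff.2 fun h' => h (this.1 h')]; rfl

end

end ParityAutomaton

namespace ParityAutomaton

/-! ### The table of the assumption automaton -/

open Ensurable.Expr

variable {kI kO : ℕ} (A : ParityAutomaton kI kO)

/-- The winning region at `var 23`, read from the solution of the big game in array `2`. -/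
def winE : Expr := lt (load 2 ((mul (const 4) widthE).add (var 23))) widthE

/-- The target at `var 23`. -/
def targetE : Expr := ite winE (mod (load 2 (var 23)) widthE)
  (mod (load 2 ((mul (const 2) widthE).add (var 23))) widthE)

/-- The existence of an accepting path from `var 25`. -/
def pathE : Expr :=
  and (not (lt (load 2 ((mul (const 5) widthE).add (var 25))) (mul (const 2) widthE)))
    (lt (load 2 ((mul (const 5) widthE).add (var 25))) (mul (const 3) widthE))

/-- The output of the strategy of the controller at `var 23`. -/
def outputToE (kI kO : ℕ) : Expr := find 26 (const kO)
  (eq (stepCall kI kO (div (var 23) (const 2)) ((const kI).add (var 26))) (div targetE (const 2)))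

/-- The transition relation of the assumption automaton at `var 23`, letter `var 24`, `var 25`. -/
def bTrE (kI kO : ℕ) : Expr :=
  ite (lt (var 24) (const kI))
    (and (not (mod (var 23) (const 2))) (and (mod (var 25) (const 2))
      (ite (lt (div (var 23) (const 2)) (nE.add (const 1)))
        (and (eq (stepCall kI kO (div (var 23) (const 2)) (var 24)) (div (var 25) (const 2))) pathE)
        (eq (div (var 25) (const 2)) (nE.add (const 1))))))
    (and (mod (var 23) (const 2)) (and (not (mod (var 25) (const 2)))
      (ite (and (lt (div (var 23) (const 2)) (nE.add (const 1)))
          (eq (var 24) ((const kI).add (outputToE kI kO))))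
        (eq (stepCall kI kO (div (var 23) (const 2)) (var 24)) (div (var 25) (const 2)))
        (eq (div (var 25) (const 2)) (nE.add (const 1))))))

/-- The colour of `var 23` in the assumption automaton. -/
def bColE : Expr := let2 16 (div (var 23) (const 2)) 24 (const 0)
  (ite (lt (var 16) (nE.add (const 1))) colE (const 0))

/-- The number of states of the assumption automaton. -/
def statesE : Expr := (nE.add (const 2)).add (nE.add (const 2))

/-- Entry `var 0` of the encoding of the assumption automaton. -/
def outE (kI kO : ℕ) : Expr :=
  ite (lt (var 0) (const 1)) statesE
    (ite (lt (var 0) (const 2)) ((load 0 (const 1)).add (load 0 (const 1)))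
      (ite (lt (var 0) ((const 2).add statesE))
        (let2 23 ((var 0).sub (const 2)) 24 (const 0) bColE)
        (let2 25 (mod ((var 0).sub ((const 2).add statesE)) statesE)
          26 (div ((var 0).sub ((const 2).add statesE)) statesE)
          (let2 23 (div (var 26) (const (kI + kO))) 24 (mod (var 26) (const (kI + kO)))
            (ite (bTrE kI kO) (const 1) (const 0))))))

/-- The number of entries of the encoding of the assumption automaton. -/
def outLengthE (kI kO : ℕ) : Expr :=
  ((const 2).add statesE).add (mul statesE (mul (const (kI + kO)) statesE))

section

variable {A} {α : ℕ → ℕ → ℕ} {M : ℕ} {ρ : ℕ → ℕ}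
  (hα : ∀ i, α 0 i = A.encode.getD i 0) (hM : A.Fits M)

include hα

theorem eval_statesE : statesE.eval α M ρ = 2 * (A.n + 2) := by
  simp only [statesE, eval_add, eval_nE hα, eval_const]; omega

include hM

theorem eval_outLengthE : (outLengthE kI kO).eval α M ρ =
    2 + 2 * (A.n + 2) + 2 * (A.n + 2) * ((kI + kO) * (2 * (A.n + 2))) := by
  have := hM.small
  rw [outLengthE, eval_add, eval_add, eval_mul (by rw [eval_statesE hα]; omega),
    eval_mul (by rw [eval_const]; omega), eval_statesE hα, eval_const, eval_const]

theorem holds_winE : winE.Holds α M ρ ↔ α 2 (4 * A.width + ρ 23) / A.width = 0 := by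
  have := hM.small
  have := A.width_pos
  rw [winE, holds_lt, eval_load, eval_add, eval_mul (by rw [eval_const]; omega), eval_widthE hα,
    eval_const, eval_var, Nat.div_eq_zero_iff]
  omega

theorem holds_pathE : pathE.Holds α M ρ ↔ α 2 (5 * A.width + ρ 25) / A.width = 2 := by
  have := hM.small
  have := A.width_pos
  rw [pathE, holds_and, holds_not, holds_lt, holds_lt, eval_load, eval_add,
    eval_mul (by rw [eval_const]; omega), eval_mul (by rw [eval_const]; omega),
    eval_mul (by rw [eval_const]; omega), eval_widthE hα,
    eval_const, eval_const, eval_const, eval_var, Nat.div_eq_iff (by omega)]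
  omega

variable (hg : ∀ v < 6 * A.width, α 2 v < M)

include hg

theorem eval_targetE (hx : ρ 23 < A.width) : targetE.eval α M ρ =
    target (fun x => α 2 x % A.width) (fun x => α 2 (2 * A.width + x) % A.width)
      (fun x => α 2 (4 * A.width + x) / A.width = 0) (ρ 23) := by
  have := hM.small
  have e : ((mul (const 2) widthE).add (var 23)).eval α M ρ = 2 * A.width + ρ 23 := by
    rw [eval_add, eval_mul (by rw [eval_const]; omega), eval_widthE hα, eval_const, eval_var]
  rw [targetE, eval_ite, holds_winE hα hM,
    eval_mod_width hα (by rw [eval_load, eval_var]; exact hg _ (by omega)),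
    eval_mod_width hα (by rw [eval_load, e]; exact hg _ (by omega)), eval_load, eval_load, e,
    eval_var, target]

theorem eval_outputToE (hx : ρ 23 < A.width) : (outputToE kI kO).eval α M ρ =
    A.outputTo (ρ 23 / 2) (target (fun x => α 2 x % A.width)
      (fun x => α 2 (2 * A.width + x) % A.width)
      (fun x => α 2 (4 * A.width + x) / A.width = 0) (ρ 23) / 2) := by
  have := hM.small
  have := A.width_pos
  have hw : A.width < M := by rw [width]; omega
  rw [outputToE, eval_find _ (by rw [eval_const]; omega), eval_const, outputTo]
  refine leastBelow_congr fun o ho => ?_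
  have e23 : (div (var 23) (const 2)).eval α M (Function.update ρ 26 o) = ρ 23 / 2 := by
    rw [eval_div_two] <;> simp [eval_var]
    omega
  have et := eval_targetE hα hM hg (ρ := Function.update ρ 26 o) (by simpa using hx)
  have hlt : target (fun x => α 2 x % A.width) (fun x => α 2 (2 * A.width + x) % A.width)
      (fun x => α 2 (4 * A.width + x) / A.width = 0) (ρ 23) < A.width := by
    rw [target]; split_ifs <;> exact Nat.mod_lt _ (by omega)
  rw [Function.update_of_ne (by decide)] at et
  rw [holds_eq, eval_stepCall hα hM (b := Sum.inr ⟨o, ho⟩)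
    (by simp [eval_add, eval_const, eval_var, code]), e23, eval_div_two (by rw [et]; omega), et]
  exact ⟨fun h => ⟨ho, h⟩, fun h => h.2⟩

theorem holds_bTrE (a : Fin kI ⊕ Fin kO) (hx : ρ 23 < 2 * (A.n + 2)) (ha : ρ 24 = code a)
    (hy : ρ 25 < 2 * (A.n + 2)) : (bTrE kI kO).Holds α M ρ ↔
      A.BTr (fun x => α 2 x % A.width) (fun x => α 2 (2 * A.width + x) % A.width)
        (fun x => α 2 (4 * A.width + x) / A.width = 0)
        (fun x => α 2 (5 * A.width + x) / A.width = 2) (ρ 23) a (ρ 25) := by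
  have := hM.small
  have := code_lt a
  rw [bTrE, holds_ite, holds_lt, holds_and, holds_and, holds_and, holds_and, holds_ite, holds_ite,
    holds_and, holds_and, holds_not, holds_not, holds_mod_two (by rw [eval_var]; omega),
    holds_mod_two (by rw [eval_var]; omega), holds_lt, holds_eq, holds_eq, holds_eq,
    holds_pathE hα hM, eval_stepCall hα hM (b := a) (by rw [eval_var, ha]),
    eval_div_two (by rw [eval_var]; omega), eval_div_two (by rw [eval_var]; omega), eval_add,
    eval_add, eval_nE hα, eval_var, eval_var, eval_var, eval_const, eval_const, ha]
  have hout : ρ 23 / 2 ≤ A.n → (outputToE kI kO).eval α M ρ = _ := fun h =>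
    eval_outputToE hα hM hg (by rw [width]; omega)
  rcases a with i | o
  · simp only [code, BTr]
    have := i.2
    simp only [this, not_true, true_and, false_and, or_false]
    have e1 : ρ 23 / 2 < A.n + 1 ↔ ρ 23 / 2 ≤ A.n := by omega
    have e2 : ¬ ρ 23 / 2 ≤ A.n ↔ A.n < ρ 23 / 2 := by omega
    have e3 : ¬ ρ 23 % 2 = 1 ↔ ρ 23 % 2 = 0 := by omega
    rw [e1, e2, e3]
  · simp only [code, BTr]
    have e0 : ¬ kI + (o : ℕ) < kI := by omega
    have e1 : ρ 23 / 2 < A.n + 1 ↔ ρ 23 / 2 ≤ A.n := by omega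
    have e3 : ¬ ρ 25 % 2 = 1 ↔ ρ 25 % 2 = 0 := by omega
    simp only [e0, not_false_eq_true, true_and, false_and, false_or, e1, e3,
      Nat.add_left_cancel_iff]
    by_cases h : ρ 23 / 2 ≤ A.n
    · rw [hout h]
      simp only [h, true_and, forall_const]
    · simp [h]

omit hg in
theorem eval_bColE (hx : ρ 23 < 2 * (A.n + 2)) : bColE.eval α M ρ = A.bCol (ρ 23) := by
  have := hM.small
  rw [bColE, eval_let2, eval_ite, holds_lt, eval_add, eval_nE hα, eval_colE hα,
    eval_div_two (by rw [eval_var]; omega), bCol]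
  simp [eval_var, eval_const]

theorem eval_outE (hk : ρ 0 < 2 + 2 * (A.n + 2) + 2 * (A.n + 2) * ((kI + kO) * (2 * (A.n + 2)))) :
    (outE kI kO).eval α M ρ =
      (A.assumptionAutomaton (fun x => α 2 x % A.width) (fun x => α 2 (2 * A.width + x) % A.width)
        (fun x => α 2 (4 * A.width + x) / A.width = 0)
        (fun x => α 2 (5 * A.width + x) / A.width = 2)).encode.getD (ρ 0) 0 := by
  classical
  have h1 := hM.out
  set B := A.assumptionAutomaton (fun x => α 2 x % A.width)
    (fun x => α 2 (2 * A.width + x) % A.width) (fun x => α 2 (4 * A.width + x) / A.width = 0)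
    (fun x => α 2 (5 * A.width + x) / A.width = 2) with hB
  have hn : B.n = 2 * (A.n + 2) := rfl
  have hsub : ((var 0).sub ((const 2).add statesE)).eval α M ρ = ρ 0 - (2 + 2 * (A.n + 2)) := by
    simp only [eval_sub, eval_add, eval_const, eval_var, eval_statesE hα]
  rw [outE, eval_ite, eval_ite, eval_ite, holds_lt, holds_lt, holds_lt]
  simp only [eval_add, eval_const, eval_var, eval_statesE hα]
  split_ifs with c1 c2 c3
  · rw [show ρ 0 = 0 by omega]; rfl
  · rw [show ρ 0 = 1 by omega, eval_load, eval_const, hα, getD_encode_one, getD_encode_one]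
    change _ = 2 * (A.start : ℕ)
    omega
  · rw [eval_let2, eval_bColE hα hM (by simp [eval_sub, eval_var, eval_const]; omega)]
    obtain ⟨s, hs⟩ : ∃ s, ρ 0 = s + 2 := ⟨ρ 0 - 2, by omega⟩
    have hslt : s < B.n := by omega
    rw [hs, getD_encode_color _ hslt]
    simp [eval_sub, eval_var, eval_const, hs]
    rfl
  · obtain ⟨j, hj⟩ : ∃ j, ρ 0 = 2 + 2 * (A.n + 2) + j := ⟨ρ 0 - (2 + 2 * (A.n + 2)), by omega⟩
    obtain ⟨N, hN⟩ : ∃ N, N = 2 * (A.n + 2) := ⟨_, rfl⟩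
    have hNpos : 0 < N := by omega
    have hjlt : j < N * (kI + kO) * N := by rw [mul_assoc, hN]; omega
    have hKpos : 0 < kI + kO := by
      rcases Nat.eq_zero_or_pos (kI + kO) with h | h
      · rw [h] at hjlt; simp at hjlt
      · exact h
    have hd1 : j / N < N * (kI + kO) := (Nat.div_lt_iff_lt_mul hNpos).2 hjlt
    have hd2 : j / N / (kI + kO) < N := (Nat.div_lt_iff_lt_mul hKpos).2 hd1
    have hm1 := Nat.mod_lt j hNpos
    have hm2 := Nat.mod_lt (j / N) hKpos
    have hle := Nat.div_le_self j N
    have hdm : (j / N / (kI + kO) * (kI + kO) + j / N % (kI + kO)) * N + j % N = j := by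
      rw [Nat.div_add_mod', Nat.div_add_mod']
    obtain ⟨a, ha⟩ := exists_code hm2
    have hjM : j < M := by omega
    rw [eval_let2, eval_mod (by rw [hsub]; omega) (by rw [eval_statesE hα]; omega),
      eval_div (by rw [hsub]; omega) (by rw [eval_statesE hα]; omega), hsub, eval_statesE hα, hj,
      Nat.add_sub_cancel_left, ← hN, eval_let2,
      eval_mod (by simp [eval_var]; omega) (by rwa [eval_const]),
      eval_div (by simp [eval_var]; omega) (by rwa [eval_const]), eval_ite,
      holds_bTrE hα hM hg a (by simp [eval_var, eval_const]; omega)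
        (by simp [eval_var, eval_const, ha]) (by simp [eval_var, eval_const]; omega)]
    have e1 : B.encode.getD (2 + N + ((j / N / (kI + kO) * (kI + kO) + code a) * N + j % N)) 0 =
        (B.trans ⟨j / N / (kI + kO), by omega⟩ a ⟨j % N, by omega⟩).toNat := by
      have e0 : ∀ N', N' = B.n → ∀ {s t : ℕ} (hs : s < B.n) (ht : t < B.n),
          B.encode.getD (2 + N' + ((s * (kI + kO) + code a) * N' + t)) 0 =
            (B.trans ⟨s, hs⟩ a ⟨t, ht⟩).toNat := by
        rintro _ rfl s t hs ht
        exact B.getD_encode_trans hs ht a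
      exact e0 N (by omega) _ _
    rw [ha, hdm] at e1
    rw [e1]
    have e2 : B.trans ⟨j / N / (kI + kO), by omega⟩ a ⟨j % N, by omega⟩ =
      decide (A.BTr (fun x => α 2 x % A.width) (fun x => α 2 (2 * A.width + x) % A.width)
        (fun x => α 2 (4 * A.width + x) / A.width = 0)
        (fun x => α 2 (5 * A.width + x) / A.width = 2) (j / N / (kI + kO)) a (j % N)) := rfl
    rw [e2]
    simp [eval_var, eval_const]
    split_ifs <;> simp_all

end

end ParityAutomaton

/-! ### Solving parity games by exhaustive search -/

/-- For a sequence of colours with period at most `N`, the parity condition can be checked on the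
first `N` entries. -/
theorem parityAccepts_iff_of_periodic {c : ℕ → ℕ} {p N : ℕ} (hp : 0 < p) (hpN : p ≤ N)
    (hc : ∀ i, c (i + p) = c i) :
    ParityAccepts c ↔ ∃ j < N, Even (c j) ∧ ∀ i < N, c j ≤ c i := by
  have hmul : ∀ k i, c (i + k * p) = c i := fun k i => by
    induction k with
    | zero => simp
    | succ k ih => rw [add_mul, one_mul, ← add_assoc, hc, ih]
  have hfreq : ∀ k, (∃ᶠ i in atTop, c i = k) ↔ ∃ j < N, c j = k := fun k => by
    constructor
    · intro h
      obtain ⟨i, hi⟩ := h.exists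
      refine ⟨i % p, (Nat.mod_lt _ hp).trans_le hpN, ?_⟩
      rw [← hi, ← hmul (i / p) (i % p), mul_comm, Nat.mod_add_div]
    · rintro ⟨j, -, rfl⟩
      refine frequently_atTop.2 fun a => ⟨j + a * p, ?_, hmul a j⟩
      exact (Nat.le_mul_of_pos_right a hp).trans (Nat.le_add_left _ _)
  simp only [ParityAccepts, hfreq]
  constructor
  · rintro ⟨_, hk, ⟨j, hj, rfl⟩, h⟩
    exact ⟨j, hj, hk, fun i hi => h ⟨i, hi, rfl⟩⟩
  · rintro ⟨j, hj, hk, h⟩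
    refine ⟨_, hk, ⟨j, hj, rfl⟩, ?_⟩
    rintro _ ⟨i, hi, rfl⟩
    exact h i hi

namespace ParityGame

variable {G : ParityGame}

/-- The colours along the path of a function on the vertices: after `n` steps the path is in its
cycle. -/
theorem parityAccepts_iterate (q : Fin G.n → Fin G.n) (v : Fin G.n) :
    (ParityAccepts fun i => G.color (q^[i] v)) ↔
      ∃ j < G.n, Even (G.color (q^[G.n + j] v) : ℕ) ∧
        ∀ i < G.n, G.color (q^[G.n + j] v) ≤ G.color (q^[G.n + i] v) := by
  obtain ⟨a, b, hab, heq⟩ : ∃ a b : Fin (G.n + 1), a < b ∧ q^[a] v = q^[b] v := by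
    obtain ⟨a, b, hne, heq⟩ := Fintype.exists_ne_map_eq_of_card_lt
      (fun i : Fin (G.n + 1) => q^[i] v) (by simp)
    rcases lt_or_gt_of_ne hne with h | h
    exacts [⟨a, b, h, heq⟩, ⟨b, a, h, heq.symm⟩]
  have hab' : (a : ℕ) < b := hab
  rw [← parityAccepts_add _ G.n]
  refine (parityAccepts_iff_of_periodic (p := b - a) (N := G.n) (by omega) (by omega)
    fun i => ?_).trans (by simp only [add_comm])
  rw [show i + (b - a) + G.n = (i + (G.n - a)) + b by omega, Function.iterate_add_apply, ← heq,
    ← Function.iterate_add_apply, show i + (G.n - a) + a = i + G.n by omega]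

/-- `q` is a choice of moves for both players that agrees with `p` for the controller. -/
def Follows (p q : Fin G.n → Fin G.n) : Prop :=
  ∀ v, G.edge v (q v) = true ∧ (G.owner v = true → q v = p v)

/-- Against a memoryless strategy it suffices to try the memoryless counter-strategies. -/
theorem winsFrom_iff {p : Fin G.n → Fin G.n} (hp : G.Legal fun _ => p) (v : Fin G.n) :
    G.WinsFrom (fun _ => p) v ↔
      ∀ q, Follows p q → ParityAccepts fun i => G.color (q^[i] v) := by
  constructor
  · intro h q hq
    refine h (fun i => q^[i] v) rfl (fun i => ?_) fun i hi => ?_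
    · rw [Function.iterate_succ_apply']
      exact (hq _).1
    · rw [Function.iterate_succ_apply']
      exact (hq _).2 hi
  · intro h ρ h0 hρ hcons
    -- In the graph that `p` leaves, all moves are up to the environment.
    obtain ⟨s, r, -, hr, hsr⟩ := exists_positional
      { n := G.n
        owner := fun _ => false
        edge := fun x y => G.edge x y && (!G.owner x || decide (y = p x))
        color := G.color
        total := fun x => by
          by_cases hx : G.owner x = true
          · exact ⟨p x, by simp [hp [] x hx]⟩
          · obtain ⟨y, hy⟩ := G.total x
            exact ⟨y, by simp [hy, hx]⟩ }
    rcases hsr v with hw | hl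
    · refine hw ρ h0 (fun i => ?_) fun i hi => absurd hi (by simp)
      have := hcons i
      simp only [Bool.and_eq_true, hρ, Bool.or_eq_true, Bool.not_eq_true', decide_eq_true_eq,
        true_and]
      by_cases hi : G.owner (ρ i) = true
      · exact Or.inr (this hi)
      · exact Or.inl (by simpa using hi)
    · have hf : Follows p r := fun x => by
        have := hr x
        simp only [Bool.and_eq_true, Bool.or_eq_true, Bool.not_eq_true', decide_eq_true_eq] at this
        exact ⟨this.1, fun hx => this.2.resolve_left (by simp [hx])⟩
      refine absurd (h r hf) (hl (fun i => r^[i] v) rfl (fun i => ?_) fun i _ => ?_)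
      · rw [Function.iterate_succ_apply']
        exact hr _
      · rw [Function.iterate_succ_apply']

theorem isMemorylessWinning_iff {p : Fin G.n → Fin G.n} : G.IsMemorylessWinning p ↔
    G.Legal (fun _ => p) ∧ ∀ p' : Fin G.n → Fin G.n, ∀ v, G.Legal (fun _ => p') →
      G.WinsFrom (fun _ => p') v → G.WinsFrom (fun _ => p) v := by
  constructor
  · exact fun h => ⟨h.1, fun p' v hp' hv => h.2 v ⟨_, hp', hv⟩⟩
  · rintro ⟨h1, h2⟩
    obtain ⟨s, hs, hw⟩ := G.exists_isMemorylessWinning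
    exact ⟨h1, fun v hv => h2 s v hs (hw v hv)⟩

/-- The function on the vertices whose table has the digits of `k`. -/
def profile (hN : 0 < G.n) (k : ℕ) (v : Fin G.n) : Fin G.n :=
  ⟨k / G.n ^ (v : ℕ) % G.n, Nat.mod_lt _ hN⟩

theorem exists_profile (hN : 0 < G.n) (p : Fin G.n → Fin G.n) :
    ∃ k < G.n ^ G.n, profile hN k = p := by
  refine ⟨finFunctionFinEquiv p, (finFunctionFinEquiv p).2, ?_⟩
  have h := finFunctionFinEquiv.symm_apply_apply p
  funext v
  exact congrFun h v

theorem exists_lt_profile_iff (hN : 0 < G.n) {P : (Fin G.n → Fin G.n) → Prop} :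
    (∃ k < G.n ^ G.n, P (profile hN k)) ↔ ∃ p, P p :=
  ⟨fun ⟨k, _, h⟩ => ⟨_, h⟩, fun ⟨p, h⟩ => by
    obtain ⟨k, hk, rfl⟩ := exists_profile hN p
    exact ⟨k, hk, h⟩⟩

theorem forall_lt_profile_iff (hN : 0 < G.n) {P : (Fin G.n → Fin G.n) → Prop} :
    (∀ k < G.n ^ G.n, P (profile hN k)) ↔ ∀ p, P p :=
  ⟨fun h p => by
    obtain ⟨k, hk, rfl⟩ := exists_profile hN p
    exact h k hk, fun h k _ => h _⟩

open Ensurable.Expr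

/-- The number of vertices of the game in array `1`. -/
def orderE : Expr := load 1 (const 0)

/-- The owner of `var v`. -/
def ownerE (v : ℕ) : Expr := load 1 ((const 1).add (var v))

/-- The colour of a vertex. -/
def colorE (e : Expr) : Expr := load 1 (((const 1).add orderE).add e)

/-- The edge from `var v` to a vertex. -/
def edgeE (v : ℕ) (e : Expr) : Expr :=
  load 1 (((const 1).add (orderE.add orderE)).add ((mul (var v) orderE).add e))

/-- The power of the number of vertices with a given exponent. -/
def powE (e : Expr) : Expr := iter 30 e (const 1) (mul orderE (var 30))

/-- The profile `var k` at `var v`. -/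
def profileE (k v : ℕ) : Expr := mod (div (var k) (powE (var v))) orderE

/-- The profile `var k` is a legal strategy. -/
def legalE (k : ℕ) : Expr := all 31 orderE (or (not (ownerE 31)) (edgeE 31 (profileE k 31)))

/-- The profile `var q` follows the profile `var k`. -/
def followsE (k q : ℕ) : Expr := all 31 orderE
  (and (edgeE 31 (profileE q 31)) (or (not (ownerE 31)) (eq (profileE q 31) (profileE k 31))))

/-- The vertex reached from `var v` with the profile `var q` after `n` and another `var j` steps. -/
def walkE (q v j : ℕ) : Expr := iter 32 (orderE.add (var j)) (var v) (profileE q 32)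

/-- The path from `var v` with the profile `var q` satisfies the parity condition. -/
def acceptsE (q v : ℕ) : Expr := ex 33 orderE
  (and (not (mod (colorE (walkE q v 33)) (const 2)))
    (all 34 orderE (not (lt (colorE (walkE q v 34)) (colorE (walkE q v 33))))))

/-- The profile `var k` is winning from `var v`. -/
def winsE (k v : ℕ) : Expr := all 35 (powE orderE) (or (not (followsE k 35)) (acceptsE 35 v))

/-- The least profile that is a memoryless winning strategy. -/
def bestE : Expr := find 36 (powE orderE) (and (legalE 36)
  (all 37 (powE orderE) (all 38 orderE (or (not (and (legalE 37) (winsE 37 38))) (winsE 36 38)))))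

section

variable {α : ℕ → ℕ → ℕ} {M : ℕ} {ρ : ℕ → ℕ}
  (hα : ∀ i < G.encode.length, α 1 i = G.encode.getD i 0)

include hα

theorem eval_orderE : orderE.eval α M ρ = G.n := by
  rw [orderE, eval_load, eval_const, hα _ (by rw [length_encode]; omega), getD_encode_zero]

theorem holds_ownerE {v : ℕ} (hv : ρ v < G.n) :
    (ownerE v).Holds α M ρ ↔ G.owner ⟨ρ v, hv⟩ = true := by
  rw [Holds, ownerE, eval_load, eval_add, eval_const, eval_var,
    hα _ (by rw [length_encode]; omega), getD_encode_owner _ hv]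
  cases G.owner ⟨ρ v, hv⟩ <;> simp

theorem eval_colorE {e : Expr} (he : e.eval α M ρ < G.n) :
    (colorE e).eval α M ρ = G.color ⟨e.eval α M ρ, he⟩ := by
  rw [colorE, eval_load, eval_add, eval_add, eval_const, eval_orderE hα,
    hα _ (by rw [length_encode]; omega), getD_encode_color _ he]

variable (hM : G.encode.length ≤ M)

include hM

theorem holds_edgeE {v : ℕ} {e : Expr} (hv : ρ v < G.n) (he : e.eval α M ρ < G.n) :
    (edgeE v e).Holds α M ρ ↔ G.edge ⟨ρ v, hv⟩ ⟨e.eval α M ρ, he⟩ = true := by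
  rw [length_encode] at hM
  have h1 : ρ v * G.n + G.n ≤ G.n * G.n := by
    rw [← Nat.succ_mul]; exact Nat.mul_le_mul_right _ hv
  rw [Holds, edgeE, eval_load, eval_add, eval_add, eval_add, eval_add,
    eval_mul (by rw [eval_var]; omega), eval_const, eval_var, eval_orderE hα, ← two_mul,
    hα _ (by rw [length_encode]; omega), getD_encode_edge _ hv he]
  cases G.edge ⟨ρ v, hv⟩ ⟨e.eval α M ρ, he⟩ <;> simp

theorem eval_powE {e : Expr} (he : e.eval α M ρ ≤ M) :
    (powE e).eval α M ρ = G.n ^ e.eval α M ρ := by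
  rw [length_encode] at hM
  rw [powE, eval_iter _ he, eval_const]
  have : (fun v => (mul orderE (var 30)).eval α M (Function.update ρ 30 v)) = fun v => G.n * v := by
    funext v
    rw [eval_mul (by rw [eval_orderE hα]; omega), eval_orderE hα, eval_var, Function.update_self]
  rw [this]
  generalize e.eval α M ρ = k
  induction k with
  | zero => simp
  | succ k ih => rw [Function.iterate_succ_apply', ih, pow_succ']

variable (hN : 0 < G.n)

theorem eval_profileE {k v : ℕ} (hk : ρ k < M) (hv : ρ v < G.n) :
    (profileE k v).eval α M ρ = profile hN (ρ k) ⟨ρ v, hv⟩ := by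
  have hM' := hM
  rw [length_encode] at hM'
  have hp : (powE (var v)).eval α M ρ = G.n ^ ρ v := by
    rw [eval_powE hα hM, eval_var]
    rw [eval_var]; omega
  have hd : (div (var k) (powE (var v))).eval α M ρ = ρ k / G.n ^ ρ v := by
    rw [eval_div (by rwa [eval_var]) (by rw [hp]; exact pow_pos hN _), hp, eval_var]
  rw [profileE, eval_mod (by rw [hd]; exact (Nat.div_le_self _ _).trans_lt hk)
    (by rwa [eval_orderE hα]), hd, eval_orderE hα, profile]

theorem holds_legalE {k : ℕ} (hk : ρ k < M) (hk' : k ≠ 31) :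
    (legalE k).Holds α M ρ ↔ G.Legal fun _ => profile hN (ρ k) := by
  have hM' := hM
  rw [length_encode] at hM'
  rw [legalE, holds_all _ (by rw [eval_orderE hα]; omega), eval_orderE hα]
  have key : ∀ v : Fin G.n, (or (not (ownerE 31)) (edgeE 31 (profileE k 31))).Holds α M
      (Function.update ρ 31 v) ↔
        (G.owner v = true → G.edge v (profile hN (ρ k) v) = true) := fun v => by
    have h1 : Function.update ρ 31 (v : ℕ) k = ρ k := Function.update_of_ne hk' _ _
    have h2 : Function.update ρ 31 (v : ℕ) 31 = v := Function.update_self _ _ _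
    have e := eval_profileE hα hM hN (ρ := Function.update ρ 31 v) (k := k) (v := 31)
      (by rwa [h1]) (by rw [h2]; exact v.2)
    rw [holds_or, holds_not, holds_ownerE hα (by rw [h2]; exact v.2),
      holds_edgeE hα hM (by rw [h2]; exact v.2) (by rw [e]; exact Fin.is_lt _)]
    simp only [e, h1, h2, Fin.eta, imp_iff_not_or]
  exact ⟨fun h _ v => (key v).1 (h v v.2), fun h v hv => (key ⟨v, hv⟩).2 (h [] _)⟩

theorem holds_followsE {k q : ℕ} (hk : ρ k < M) (hk' : k ≠ 31) (hq : ρ q < M) (hq' : q ≠ 31) :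
    (followsE k q).Holds α M ρ ↔ Follows (profile hN (ρ k)) (profile hN (ρ q)) := by
  have hM' := hM
  rw [length_encode] at hM'
  rw [followsE, holds_all _ (by rw [eval_orderE hα]; omega), eval_orderE hα]
  have key : ∀ v : Fin G.n, (and (edgeE 31 (profileE q 31)) (or (not (ownerE 31))
      (eq (profileE q 31) (profileE k 31)))).Holds α M (Function.update ρ 31 v) ↔
        (G.edge v (profile hN (ρ q) v) = true ∧
          (G.owner v = true → profile hN (ρ q) v = profile hN (ρ k) v)) := fun v => by
    have h1 : Function.update ρ 31 (v : ℕ) k = ρ k := Function.update_of_ne hk' _ _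
    have h3 : Function.update ρ 31 (v : ℕ) q = ρ q := Function.update_of_ne hq' _ _
    have h2 : Function.update ρ 31 (v : ℕ) 31 = v := Function.update_self _ _ _
    have e := eval_profileE hα hM hN (ρ := Function.update ρ 31 v) (k := k) (v := 31)
      (by rwa [h1]) (by rw [h2]; exact v.2)
    have e' := eval_profileE hα hM hN (ρ := Function.update ρ 31 v) (k := q) (v := 31)
      (by rwa [h3]) (by rw [h2]; exact v.2)
    rw [holds_and, holds_or, holds_not, holds_eq, holds_ownerE hα (by rw [h2]; exact v.2),
      holds_edgeE hα hM (by rw [h2]; exact v.2) (by rw [e']; exact Fin.is_lt _)]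
    simp only [e, e', h1, h2, h3, Fin.eta, imp_iff_not_or, Fin.ext_iff]
  exact ⟨fun h v => (key v).1 (h v v.2), fun h v hv => (key ⟨v, hv⟩).2 (h _)⟩

theorem eval_walkE {q v j : ℕ} (hq : ρ q < M) (hq' : q ≠ 32) (hv : ρ v < G.n) (hj : ρ j ≤ G.n) :
    (walkE q v j).eval α M ρ = ((profile hN (ρ q))^[G.n + ρ j] ⟨ρ v, hv⟩ : Fin G.n) := by
  have hM' := hM
  rw [length_encode] at hM'
  have hb : (orderE.add (var j)).eval α M ρ = G.n + ρ j := by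
    rw [eval_add, eval_orderE hα, eval_var]
  rw [walkE, eval_iter _ (by rw [hb]; omega), hb, eval_var]
  generalize G.n + ρ j = i
  induction i with
  | zero => rfl
  | succ i ih =>
    have h1 : ∀ x, Function.update ρ 32 x q = ρ q := fun x => Function.update_of_ne hq' _ _
    have h2 : ∀ x, Function.update ρ 32 x 32 = x := fun x => Function.update_self _ _ _
    rw [Function.iterate_succ_apply', ih, Function.iterate_succ_apply',
      eval_profileE hα hM hN (by rwa [h1]) (by rw [h2]; exact Fin.is_lt _)]
    simp only [h1, h2]

/-- The remainder modulo `2` is computed by a loop, whence the bound on the colours. -/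
theorem holds_acceptsE {q v : ℕ} (hc : ∀ x, G.color x < M) (hq : ρ q < M) (hq' : 34 < q)
    (hv : ρ v < G.n) (hv' : 34 < v) : (acceptsE q v).Holds α M ρ ↔
      ParityAccepts fun i => G.color ((profile hN (ρ q))^[i] ⟨ρ v, hv⟩) := by
  have hM' := hM
  rw [length_encode] at hM'
  rw [acceptsE, holds_ex _ (by rw [eval_orderE hα]; omega), eval_orderE hα,
    parityAccepts_iterate]
  refine exists_congr fun j => and_congr_right fun hj => ?_
  have h1 : Function.update ρ 33 j q = ρ q := Function.update_of_ne (by omega) _ _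
  have h2 : Function.update ρ 33 j v = ρ v := Function.update_of_ne (by omega) _ _
  have h3 : Function.update ρ 33 j 33 = j := Function.update_self _ _ _
  have e := eval_walkE hα hM hN (ρ := Function.update ρ 33 j) (q := q) (v := v) (j := 33)
    (by rwa [h1]) (by omega) (by rwa [h2]) (by omega)
  simp only [h1, h2, h3] at e
  have e' : (colorE (walkE q v 33)).eval α M (Function.update ρ 33 j) =
      G.color ((profile hN (ρ q))^[G.n + j] ⟨ρ v, hv⟩) := by
    rw [eval_colorE hα (by rw [e]; exact Fin.is_lt _)]
    simp only [e]
  rw [holds_and, holds_not, holds_mod_two (by rw [e']; exact hc _), e',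
    Nat.even_iff, ← Nat.mod_two_ne_one, holds_all _ (by rw [eval_orderE hα]; omega), eval_orderE hα]
  refine and_congr_right fun _ => forall_congr' fun i => forall_congr' fun hi => ?_
  set ρ' := Function.update (Function.update ρ 33 j) 34 i with hρ'
  have k1 : ρ' q = ρ q := by rw [hρ', Function.update_of_ne (by omega), h1]
  have k2 : ρ' v = ρ v := by rw [hρ', Function.update_of_ne (by omega), h2]
  have k3 : ρ' 33 = j := by rw [hρ', Function.update_of_ne (by omega), h3]
  have k4 : ρ' 34 = i := Function.update_self _ _ _
  have e1 := eval_walkE hα hM hN (ρ := ρ') (q := q) (v := v) (j := 33)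
    (by rwa [k1]) (by omega) (by rwa [k2]) (by omega)
  have e2 := eval_walkE hα hM hN (ρ := ρ') (q := q) (v := v) (j := 34)
    (by rwa [k1]) (by omega) (by rwa [k2]) (by omega)
  simp only [k1, k2, k3, k4] at e1 e2
  rw [holds_not, holds_lt, eval_colorE hα (by rw [e2]; exact Fin.is_lt _),
    eval_colorE hα (by rw [e1]; exact Fin.is_lt _)]
  simp only [e1, e2, not_lt]

omit hN in
theorem eval_powE_orderE : (powE orderE).eval α M ρ = G.n ^ G.n := by
  have hM' := hM
  rw [length_encode] at hM'
  rw [eval_powE hα hM (by rw [eval_orderE hα]; omega), eval_orderE hα]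

variable (hc : ∀ x, G.color x < M) (hp : G.n ^ G.n < M)

include hc hp

theorem holds_winsE {k v : ℕ} (hk : ρ k < M) (hk' : 35 < k) (hv : ρ v < G.n) (hv' : 35 < v)
    (hl : G.Legal fun _ => profile hN (ρ k)) :
    (winsE k v).Holds α M ρ ↔ G.WinsFrom (fun _ => profile hN (ρ k)) ⟨ρ v, hv⟩ := by
  have e := eval_powE_orderE hα hM (ρ := ρ)
  rw [winsE, holds_all _ (by omega), e, winsFrom_iff hl, ← forall_lt_profile_iff hN]
  refine forall_congr' fun q => forall_congr' fun hq => ?_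
  have h1 : Function.update ρ 35 q k = ρ k := Function.update_of_ne (by omega) _ _
  have h2 : Function.update ρ 35 q v = ρ v := Function.update_of_ne (by omega) _ _
  have h3 : Function.update ρ 35 q 35 = q := Function.update_self _ _ _
  rw [holds_or, holds_not, holds_followsE hα hM hN (by rwa [h1]) (by omega) (by omega) (by omega),
    holds_acceptsE hα hM hN hc (by omega) (by omega) (by rwa [h2]) (by omega), imp_iff_not_or]
  simp only [h1, h2, h3]

/-- Exhaustive search finds a memoryless winning strategy. -/
theorem eval_bestE : bestE.eval α M ρ < M ∧
    G.IsMemorylessWinning (profile hN (bestE.eval α M ρ)) := by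
  have hM' := hM
  rw [length_encode] at hM'
  have e := eval_powE_orderE hα hM (ρ := ρ)
  rw [bestE, eval_find _ (by omega), e]
  rw [leastBelow_congr (R := fun k => G.IsMemorylessWinning (profile hN k)) fun k hk => ?_]
  · have := leastBelow_spec ((exists_lt_profile_iff hN).2 G.exists_isMemorylessWinning)
    exact ⟨this.1.trans hp, this.2⟩
  · have h1 : Function.update ρ 36 k 36 = k := Function.update_self _ _ _
    have e' := eval_powE_orderE hα hM (ρ := Function.update ρ 36 k)
    rw [holds_and, holds_legalE hα hM hN (by omega) (by omega), isMemorylessWinning_iff, h1]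
    refine and_congr_right fun hl => ?_
    rw [holds_all _ (by omega), e',
      ← forall_lt_profile_iff hN (P := fun p' => ∀ v, G.Legal (fun _ => p') →
        G.WinsFrom (fun _ => p') v → G.WinsFrom (fun _ => profile hN k) v)]
    refine forall_congr' fun k' => forall_congr' fun hk' => ?_
    rw [holds_all _ (by rw [eval_orderE hα]; omega), eval_orderE hα]
    have key : ∀ v : Fin G.n, (or (not (and (legalE 37) (winsE 37 38))) (winsE 36 38)).Holds α M
        (Function.update (Function.update (Function.update ρ 36 k) 37 k') 38 v) ↔
          (G.Legal (fun _ => profile hN k') → G.WinsFrom (fun _ => profile hN k') v →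
            G.WinsFrom (fun _ => profile hN k) v) := fun v => by
      set ρ' := Function.update (Function.update (Function.update ρ 36 k) 37 k') 38 (v : ℕ)
      have r1 : ρ' 36 = k := rfl
      have r2 : ρ' 37 = k' := rfl
      have r3 : ρ' 38 = v := rfl
      have hv : ρ' 38 < G.n := v.2
      rw [holds_or, holds_not, holds_and, holds_legalE hα hM hN (by omega) (by omega), r2,
        holds_winsE hα hM hN hc hp (k := 36) (by omega) (by omega) hv (by omega) (by rwa [r1])]
      by_cases hl' : G.Legal fun _ => profile hN k'
      · rw [holds_winsE hα hM hN hc hp (k := 37) (by omega) (by omega) hv (by omega) (by rwa [r2])]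
        simp only [r1, r2, r3, hl', true_and, forall_const, imp_iff_not_or, Fin.eta]
      · simp [hl']
    exact ⟨fun h v => (key v).1 (h v v.2), fun h v hv => (key ⟨v, hv⟩).2 (h _)⟩

end

end ParityGame

/-! ### Polynomial bounds -/

open Polynomial in
theorem eval_mono (p : ℕ[X]) {a b : ℕ} (h : a ≤ b) : p.eval a ≤ p.eval b := by
  rw [eval_eq_sum_range, eval_eq_sum_range]
  exact Finset.sum_le_sum fun i _ => Nat.mul_le_mul_left _ (Nat.pow_le_pow_left h i)

theorem lt_two_pow_size {l : List ℕ} {x : ℕ} (h : x ∈ l) : x < 2 ^ size l := by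
  refine (Nat.lt_size_self x).trans_le (Nat.pow_le_pow_right (by norm_num) ?_)
  have := List.single_le_sum (l := l.map fun k => Nat.size k + 1) (by simp) (Nat.size x + 1)
    (List.mem_map_of_mem h)
  rw [size]
  omega

open Polynomial in
theorem exists_eval_two_pow_le (c : ℕ[X]) : ∃ r : ℕ[X], ∀ y, c.eval (2 ^ y) ≤ 2 ^ r.eval y := by
  refine ⟨C (c.eval 1) + C c.natDegree * X, fun y => ?_⟩
  have h : c.eval (2 ^ y) ≤ c.eval 1 * (2 ^ y) ^ c.natDegree := by
    rw [eval_eq_sum_range, eval_eq_sum_range, Finset.sum_mul]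
    refine Finset.sum_le_sum fun i hi => ?_
    rw [one_pow, mul_one]
    exact Nat.mul_le_mul_left _ (Nat.pow_le_pow_right (by positivity)
      (Nat.lt_succ_iff.1 (Finset.mem_range.1 hi)))
  refine h.trans ?_
  simp only [eval_add, eval_mul, eval_C, eval_X]
  rw [pow_add, ← pow_mul, mul_comm y]
  exact Nat.mul_le_mul_right _ Nat.lt_two_pow_self.le

theorem size_le {l : List ℕ} {b : ℕ} (h : ∀ x ∈ l, x < 2 ^ b) : size l ≤ l.length * (b + 1) := by
  induction l with
  | nil => simp [size]
  | cons x l ih =>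
    have h1 := Nat.size_le.2 (h x (by simp))
    have h2 := ih fun y hy => h y (by simp [hy])
    simp only [size, List.map_cons, List.sum_cons, List.length_cons] at h2 ⊢
    rw [add_mul]
    omega

theorem length_le_size (l : List ℕ) : l.length ≤ size l := by
  induction l with
  | nil => simp
  | cons x l ih =>
    simp only [size, List.map_cons, List.sum_cons, List.length_cons] at ih ⊢
    omega

/-! ### Programs that solve parity games -/

/-- With oracle `f`, the program `S` computes into array `2` a memoryless winning strategy for the
game that is encoded in array `1`, the length of the code being in register `3`. The cap for loops,
in register `1`, is at least this length. The time is bounded in terms of the cap and of the size of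
the game. -/
def SolvesGames (f : List ℕ → List ℕ) (S : Prog) (T : ℕ → ℕ) : Prop :=
  ∀ (G : ParityGame) (m : Mem), (∀ i < G.encode.length, m.arr 1 i = G.encode.getD i 0) →
    m.reg 3 = G.encode.length → G.encode.length ≤ m.reg 1 →
      Runs f S m (T (m.reg 1 + size G.encode)) fun m' =>
        (∃ s, G.IsMemorylessWinning s ∧ ∀ v : Fin G.n, m'.arr 2 v = s v) ∧
          m'.arr 0 = m.arr 0 ∧ m'.reg 1 = m.reg 1

theorem solvesGames_query {f : List ℕ → List ℕ} (hf : IsParityOracle f) :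
    SolvesGames f (.query 1 3 2 4) fun z => 2 * z + 1 := by
  intro G m harr hlen hle
  obtain ⟨s, hs, hfs⟩ := hf G
  have hread : m.read 1 (m.reg 3) = G.encode :=
    (eq_map_range hlen.symm fun i hi => (harr i (by omega)).symm).symm
  refine ⟨_, _, .query 1 3 2 4 m, ?_, ?_, ?_, ?_⟩
  · have : G.n ≤ G.encode.length := by rw [G.length_encode]; omega
    rw [hread, hfs, List.length_ofFn, hlen]
    change _ ≤ 2 * (m.reg 1 + size G.encode) + 1
    omega
  · refine ⟨s, hs, fun v => ?_⟩
    simp only [Mem.arr_setReg, Mem.arr_setArr, Function.update_self, hread, hfs]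
    exact getD_ofFn _ v.2
  · simp
  · simp

namespace ParityGame

open Ensurable.Expr

/-- A cap for the loops of the exhaustive search, given the former cap as `var 4`: it exceeds the
number of profiles, and all colours, since parities are computed by loops. -/
def searchCapE : Expr :=
  (((var 4).add (powE orderE)).add (sum 39 orderE (colorE (var 39)))).add (const 1)

/-- The table of the profile `var 5`. -/
def tableE : Expr := ite (lt (var 0) orderE) (profileE 5 0) (const 0)

/-- Exhaustive search for a memoryless winning strategy. -/
def search : Prog :=
  .seq (.copy 6 1) (.seq (.assign 7 searchCapE) (.seq (.copy 1 7) (.seq (.assign 7 bestE)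
    (.seq (.fill 2 tableE) (.copy 1 6)))))

theorem oracleFree_search : search.OracleFree :=
  ⟨trivial, Prog.oracleFree_assign _ _, trivial, Prog.oracleFree_assign _ _,
    Prog.oracleFree_fill _ _, trivial⟩

/-- The running time of the search in terms of the cap for its loops. -/
noncomputable def searchCost : Polynomial ℕ :=
  searchCapE.cost + bestE.cost + (Polynomial.X * (tableE.cost + 4) + 4) + 5

theorem solvesGames_search (f : List ℕ → List ℕ) :
    SolvesGames f search fun z => searchCost.eval (2 ^ (z * z + 2 * z + 2)) := by
  intro G m harr hlen hle
  have hα := harr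
  set z := m.reg 1 + size G.encode with hz
  set M' := m.reg 1 + G.n ^ G.n + (∑ v : Fin G.n, G.color v) + 1 with hM'
  have hcap : ∀ ρ : ℕ → ℕ, ρ 4 = m.reg 1 → searchCapE.eval m.arr (m.reg 1) ρ = M' := by
    intro ρ hρ
    have hle' := hle
    rw [length_encode] at hle'
    rw [searchCapE, eval_add, eval_add, eval_add, eval_var, hρ, eval_powE_orderE hα hle, eval_const,
      eval_sum _ (by rw [eval_orderE hα]; omega), eval_orderE hα, Finset.sum_range, hM']
    congr 2
    refine Finset.sum_congr rfl fun v _ => ?_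
    rw [eval_colorE hα (by simp [eval_var])]
    simp [eval_var]
  have hM'z : M' ≤ 2 ^ (z * z + 2 * z + 2) := by
    have hn : G.n ≤ z := by rw [length_encode] at hle; omega
    have h1 : m.reg 1 ≤ 2 ^ (z * z + 2 * z) :=
      (show m.reg 1 ≤ z by omega).trans (Nat.lt_two_pow_self.le.trans
        (Nat.pow_le_pow_right (by norm_num) (by omega)))
    have h2 : G.n ^ G.n ≤ 2 ^ (z * z + 2 * z) := by
      calc G.n ^ G.n ≤ (2 ^ G.n) ^ G.n := Nat.pow_le_pow_left Nat.lt_two_pow_self.le _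
        _ = 2 ^ (G.n * G.n) := (pow_mul _ _ _).symm
        _ ≤ _ := Nat.pow_le_pow_right (by norm_num) ((Nat.mul_le_mul hn hn).trans (by omega))
    have h3 : (∑ v : Fin G.n, G.color v) ≤ 2 ^ (z * z + 2 * z) := by
      calc (∑ v : Fin G.n, G.color v) ≤ ∑ v : Fin G.n, 2 ^ z := by
            refine Finset.sum_le_sum fun v _ => ?_
            have : G.color v ∈ G.encode := by simp [encode]
            exact (lt_two_pow_size this).le.trans (Nat.pow_le_pow_right (by norm_num) (by omega))
        _ = G.n * 2 ^ z := by simp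
        _ ≤ 2 ^ z * 2 ^ z := Nat.mul_le_mul_right _ (hn.trans Nat.lt_two_pow_self.le)
        _ = 2 ^ (2 * z) := by rw [← pow_add, two_mul]
        _ ≤ _ := Nat.pow_le_pow_right (by norm_num) (by omega)
    have h4 : 1 ≤ 2 ^ (z * z + 2 * z) := Nat.one_le_two_pow
    rw [pow_add _ _ 2]
    omega
  have hle₂ : G.encode.length ≤ M' := by omega
  have hpM : G.n ^ G.n < M' := by omega
  have hcM : ∀ x, G.color x < M' := fun x => by
    have := Finset.single_le_sum (f := G.color) (fun _ _ => Nat.zero_le _) (Finset.mem_univ x)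
    omega
  refine Runs.mono (c₁ := 1 + ((searchCapE.cost + 1).eval (m.reg 1) + (1 +
    ((bestE.cost + 1).eval M' + ((Polynomial.X * (tableE.cost + 4) + 4).eval M' + 1)))))
    (Runs.seq (Runs.copy (Runs.seq ((Runs.assign f 7 searchCapE _).mono (by simp) ?_)))) ?_
    fun _ h => h
  · rintro m₁ ⟨ha₁, hv₁, hr₁⟩
    simp only [Mem.arr_setReg, Mem.reg_setReg] at ha₁ hv₁ hr₁
    have h16 := hr₁ 6 (by omega) (by omega)
    rw [if_pos rfl] at h16
    rw [if_neg (by omega), hcap _ (by simp [Mem.vals])] at hv₁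
    refine Runs.seq (Runs.copy (Runs.seq ((Runs.assign f 7 bestE _).mono (by simp [hv₁]) ?_)))
    rintro m₂ ⟨ha₂, hv₂, hr₂⟩
    simp only [Mem.arr_setReg, Mem.reg_setReg, hv₁, ha₁] at ha₂ hv₂ hr₂
    have h26 := hr₂ 6 (by omega) (by omega)
    have h21 := hr₂ 1 (by omega) (by omega)
    rw [if_neg (by omega), h16] at h26
    rw [if_pos rfl] at h21
    rw [if_true] at hv₂
    set k := m₂.reg 7 with hk
    have hα₂ : ∀ g, ∀ i < G.encode.length, Function.update m₂.arr 2 g 1 i = G.encode.getD i 0 := by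
      intro g i hi
      rw [Function.update_of_ne (by decide), ha₂, hα i hi]
    refine Runs.seq ((Runs.fill f 2 tableE m₂ (fun i => if h : i < G.n then
        profile (by omega) k ⟨i, h⟩ else 0) fun i hi g => ?_).mono (by rw [h21]) ?_)
    · rw [tableE, eval_ite, holds_lt, eval_orderE (hα₂ g), eval_const, eval_var,
        Function.update_self]
      split_ifs with h
      · have hN : 0 < G.n := by omega
        have hkM : k < M' := by rw [hv₂]; exact (eval_bestE hα hle₂ hN hcM hpM).1
        rw [h21, eval_profileE (hα₂ g) hle₂ hN (by simpa [Mem.vals] using hkM) (by simpa using h)]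
        simp [Mem.vals, hk]
      · rfl
    · rintro m₃ ⟨⟨g, hg, hgF⟩, hr₃⟩
      have h36 := hr₃ 6 (by omega) (by omega)
      refine Runs.copy ⟨?_, ?_, ?_⟩
      · rcases Nat.eq_zero_or_pos G.n with hN | hN
        · obtain ⟨s, hs⟩ := G.exists_isMemorylessWinning
          exact ⟨s, hs, fun v => absurd v.2 (by omega)⟩
        · refine ⟨profile hN k, ?_, fun v => ?_⟩
          · rw [hv₂]
            exact (eval_bestE hα hle₂ hN hcM hpM).2
          · have hvM : (v : ℕ) < m₂.reg 1 := by
              rw [h21]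
              rw [length_encode] at hle₂
              omega
            rw [Mem.arr_setReg, hg, Function.update_self, hgF v hvM, dif_pos v.2]
      · rw [Mem.arr_setReg, hg, Function.update_of_ne (by decide), ha₂]
      · rw [Mem.reg_setReg, if_pos rfl, h36, h26]
  · have h1 := eval_mono searchCapE.cost (show m.reg 1 ≤ _ from
      (show m.reg 1 ≤ M' by omega).trans hM'z)
    have h2 := eval_mono bestE.cost hM'z
    have h3 := eval_mono (Polynomial.X * (tableE.cost + 4) + 4) hM'z
    simp only [searchCost, Polynomial.eval_add, Polynomial.eval_one, Polynomial.eval_ofNat]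
      at h1 h2 h3 ⊢
    omega

end ParityGame

namespace ParityAutomaton

open Ensurable.Expr

variable {kI kO : ℕ} (A : ParityAutomaton kI kO)

/-! ### The sizes of the game and of the automaton -/

/-- The cap for loops, as a function of the size of the input; it is large enough by
`fits_of_le`. -/
noncomputable def capPoly (k : ℕ) : Polynomial ℕ := (16 * (Polynomial.X + Polynomial.C k)) ^ 3

theorem eval_capPoly (k z : ℕ) : (capPoly k).eval z = (16 * (z + k)) ^ 3 := by simp [capPoly]

/-- A bound for the sizes of the big game and of the assumption automaton. -/
noncomputable def sizePoly (k : ℕ) : Polynomial ℕ :=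
  capPoly k * (capPoly k + Polynomial.X + 2)

theorem eval_sizePoly (k z : ℕ) :
    (sizePoly k).eval z = (capPoly k).eval z * ((capPoly k).eval z + z + 1 + 1) := by
  simp [sizePoly]

theorem fits_capPoly : A.Fits ((capPoly (kI + kO)).eval (size A.encode)) := by
  refine A.fits_of_le ?_
  rw [eval_capPoly]
  exact Nat.pow_le_pow_left (Nat.mul_le_mul_left _ (Nat.add_le_add_right (length_le_size _) _)) 3

theorem col_lt (s : ℕ) : A.col s < 2 ^ size A.encode + 1 := by
  rw [col]
  split_ifs with h
  · have : A.color ⟨s, h⟩ ∈ A.encode := by simp [encode]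
    exact (lt_two_pow_size this).trans (Nat.lt_succ_self _)
  · have := Nat.one_le_two_pow (n := size A.encode)
    omega

theorem toNat_lt_two_pow (b : Bool) (n : ℕ) : b.toNat < 2 ^ (n + 1) :=
  (Bool.toNat_lt b).trans_le (by
    have := Nat.one_le_two_pow (n := n)
    rw [pow_succ]
    omega)

theorem size_encode_bigGame_le (hI : 0 < kI) (hO : 0 < kO) :
    size (A.bigGame hI hO).encode ≤ (sizePoly (kI + kO)).eval (size A.encode) := by
  have hM := A.fits_capPoly
  set z := size A.encode with hz
  set M := (capPoly (kI + kO)).eval z with hM'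
  have hn : (A.bigGame hI hO).n = 6 * A.width := rfl
  have h1 := hM.game
  refine (size_le (b := M + z + 1) fun x hx => ?_).trans ?_
  · have h2 : 2 ^ (z + 1) ≤ 2 ^ (M + z + 1) := Nat.pow_le_pow_right (by norm_num) (by omega)
    simp only [ParityGame.encode, List.mem_cons, List.mem_append, List.mem_ofFn', Set.mem_range,
      List.mem_flatMap, List.mem_map, List.mem_finRange, true_and] at hx
    rcases hx with rfl | (⟨v, rfl⟩ | ⟨v, rfl⟩) | ⟨v, u, rfl⟩
    · rw [hn]
      exact (show 6 * A.width ≤ M + z + 1 by omega).trans_lt Nat.lt_two_pow_self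
    · exact toNat_lt_two_pow _ _
    · refine lt_of_lt_of_le ?_ h2
      change A.bigCol v < _
      have : A.col (v % A.width / 2) < 2 ^ z + 1 := A.col_lt _
      have := Nat.one_lt_two_pow (n := z) (by
        have := length_le_size A.encode
        rw [length_encode] at this
        omega)
      rw [bigCol, pow_succ]
      split_ifs <;> omega
    · exact toNat_lt_two_pow _ _
  · rw [eval_sizePoly, ParityGame.length_encode, hn]
    exact Nat.mul_le_mul_right _ h1.le

theorem size_encode_assumptionAutomaton_le (s₀ s₂ : ℕ → ℕ) (W E : ℕ → Prop) :
    size (A.assumptionAutomaton s₀ s₂ W E).encode ≤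
      (sizePoly (kI + kO)).eval (size A.encode) := by
  have hM := A.fits_capPoly
  set z := size A.encode with hz
  set M := (capPoly (kI + kO)).eval z with hM'
  have hn : (A.assumptionAutomaton s₀ s₂ W E).n = 2 * (A.n + 2) := rfl
  have h1 := hM.out
  have hsize : ∀ k ≤ M, k < 2 ^ (M + z + 1) := fun k hk =>
    (show k ≤ M + z + 1 by omega).trans_lt Nat.lt_two_pow_self
  refine (size_le (b := M + z + 1) fun x hx => ?_).trans ?_
  · have h2 : 2 ^ (z + 1) ≤ 2 ^ (M + z + 1) := Nat.pow_le_pow_right (by norm_num) (by omega)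
    simp only [encode, List.mem_cons, List.mem_append, List.mem_ofFn', Set.mem_range,
      List.mem_flatMap, List.mem_map, List.mem_finRange, true_and] at hx
    rcases hx with rfl | rfl | ⟨v, rfl⟩ | ⟨v, a, -, u, rfl⟩
    · exact hsize _ (by omega)
    · exact hsize _ (by omega)
    · refine lt_of_lt_of_le ?_ h2
      change A.bCol v < _
      have : A.col (v / 2) < 2 ^ z + 1 := A.col_lt _
      have := Nat.one_le_two_pow (n := z)
      rw [bCol, pow_succ]
      split_ifs <;> omega
    · exact toNat_lt_two_pow _ _
  · rw [eval_sizePoly, length_encode, hn]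
    exact Nat.mul_le_mul_right _ h1.le

/-! ### The algorithm -/

/-- The number of entries of the encoding of the big game. -/
def gameLengthE : Expr := ((const 1).add (bigE.add bigE)).add (mul bigE bigE)

/-- The code of the big game, padded with zeros. -/
def gameTableE (kI kO : ℕ) : Expr := ite (lt (var 0) gameLengthE) (gameE kI kO) (const 0)

/-- The code of the assumption automaton, padded with zeros. -/
def outTableE (kI kO : ℕ) : Expr := ite (lt (var 0) (outLengthE kI kO)) (outE kI kO) (const 0)

/-- `var 0` to the third power. -/
def cubeE : Expr := mul (var 0) (mul (var 0) (var 0))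

/-- The algorithm: compute the cap for loops, write the big game into array `1`, solve it, write the
assumption automaton into array `3`, and copy it into array `0`. The additions compute
`16 * (ℓ + (kI + kO))`, where `ℓ` is the length of the input; its cube is the cap. -/
def algorithm (kI kO : ℕ) (S : Prog) : Prog :=
  .seq (.const 2 (kI + kO)) (.seq (.add 2 2 0) (.seq (.add 2 2 2) (.seq (.add 2 2 2)
    (.seq (.add 2 2 2) (.seq (.add 2 2 2) (.seq (.copy 1 2) (.seq (.assign 7 cubeE)
      (.seq (.copy 1 7) (.seq (.fill 1 (gameTableE kI kO)) (.seq (.assign 3 gameLengthE)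
        (.seq S (.seq (.fill 3 (outTableE kI kO)) (.seq (.assign 5 (outLengthE kI kO))
          (.seq (.fill 0 (load 3 (var 0))) (.copy 0 5)))))))))))))))

theorem oracleFree_algorithm {S : Prog} (hS : S.OracleFree) : (algorithm kI kO S).OracleFree := by
  simp [algorithm, Prog.OracleFree, Prog.oracleFree_assign, Prog.oracleFree_fill, hS]

/-- The running time of the algorithm except for the solution of the game, in terms of the cap for
loops. -/
noncomputable def algorithmCost (kI kO : ℕ) : Polynomial ℕ :=
  cubeE.cost + (Polynomial.X * ((gameTableE kI kO).cost + 4) + 4) + gameLengthE.cost +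
    (Polynomial.X * ((outTableE kI kO).cost + 4) + 4) + (outLengthE kI kO).cost +
      (Polynomial.X * ((load 3 (var 0)).cost + 4) + 4) + 12

theorem runs_algorithm {f : List ℕ → List ℕ} {S : Prog} {T : ℕ → ℕ} (hS : SolvesGames f S T)
    (hI : 0 < kI) (hO : 0 < kO) :
    Runs f (algorithm kI kO S) (Mem.input A.encode)
      ((algorithmCost kI kO).eval ((capPoly (kI + kO)).eval A.encode.length) +
        T ((capPoly (kI + kO)).eval A.encode.length + size (A.bigGame hI hO).encode)) fun m' =>
      ∃ s₀ s₁ s₂ W E, A.Solution s₀ s₁ s₂ W E ∧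
        m'.output = (A.assumptionAutomaton s₀ s₂ W E).encode := by
  set c := 16 * (A.encode.length + (kI + kO)) with hc
  set M := (capPoly (kI + kO)).eval A.encode.length with hM'
  have hMc : M = c ^ 3 := eval_capPoly _ _
  have hM : A.Fits M := A.fits_of_le (by rw [hMc])
  have hcM : c ≤ M := by rw [hMc]; exact Nat.le_self_pow (by norm_num) c
  have hgame := hM.game
  have hn : (A.bigGame hI hO).n = 6 * A.width := rfl
  have hlen : (A.bigGame hI hO).encode.length =
      1 + 2 * (6 * A.width) + 6 * A.width * (6 * A.width) := ParityGame.length_encode _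
  have hgl : ∀ {α : ℕ → ℕ → ℕ} {ρ : ℕ → ℕ}, (∀ i, α 0 i = A.encode.getD i 0) →
      gameLengthE.eval α M ρ = (A.bigGame hI hO).encode.length := fun {α ρ} hα => by
    rw [gameLengthE, eval_add, eval_add, eval_add, eval_mul (by rw [eval_bigE hα hM]; omega),
      eval_const, eval_bigE hα hM, hlen]
    omega
  have h0 : ∀ i, (Mem.input A.encode).arr 0 i = A.encode.getD i 0 := fun i => rfl
  refine Runs.mono (c₁ := 1 + (1 + (1 + (1 + (1 + (1 + (1 + ((cubeE.cost + 1).eval c + (1 +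
    ((Polynomial.X * ((gameTableE kI kO).cost + 4) + 4).eval M + ((gameLengthE.cost + 1).eval M +
      (T (M + size (A.bigGame hI hO).encode) +
        ((Polynomial.X * ((outTableE kI kO).cost + 4) + 4).eval M +
          (((outLengthE kI kO).cost + 1).eval M +
            ((Polynomial.X * ((load 3 (var 0)).cost + 4) + 4).eval M + 1)))))))))))))))
    (Runs.seq (Runs.const (Runs.seq (Runs.add (Runs.seq (Runs.add (Runs.seq (Runs.add (Runs.seq
      (Runs.add (Runs.seq (Runs.add (Runs.seq (Runs.copy (Runs.seq ((Runs.assign f 7 cubeE _).mono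
        ?_ ?_)))))))))))))))) ?_ fun _ h => h
  · simp [Mem.input]
    refine eval_mono _ (by omega)
  · rintro m₁ ⟨ha₁, hv₁, -⟩
    replace hv₁ : m₁.reg 7 = M := by
      rw [hv₁, cubeE, eval_mul, eval_mul, hMc] <;> simp [eval_var, Mem.vals, Mem.input]
      ring
    simp only [Mem.arr_setReg] at ha₁
    refine Runs.seq (Runs.copy (Runs.seq ((Runs.fill f 1 (gameTableE kI kO) _
      (fun i => (A.bigGame hI hO).encode.getD i 0) fun k hk g => ?_).mono (by simp [hv₁]) ?_)))
    · have hα : ∀ i, Function.update m₁.arr 1 g 0 i = A.encode.getD i 0 := fun i => by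
        rw [Function.update_of_ne (by decide), ha₁, h0]
      simp only [Mem.arr_setReg, Mem.reg_setReg, if_true, hv₁] at hk ⊢
      rw [gameTableE, eval_ite, holds_lt, hgl hα, eval_var, Function.update_self, eval_const]
      split_ifs with h
      · rw [eval_gameE hα hM hI hO (by rw [Function.update_self]; omega), Function.update_self]
      · exact (List.getD_eq_default _ _ (by omega)).symm
    rintro m₂ ⟨⟨g₁, ha₂, hg₁⟩, hr₂⟩
    simp only [Mem.arr_setReg, Mem.reg_setReg, if_true, hv₁] at ha₂ hg₁ hr₂
    have h21 : m₂.reg 1 = M := by rw [hr₂ 1 (by omega) (by omega), if_pos rfl]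
    have hα₂ : ∀ i, m₂.arr 0 i = A.encode.getD i 0 := fun i => by
      rw [ha₂, Function.update_of_ne (by decide), ha₁, h0]
    refine Runs.seq ((Runs.assign f 3 gameLengthE _).mono (by rw [h21]) ?_)
    rintro m₃ ⟨ha₃, hv₃, hr₃⟩
    have h31 : m₃.reg 1 = M := by rw [hr₃ 1 (by omega) (by omega), h21]
    rw [h21, hgl hα₂] at hv₃
    refine Runs.seq ((hS (A.bigGame hI hO) m₃ (fun i hi => ?_) hv₃ (by omega)).mono
      (by rw [h31]) ?_)
    · rw [ha₃, ha₂, Function.update_self, hg₁ i (by omega)]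
    rintro m₄ ⟨⟨s, hs, hgs⟩, ha₄, h41⟩
    rw [h31] at h41
    have hα₄ : ∀ i, m₄.arr 0 i = A.encode.getD i 0 := fun i => by rw [ha₄, ha₃, hα₂]
    have hlt : ∀ v < 6 * A.width, m₄.arr 2 v < M := fun v hv => by
      have h1 := hgs ⟨v, hv⟩
      have h2 : (s ⟨v, hv⟩ : ℕ) < 6 * A.width := (s ⟨v, hv⟩).2
      simp only at h1
      omega
    have hsol := solution_of_bigGame hs hgs
    set B := A.assumptionAutomaton (fun x => m₄.arr 2 x % A.width)
      (fun x => m₄.arr 2 (2 * A.width + x) % A.width)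
      (fun x => m₄.arr 2 (4 * A.width + x) / A.width = 0)
      (fun x => m₄.arr 2 (5 * A.width + x) / A.width = 2) with hB
    have hBlen : B.encode.length =
        2 + 2 * (A.n + 2) + 2 * (A.n + 2) * ((kI + kO) * (2 * (A.n + 2))) := length_encode _
    have hout := hM.out
    refine Runs.seq ((Runs.fill f 3 (outTableE kI kO) m₄ (fun i => B.encode.getD i 0)
      fun k hk g => ?_).mono (by rw [h41]) ?_)
    · have hα : ∀ i, Function.update m₄.arr 3 g 0 i = A.encode.getD i 0 := fun i => by
        rw [Function.update_of_ne (by decide), hα₄]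
      rw [outTableE, eval_ite, holds_lt, h41, eval_outLengthE hα hM, eval_var,
        Function.update_self, eval_const]
      split_ifs with h
      · rw [eval_outE hα hM (fun v hv => by
          rw [Function.update_of_ne (by decide)]; exact hlt v hv)
          (by rwa [Function.update_self]), Function.update_self]
        simp only [Function.update_of_ne (show 2 ≠ 3 by decide)]
        rfl
      · exact (List.getD_eq_default _ _ (by omega)).symm
    rintro m₅ ⟨⟨g₂, ha₅, hg₂⟩, hr₅⟩
    have h51 : m₅.reg 1 = M := by rw [hr₅ 1 (by omega) (by omega), h41]
    have hα₅ : ∀ i, m₅.arr 0 i = A.encode.getD i 0 := fun i => by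
      rw [ha₅, Function.update_of_ne (by decide), hα₄]
    refine Runs.seq ((Runs.assign f 5 (outLengthE kI kO) m₅).mono (by rw [h51]) ?_)
    rintro m₆ ⟨ha₆, hv₆, hr₆⟩
    rw [h51, eval_outLengthE hα₅ hM, ← hBlen] at hv₆
    have h61 : m₆.reg 1 = M := by rw [hr₆ 1 (by omega) (by omega), h51]
    refine Runs.seq ((Runs.fill f 0 (load 3 (var 0)) m₆ g₂ fun k hk g => ?_).mono
      (by rw [h61]) ?_)
    · rw [eval_load, eval_var, Function.update_self, Function.update_of_ne (by decide), ha₆, ha₅,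
        Function.update_self]
    rintro m₇ ⟨⟨g₃, ha₇, hg₃⟩, hr₇⟩
    refine Runs.copy ⟨_, _, _, _, _, hsol, ?_⟩
    rw [Mem.output, Mem.read, Mem.reg_setReg, if_pos rfl, hr₇ 5 (by omega) (by omega), hv₆]
    refine (eq_map_range rfl fun i hi => ?_).symm
    rw [Mem.arr_setReg, ha₇, Function.update_self, hg₃ i (by omega), hg₂ i (by omega)]
  · have h1 := eval_mono cubeE.cost hcM
    simp only [algorithmCost, Polynomial.eval_add, Polynomial.eval_one, Polynomial.eval_ofNat]
      at h1 ⊢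
    omega

/-- The algorithm is correct, and polynomial up to the time that it takes to solve a parity game of
polynomial size. -/
theorem algorithm_correct {f : List ℕ → List ℕ} {S : Prog} {T : ℕ → ℕ} (hS : SolvesGames f S T)
    (hT : Monotone T) (hI : 0 < kI) (hO : 0 < kO) {L : Set (ℕ → Fin kI × Fin kO)}
    (hA : A.Deterministic) (hAL : A.Recognises L) :
    ∃ (B : ParityAutomaton kI kO) (H : Set (ℕ → Fin kI × Fin kO)),
      OutputsWithin f (algorithm kI kO S) A.encode B.encode
        (((algorithmCost kI kO).comp (capPoly (kI + kO))).eval (size A.encode) +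
          T ((capPoly (kI + kO) + sizePoly (kI + kO)).eval (size A.encode))) ∧
      size B.encode ≤ (sizePoly (kI + kO)).eval (size A.encode) ∧
      B.Deterministic ∧ B.Recognises H ∧ IsEnsurableOptimal L H := by
  obtain ⟨m', t, he, ht, s₀, s₁, s₂, W, E, hsol, hout⟩ := A.runs_algorithm hS hI hO
  obtain ⟨H, hH, hopt⟩ := hsol.isEnsurableOptimal hI hO hA hAL
  have hcap := eval_mono (capPoly (kI + kO)) (length_le_size A.encode)
  refine ⟨_, H, ⟨m', t, he, ht.trans (Nat.add_le_add ?_ (hT ?_)), hout⟩,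
    A.size_encode_assumptionAutomaton_le _ _ _ _, A.deterministic_assumptionAutomaton _ _ _ _, hH,
    hopt⟩
  · rw [Polynomial.eval_comp]
    exact eval_mono _ hcap
  · rw [Polynomial.eval_add]
    exact Nat.add_le_add hcap (A.size_encode_bigGame_le hI hO)

end ParityAutomaton

end Ensurable

open Ensurable in
theorem mainTheorem4 (kI kO : ℕ) (hI : 0 < kI) (hO : 0 < kO) :
    (∃ P : Prog, P.OracleFree ∧ ∃ timeBound sizeBound : Polynomial ℕ,
      ∀ (A : ParityAutomaton kI kO) (L : Set (ℕ → Fin kI × Fin kO)),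
        A.Deterministic → A.Recognises L →
        ∃ (B : ParityAutomaton kI kO) (H : Set (ℕ → Fin kI × Fin kO)),
          OutputsWithin (fun _ => []) P A.encode B.encode
            (2 ^ timeBound.eval (size A.encode)) ∧
          size B.encode ≤ sizeBound.eval (size A.encode) ∧
          B.Deterministic ∧ B.Recognises H ∧ IsEnsurableOptimal L H) ∧
    (∃ P : Prog, ∃ timeBound sizeBound : Polynomial ℕ,
      ∀ f : List ℕ → List ℕ, IsParityOracle f →
      ∀ (A : ParityAutomaton kI kO) (L : Set (ℕ → Fin kI × Fin kO)),
        A.Deterministic → A.Recognises L →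
        ∃ (B : ParityAutomaton kI kO) (H : Set (ℕ → Fin kI × Fin kO)),
          OutputsWithin f P A.encode B.encode (timeBound.eval (size A.encode)) ∧
          size B.encode ≤ sizeBound.eval (size A.encode) ∧
          B.Deterministic ∧ B.Recognises H ∧ IsEnsurableOptimal L H) := by
  obtain ⟨c, hc⟩ : ∃ c, c =
    (ParityAutomaton.algorithmCost kI kO).comp (ParityAutomaton.capPoly (kI + kO)) := ⟨_, rfl⟩
  obtain ⟨g, hg⟩ : ∃ g, g =
    ParityAutomaton.capPoly (kI + kO) + ParityAutomaton.sizePoly (kI + kO) := ⟨_, rfl⟩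
  constructor
  · obtain ⟨r, hr⟩ := exists_eval_two_pow_le ParityGame.searchCost
    refine ⟨ParityAutomaton.algorithm kI kO ParityGame.search,
      ParityAutomaton.oracleFree_algorithm ParityGame.oracleFree_search,
      c + r.comp (g * g + 2 * g + 2) + 1, ParityAutomaton.sizePoly (kI + kO),
      fun A L hA hAL => ?_⟩
    obtain ⟨B, H, ⟨m', t, he, ht, hout⟩, hB⟩ := A.algorithm_correct
      (ParityGame.solvesGames_search _) (fun a b hab => eval_mono _
        (Nat.pow_le_pow_right (by norm_num) (by gcongr))) hI hO hA hAL
    refine ⟨B, H, ⟨m', t, he, ht.trans ?_, hout⟩, hB⟩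
    rw [← hc, ← hg]
    generalize size A.encode = z
    have h1 : c.eval z ≤ 2 ^ (c.eval z + (r.comp (g * g + 2 * g + 2)).eval z) :=
      Nat.lt_two_pow_self.le.trans (Nat.pow_le_pow_right (by norm_num) (Nat.le_add_right _ _))
    have h2 : ParityGame.searchCost.eval (2 ^ (g.eval z * g.eval z + 2 * g.eval z + 2)) ≤
        2 ^ (c.eval z + (r.comp (g * g + 2 * g + 2)).eval z) := by
      refine (hr _).trans (Nat.pow_le_pow_right (by norm_num) ?_)
      simp [Polynomial.eval_comp]
    refine (Nat.add_le_add h1 h2).trans (le_of_eq ?_)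
    rw [Polynomial.eval_add, Polynomial.eval_add, Polynomial.eval_one, pow_succ, mul_two]
  · refine ⟨ParityAutomaton.algorithm kI kO (.query 1 3 2 4), c + (2 * g + 1),
      ParityAutomaton.sizePoly (kI + kO), fun f hf A L hA hAL => ?_⟩
    have := A.algorithm_correct (solvesGames_query hf) (fun a b hab => by dsimp only; omega)
      hI hO hA hAL
    rw [← hc, ← hg] at this
    simpa using this
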